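/- Let $d\ge 2$, $\gamma>0$, $\tau\ge d-1$, $\rho>0$, $r_0>0$, write $|k|=|k_1|+\dots+|k_d|$ for $k\in\mathbb Z^d$ and $|\cdot|$ for the Euclidean (Hermitian) norm on $\mathbb R^d$ ($\mathbb C^d$), and let $DC(\tau,\gamma)$ be the set of $\omega\in\mathbb R^d$ with $|\omega\cdot k|\ge\gamma|k|^{-\tau}$ for all $k\in\mathbb Z^d\setminus\{0\}$. Let $H$ be a bounded holomorphic function on $\{\theta\in\mathbb C^d/\mathbb Z^d : |\mathrm{Im}\,\theta|<\rho\}\times\{I\in\mathbb C^d : |I|<r_0\}$, real for real arguments, with sup norm $|H|_{\rho,r_0}$, such that $H(\theta,I)=\omega\cdot I+O(|I|^2)$ with $\omega\in DC(\tau,\gamma)$. Let $N$ be the Birkhoff normal form of $H$: the formal power series in $I\in\mathbb R^d$ whose truncations $N_m$ (the terms of total degree at most $m$) satisfy, for every $m\ge 2$, $H\circ\Psi_m(\theta,I)=N_m(I)+O(|I|^{m+1})$ for some real-analytic exact-symplectic transformation $\Psi_m(\theta,I)=(\theta+O(|I|),I+O(|I|^2))$ defined near $\mathbb T^d\times\{0\}$.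 For $m\ge 1$ let $V_m\subseteq\mathbb R^d$ be the span of the vectors $\partial^\alpha\nabla N_m(0)$, $\alpha\in\mathbb N^d$; let $m^*\ge 1$ be the smallest integer such that $V_m=V_{m^*}$ for all $m\ge m^*$, and put $V=V_{m^*}$. For $c>0$ and $r>0$ put $m(r)=\lfloor c\,r^{-1/(\tau+1)}\rfloor$ and $N_r=N_{m(r)}$. Assume $2\le\dim V\le d-1$ (so that $m^*\ge 2$) and set $\bar\tau=(m^*-1)(d+1)+\tau+1$. Then there is $c_0>0$ such that for every $0<c\le c_0$ there are positive constants $C$, $r^*$, $\gamma^*$ such that for all $0<r<r^*$ and all $0<\bar\gamma<\gamma^*$ $$\mathrm{Leb}\big(\{I\in\mathbb R^d : |I|<2r,\ \nabla N_r(I)\notin DC(\bar\tau,\bar\gamma)\}\big)\le C\,\bar\gamma^{1/(m^*-1)}\,r^{d-1}.$$ Here $c_0$ depends only on $d,\gamma,\tau,\rho,r_0$, on $|H|_{\rho,r_0}$ (or an upper bound for it) and on the truncated normal form $N_{m^*}$, and $C,r^*,\gamma^*$ depend only on these data and on $c$. -/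

import Mathlib

open Filter Topology MeasureTheory Asymptotics

noncomputable section

namespace Birkhoff

/-- Real `d`-space with its Euclidean norm. -/
abbrev RSp (d : ℕ) : Type := EuclideanSpace ℝ (Fin d)

/-- Complex `d`-space with its Hermitian norm. -/
abbrev CSp (d : ℕ) : Type := EuclideanSpace ℂ (Fin d)

/-- The inclusion of real space into complex space. -/
def toC {d : ℕ} (x : RSp d) : CSp d := WithLp.toLp 2 fun i => (x i : ℂ)

/-- The vector of imaginary parts. -/
def imPart {d : ℕ} (z : CSp d) : RSp d := WithLp.toLp 2 fun i => (z i).im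

/-- An integer vector, seen as a real vector. -/
def intVec {d : ℕ} (k : Fin d → ℤ) : RSp d := WithLp.toLp 2 fun i => (k i : ℝ)

/-- The set `DC(τ, γ)` of Diophantine vectors, where integer vectors are measured in the
`ℓ¹` norm. -/
def DC (d : ℕ) (τ γ : ℝ) : Set (RSp d) :=
  {ω | ∀ k : Fin d → ℤ, k ≠ 0 →
    γ * (∑ i, |(k i : ℝ)|) ^ (-τ) ≤ |∑ i, ω i * (k i : ℝ)|}

/-- The lift to the universal cover `ℂ^d × ℂ^d` of the complex domain
`{|Im θ| < ρ} × {|I| < r}` of `(ℂ^d / ℤ^d) × ℂ^d`. -/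
def complexDomain (d : ℕ) (ρ r : ℝ) : Set (CSp d × CSp d) :=
  {z | ‖imPart z.1‖ < ρ ∧ ‖z.2‖ < r}

/-- The space of bounded holomorphic functions on the complex domain that are
`ℤ^d`-periodic in the angles and real at real points. -/
structure MemA (d : ℕ) (ρ r : ℝ) (H : CSp d × CSp d → ℂ) : Prop where
  holo : DifferentiableOn ℂ H (complexDomain d ρ r)
  periodic : ∀ z ∈ complexDomain d ρ r, ∀ k : Fin d → ℤ,
    H (z.1 + toC (intVec k), z.2) = H z
  bounded : BddAbove ((fun z => ‖H z‖) '' complexDomain d ρ r)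
  real : ∀ θ I : RSp d, ‖I‖ < r → (H (toC θ, toC I)).im = 0

/-- The sup norm `|H|_{ρ, r}` over the complex domain. -/
def supNorm (d : ℕ) (ρ r : ℝ) (H : CSp d × CSp d → ℂ) : ℝ :=
  sSup ((fun z => ‖H z‖) '' complexDomain d ρ r)

/-- The restriction of `H` to real arguments. -/
def realHam {d : ℕ} (H : CSp d × CSp d → ℂ) (p : RSp d × RSp d) : ℝ :=
  (H (toC p.1, toC p.2)).re

/-- The filter of points `(θ, I)` with `I → 0`, uniformly in the angles `θ`. -/
def zeroSection (d : ℕ) : Filter (RSp d × RSp d) := ⊤ ×ˢ 𝓝 (0 : RSp d)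

/-- `H(θ, I) = ω · I + O(|I|²)`, uniformly in `θ`. -/
def HasLinearPart {d : ℕ} (H : CSp d × CSp d → ℂ) (ω : RSp d) : Prop :=
  (fun p : RSp d × RSp d => realHam H p - ∑ i, ω i * p.2 i)
    =O[zeroSection d] fun p => ‖p.2‖ ^ 2

/-- `Ψ` is (the lift to `ℝ^d × ℝ^d` of) a real-analytic exact-symplectic transformation of
`𝕋^d × {|I| < s}` which is homotopic to the identity in the angles: with
`Ψ(θ, I) = (Θ, J)`, the one-form `J · dΘ - I · dθ` is the differential of a function `S`
on `𝕋^d × {|I| < s}`. -/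
structure IsExactSymplectic (d : ℕ) (s : ℝ) (Ψ : RSp d × RSp d → RSp d × RSp d) : Prop where
  analytic : AnalyticOnNhd ℝ Ψ (Set.univ ×ˢ Metric.ball 0 s)
  equivariant : ∀ θ I : RSp d, ‖I‖ < s → ∀ k : Fin d → ℤ,
    Ψ (θ + intVec k, I) = Ψ (θ, I) + (intVec k, 0)
  exact : ∃ S : RSp d × RSp d → ℝ,
    (∀ θ I : RSp d, ‖I‖ < s → ∀ k : Fin d → ℤ, S (θ + intVec k, I) = S (θ, I)) ∧
    ∀ p : RSp d × RSp d, ‖p.2‖ < s → DifferentiableAt ℝ S p ∧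
      ∀ v : RSp d × RSp d,
        fderiv ℝ S p v = inner ℝ (Ψ p).2 (fderiv ℝ Ψ p v).1 - inner ℝ p.2 v.1

/-- The truncation of a formal power series in `d` variables to total degree at most `m`. -/
def truncBNF {d : ℕ} (N : MvPowerSeries (Fin d) ℝ) (m : ℕ) : MvPolynomial (Fin d) ℝ :=
  MvPowerSeries.truncTotal (m + 1) N

/-- The value of a polynomial at a real vector. -/
def evalAt {d : ℕ} (P : MvPolynomial (Fin d) ℝ) (I : RSp d) : ℝ :=
  MvPolynomial.eval (fun i => I i) P

/-- `N` is the Birkhoff normal form of `H`: for every `m ≥ 2` there is an analytic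
exact-symplectic transformation `Ψ(θ, I) = (θ + O(|I|), I + O(|I|²))`, defined near `I = 0`,
such that `H ∘ Ψ (θ, I) = N_m(I) + O(|I|^{m+1})`, with `N_m` the truncation of `N` to degree
at most `m`. -/
def IsBNF {d : ℕ} (H : CSp d × CSp d → ℂ) (N : MvPowerSeries (Fin d) ℝ) : Prop :=
  ∀ m : ℕ, 2 ≤ m → ∃ (s : ℝ) (Ψ : RSp d × RSp d → RSp d × RSp d), 0 < s ∧
    IsExactSymplectic d s Ψ ∧
    (fun p => (Ψ p).1 - p.1) =O[zeroSection d] (fun p => ‖p.2‖) ∧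
    (fun p => (Ψ p).2 - p.2) =O[zeroSection d] (fun p => ‖p.2‖ ^ 2) ∧
    (fun p => realHam H (Ψ p) - evalAt (truncBNF N m) p.2)
      =O[zeroSection d] (fun p => ‖p.2‖ ^ (m + 1))

/-- The gradient map of a polynomial. -/
def grad {d : ℕ} (P : MvPolynomial (Fin d) ℝ) (I : RSp d) : RSp d :=
  WithLp.toLp 2 fun i => evalAt (MvPolynomial.pderiv i P) I

/-- The partial derivative `∂^α` of a polynomial. -/
def multiDeriv {d : ℕ} (α : Fin d → ℕ) (P : MvPolynomial (Fin d) ℝ) :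
    MvPolynomial (Fin d) ℝ :=
  (List.finRange d).foldr (fun j Q => (MvPolynomial.pderiv j)^[α j] Q) P

/-- The space `V_m` spanned by all partial derivatives at the origin of the gradient of
`N_m`; as differentiation is componentwise, `grad (∂^α P) = ∂^α (grad P)`. -/
def freqSpace {d : ℕ} (N : MvPowerSeries (Fin d) ℝ) (m : ℕ) : Submodule ℝ (RSp d) :=
  Submodule.span ℝ
    (Set.range fun α : Fin d → ℕ => grad (multiDeriv α (truncBNF N m)) 0)

/-- The smallest `m ≥ 1` from which on the spaces `V_m` are constant. -/
def mStar {d : ℕ} (N : MvPowerSeries (Fin d) ℝ) : ℕ :=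
  sInf {m : ℕ | 1 ≤ m ∧ ∀ n, m ≤ n → freqSpace N n = freqSpace N m}

/-- The stationary value `V` of the spaces `V_m`. -/
def freqSpaceLim {d : ℕ} (N : MvPowerSeries (Fin d) ℝ) : Submodule ℝ (RSp d) :=
  freqSpace N (mStar N)

/-- The order of truncation `m(r) = [c r^{-a}]`, with `a = 1/(τ+1)`. -/
def truncOrder (c τ r : ℝ) : ℕ := ⌊c * r ^ (-(1 / (τ + 1)))⌋₊

end Birkhoff

end

/-! Two estimates carry the theorem: the coefficients of the normal form grow at most at a Gevrey
rate, and a non-degenerate polynomial map rarely comes close to a resonance.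

Growth (`exists_growth_bound`). Look for a generating function with H(θ, I + ∂S(θ, I)) = n(I), the
derivative being in θ. As H = ω·I + O(|I|²), each degree in I gives a homological equation ω·∂S_j +
F_j = n_j with F_j built from lower degrees. The Diophantine condition solves it at the price of a
width σ of the complex strip and a factor of order σ^{-(τ+1)}. If m degrees are wanted, σ = s/m
makes every degree cost at most B m^{τ+1}, so the part of degree m is bounded by (B m^{τ+1})^{m-1}
(`exists_formal_solution`). This part is that of N: the torus Ψ_m(𝕋^d × {I}) and the graph of I + ∂S
are Lagrangian tori of the same class, so they intersect (`exists_intersection`), and the value of H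
at a common point is both N_m(I) and n(I), up to O(|I|^{m+1}). No normalizing transformation has to
be composed or estimated.

Measure (`exists_measure_bound_of_growth`). Both ω and every ∇N_r(I) lie in V, so an integer vector
k acts only through its projection w to V, and |ω·k| = |ω·w| bounds |w| from below. By compactness,
for each unit u in V some directional derivative of order j < m* of u·∇N_{m*} is at least σ at the
origin (`exists_dirDeriv_lower_bound`). Since m(r)^{τ+1} r ≤ c^{τ+1}, the higher terms of N_r are
dominated by a geometric series on |I| ≤ 6r, and σ/2 survives there (`abs_evalAt_truncBNF_sub_le`).
Such a function is below ε only on a set of length of order (ε/σ)^{1/(m*-1)} on each segment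
(`volume_sublevel_le`). Fubini adds the factor r^{d-1}, and the exponent in the Diophantine
condition is what makes the sum over k converge. -/

namespace Birkhoff

/-! ### Sublevel sets of functions with a large derivative -/

/-- If a function is smaller than `ε` at `2 ^ j` points with gaps at least `δ`, then its `j`-th
derivative is smaller than `ε * (2 / δ) ^ j` somewhere between them. -/
theorem exists_deriv_lt_of_separated (j : ℕ) : ∀ (F : ℕ → ℝ → ℝ)
    (_ : ∀ i t, HasDerivAt (F i) (F (i + 1) t) t) (a b ε δ : ℝ) (_ : 0 < δ) (t : ℕ → ℝ)
    (_ : ∀ i < 2 ^ j, t i ∈ Set.Icc a b ∧ |F 0 (t i)| < ε)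
    (_ : ∀ i, i + 1 < 2 ^ j → t i + δ ≤ t (i + 1)),
    ∃ x ∈ Set.Icc a b, |F j x| < ε * (2 / δ) ^ j := by
  induction j with
  | zero =>
    intro F _ a b ε δ _ t ht _
    exact ⟨t 0, (ht 0 (by simp)).1, by simpa using (ht 0 (by simp)).2⟩
  | succ j ih =>
    intro F hF a b ε δ hδ t ht hsep
    -- The points are paired as (2i, 2i+1) and the mean value theorem is applied in each pair. This
    -- halves their number, and the gap between pairs keeps the new points δ-separated, so the
    -- induction can go on with the derivative.
    have key : ∀ i, ∃ x, i < 2 ^ j → (x ∈ Set.Ioo (t (2 * i)) (t (2 * i + 1)) ∧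
        |F 1 x| < ε * (2 / δ)) := by
      intro i
      by_cases hi : i < 2 ^ j
      · have hi1 : 2 * i + 1 < 2 ^ (j + 1) := by rw [pow_succ]; omega
        have hs := hsep (2 * i) hi1
        obtain ⟨c, hc, hc'⟩ := exists_hasDerivAt_eq_slope (F 0) (F 1)
          (show t (2 * i) < t (2 * i + 1) by linarith)
          (fun x _ => (hF 0 x).continuousAt.continuousWithinAt) (fun x _ => hF 0 x)
        refine ⟨c, fun _ => ⟨hc, ?_⟩⟩
        have h1 := (ht (2 * i) (by omega)).2
        have h2 := (ht (2 * i + 1) hi1).2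
        have h3 : |F 0 (t (2 * i + 1)) - F 0 (t (2 * i))| < 2 * ε := by
          rw [abs_lt] at *; constructor <;> linarith
        rw [hc', abs_div, abs_of_pos (by linarith : 0 < t (2 * i + 1) - t (2 * i))]
        rw [div_lt_iff₀ (by linarith)]
        have hε : 0 < ε := lt_of_le_of_lt (abs_nonneg _) h1
        calc |F 0 (t (2 * i + 1)) - F 0 (t (2 * i))| < 2 * ε := h3
          _ = ε * (2 / δ) * δ := by field_simp
          _ ≤ _ := by gcongr; linarith
      · exact ⟨0, fun h => absurd h hi⟩
    choose x hx using key
    obtain ⟨y, hy, hy'⟩ := ih (fun i => F (i + 1)) (fun i t => hF (i + 1) t) a b (ε * (2 / δ)) δ hδ x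
      (fun i hi => ⟨⟨(ht (2 * i) (by rw [pow_succ]; omega)).1.1.trans (hx i hi).1.1.le,
        (hx i hi).1.2.le.trans (ht (2 * i + 1) (by rw [pow_succ]; omega)).1.2⟩, (hx i hi).2⟩)
      (fun i hi => by
        have h1 := (hx i (by omega)).1.2
        have h2 := (hx (i + 1) hi).1.1
        have h3 := hsep (2 * i + 1) (by rw [pow_succ]; omega)
        have : 2 * (i + 1) = 2 * i + 1 + 1 := by ring
        rw [this] at h2
        linarith)
    exact ⟨y, hy, by rw [pow_succ']; simpa [mul_assoc] using hy'⟩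

/-- A set of reals without `n` points that are pairwise at distance at least `δ` has measure at
most `2 * n * δ`. -/
theorem volume_le_of_no_separated (E : Set ℝ) (n : ℕ) (δ : ℝ) (hδ : 0 < δ)
    (h : ∀ t : ℕ → ℝ, (∀ i < n, t i ∈ E) → (∀ i, i + 1 < n → t i + δ ≤ t (i + 1)) → False) :
    volume E ≤ ENNReal.ofReal (2 * n * δ) := by
  classical
  let p : ℕ → Prop := fun k => ∃ T : Finset ℝ, (T : Set ℝ) ⊆ E ∧
    (∀ x ∈ T, ∀ y ∈ T, x < y → x + δ ≤ y) ∧ T.card = k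
  have hb : ∀ k, p k → k < n := by
    rintro k ⟨T, hT, hsep, hk⟩
    by_contra hkn
    push Not at hkn
    refine h (fun i => if hi : i < k then T.orderEmbOfFin hk ⟨i, hi⟩ else 0) ?_ ?_
    · intro i hi
      simp only [show i < k by omega, dif_pos]
      exact hT (T.orderEmbOfFin_mem hk _)
    · intro i hi
      simp only [show i < k by omega, show i + 1 < k by omega, dif_pos]
      refine hsep _ (T.orderEmbOfFin_mem hk _) _ (T.orderEmbOfFin_mem hk _) ?_
      exact (T.orderEmbOfFin hk).strictMono (by simp [Fin.lt_def])
  have h0 : p 0 := ⟨∅, by simp, by simp, by simp⟩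
  -- A δ-separated subset of maximal cardinality: by maximality the intervals of radius δ around its
  -- points cover the set.
  have hg : p (Nat.findGreatest p n) := Nat.findGreatest_spec (Nat.zero_le n) h0
  obtain ⟨T, hT, hsep, hk⟩ := hg
  have hTn : T.card ≤ n := hk ▸ Nat.findGreatest_le n
  have hcov : E ⊆ ⋃ x ∈ T, Set.Icc (x - δ) (x + δ) := by
    intro y hy
    by_contra hy'
    simp only [Set.mem_iUnion, Set.mem_Icc, not_exists, not_and, not_le] at hy'
    have hfar : ∀ x ∈ T, y + δ ≤ x ∨ x + δ ≤ y := by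
      intro x hx
      by_cases h1 : x - δ ≤ y
      · exact Or.inr (hy' x hx h1).le
      · left; linarith
    have hyT : y ∉ T := fun hyT => by rcases hfar y hyT with h | h <;> linarith
    have : p (T.card + 1) := by
      refine ⟨insert y T, ?_, ?_, Finset.card_insert_of_notMem hyT⟩
      · rw [Finset.coe_insert]; exact Set.insert_subset hy hT
      · intro x hx z hz hxz
        rw [Finset.mem_insert] at hx hz
        rcases hx with rfl | hx <;> rcases hz with rfl | hz
        · exact absurd hxz (lt_irrefl _)
        · rcases hfar z hz with h | h <;> linarith
        · rcases hfar x hx with h | h <;> linarith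
        · exact hsep x hx z hz hxz
    have h1 := hb _ this
    have h2 : T.card + 1 ≤ Nat.findGreatest p n := Nat.le_findGreatest h1.le this
    omega
  calc volume E ≤ volume (⋃ x ∈ T, Set.Icc (x - δ) (x + δ)) := measure_mono hcov
    _ ≤ ∑ x ∈ T, volume (Set.Icc (x - δ) (x + δ)) := measure_biUnion_finset_le _ _
    _ = ∑ x ∈ T, ENNReal.ofReal (2 * δ) := by
        refine Finset.sum_congr rfl fun x _ => ?_
        rw [Real.volume_Icc]; congr 1; ring
    _ = ENNReal.ofReal (2 * T.card * δ) := by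
        rw [Finset.sum_const, nsmul_eq_mul, ← ENNReal.ofReal_natCast,
          ← ENNReal.ofReal_mul (by positivity)]
        congr 1; ring
    _ ≤ _ := by
        apply ENNReal.ofReal_le_ofReal
        have : (T.card : ℝ) ≤ n := by exact_mod_cast hTn
        gcongr

/-- Measure of a sublevel set of a function one of whose derivatives is bounded below. -/
theorem volume_sublevel_le (j : ℕ) (F : ℕ → ℝ → ℝ)
    (hF : ∀ i t, HasDerivAt (F i) (F (i + 1) t) t) (a b ε δ : ℝ) (hδ : 0 < δ)
    (hlow : ∀ x ∈ Set.Icc a b, ε * (2 / δ) ^ j ≤ |F j x|) :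
    volume {t | t ∈ Set.Icc a b ∧ |F 0 t| < ε} ≤ ENNReal.ofReal (2 * 2 ^ j * δ) := by
  have := volume_le_of_no_separated {t | t ∈ Set.Icc a b ∧ |F 0 t| < ε} (2 ^ j) δ hδ
    (fun t ht hsep => by
      obtain ⟨x, hx, hx'⟩ := exists_deriv_lt_of_separated j F hF a b ε δ hδ t ht hsep
      exact absurd (hlow x hx) (not_le.mpr hx'))
  simpa using this

/-- Slicing along a direction `e`: if all segments of length `2 * r` in direction `e` meet a subset
of the ball of radius `2 * r` in measure at most `δ`, then the measure of that subset is bounded. -/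
theorem volume_le_of_slices {d : ℕ} (hd : 0 < d) (E : Set (RSp d)) (hE : MeasurableSet E)
    (r δ : ℝ) (hr : 0 < r)
    (hEr : E ⊆ Metric.ball 0 (2 * r)) (e : RSp d) (he : ‖e‖ ≤ 1)
    (hs : ∀ x : RSp d, ‖x‖ < 4 * r →
      volume {t : ℝ | t ∈ Set.Icc 0 (2 * r) ∧ x + t • e ∈ E} ≤ ENNReal.ofReal δ) :
    volume E ≤ ENNReal.ofReal (δ * (4 ^ d * r ^ (d - 1))) *
      volume (Metric.ball (0 : RSp d) 1) := by
  have : Nonempty (Fin d) := ⟨⟨0, hd⟩⟩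
  have hmeas : Measurable (fun p : ℝ × RSp d => E.indicator (fun _ => (1 : ENNReal)) (p.2 + p.1 • e)) :=
    (measurable_const.indicator hE).comp (by fun_prop)
  -- Instead of decomposing space along `e`, average over all translates: each translate has the
  -- same volume, and after exchanging the integrals the inner one is the length of a slice.
  have h1 : ∫⁻ t in Set.Icc (0 : ℝ) (2 * r), ∫⁻ x : RSp d, E.indicator (fun _ => (1 : ENNReal)) (x + t • e)
      = ENNReal.ofReal (2 * r) * volume E := by
    have : ∀ t : ℝ, ∫⁻ x : RSp d, E.indicator (fun _ => (1 : ENNReal)) (x + t • e) = volume E := by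
      intro t
      rw [lintegral_add_right_eq_self (fun x => E.indicator (fun _ => (1 : ENNReal)) x) (t • e)]
      rw [lintegral_indicator hE]; simp
    simp only [this]
    rw [setLIntegral_const, Real.volume_Icc, mul_comm]; simp
  have h2 : ∫⁻ t in Set.Icc (0 : ℝ) (2 * r), ∫⁻ x : RSp d, E.indicator (fun _ => (1 : ENNReal)) (x + t • e)
      = ∫⁻ x : RSp d, ∫⁻ t in Set.Icc (0 : ℝ) (2 * r), E.indicator (fun _ => (1 : ENNReal)) (x + t • e) :=
    lintegral_lintegral_swap hmeas.aemeasurable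
  have h3 : ∀ x : RSp d, ∫⁻ t in Set.Icc (0 : ℝ) (2 * r), E.indicator (fun _ => (1 : ENNReal)) (x + t • e)
      ≤ (Metric.ball (0 : RSp d) (4 * r)).indicator (fun _ => ENNReal.ofReal δ) x := by
    intro x
    have hset : MeasurableSet {t : ℝ | x + t • e ∈ E} := by
      have : Measurable fun t : ℝ => x + t • e := by fun_prop
      exact this hE
    have hEq : ∫⁻ t in Set.Icc (0 : ℝ) (2 * r), E.indicator (fun _ => (1 : ENNReal)) (x + t • e) =
        volume {t : ℝ | t ∈ Set.Icc 0 (2 * r) ∧ x + t • e ∈ E} := by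
      have : (fun t : ℝ => E.indicator (fun _ => (1 : ENNReal)) (x + t • e)) =
          {t : ℝ | x + t • e ∈ E}.indicator (fun _ => (1 : ENNReal)) := by
        ext t; simp [Set.indicator]
      rw [this, lintegral_indicator hset]
      rw [setLIntegral_const, one_mul, Measure.restrict_apply hset]
      congr 1; ext t; simp [and_comm]
    rw [hEq]
    by_cases hx : ‖x‖ < 4 * r
    · rw [Set.indicator_of_mem (by simpa using hx)]
      exact hs x hx
    · have : {t : ℝ | t ∈ Set.Icc 0 (2 * r) ∧ x + t • e ∈ E} = ∅ := by
        ext t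
        simp only [Set.mem_ofPred_eq, Set.mem_Icc, Set.mem_empty_iff_false, iff_false, not_and]
        rintro ⟨ht0, ht1⟩ hmem
        have h4 := hEr hmem
        rw [mem_ball_zero_iff] at h4
        apply hx
        calc ‖x‖ = ‖(x + t • e) - t • e‖ := by simp
          _ ≤ ‖x + t • e‖ + ‖t • e‖ := norm_sub_le _ _
          _ < 2 * r + 2 * r := by
            refine add_lt_add_of_lt_of_le h4 ?_
            rw [norm_smul, Real.norm_of_nonneg ht0]
            nlinarith [norm_nonneg e]
          _ = 4 * r := by ring
      rw [this]; simp
  have h4 : ENNReal.ofReal (2 * r) * volume E ≤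
      ENNReal.ofReal δ * (ENNReal.ofReal ((4 * r) ^ d) * volume (Metric.ball (0 : RSp d) 1)) := by
    rw [← h1, h2]
    refine (lintegral_mono h3).trans ?_
    rw [lintegral_indicator measurableSet_ball, setLIntegral_const,
      Measure.addHaar_ball volume (0 : RSp d) (by positivity : (0 : ℝ) ≤ 4 * r)]
    simp
  -- Dividing the volume (4r)^d by the length of the segment leaves r^{d-1}; the factor 2 is given
  -- away.
  have h5 : ENNReal.ofReal r * volume E ≤ ENNReal.ofReal r *
      (ENNReal.ofReal (δ * (4 ^ d * r ^ (d - 1))) * volume (Metric.ball (0 : RSp d) 1)) := by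
    calc ENNReal.ofReal r * volume E ≤ ENNReal.ofReal (2 * r) * volume E := by
          gcongr; linarith
      _ ≤ _ := h4
      _ = _ := by
        rw [← mul_assoc, ← mul_assoc, ← ENNReal.ofReal_mul hr.le,
          ← ENNReal.ofReal_mul' (by positivity)]
        congr 2
        obtain ⟨k, rfl⟩ : ∃ k, d = k + 1 := ⟨d - 1, by omega⟩
        simp only [Nat.add_sub_cancel]; ring
  exact (ENNReal.mul_le_mul_iff_right (by simpa using hr) (by simp)).1 h5

/-! ### Directional derivatives of polynomials -/

/-- The derivative of a polynomial in the direction `e`. -/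
noncomputable def dirDeriv {d : ℕ} (e : RSp d) :
    MvPolynomial (Fin d) ℝ →ₗ[ℝ] MvPolynomial (Fin d) ℝ :=
  ∑ l, e l • (MvPolynomial.pderiv (R := ℝ) l).toLinearMap

theorem dirDeriv_apply {d : ℕ} (e : RSp d) (F : MvPolynomial (Fin d) ℝ) :
    dirDeriv e F = ∑ l, e l • MvPolynomial.pderiv l F := by
  simp [dirDeriv]

theorem evalAt_dirDeriv {d : ℕ} (e : RSp d) (F : MvPolynomial (Fin d) ℝ) (x : RSp d) :
    evalAt (dirDeriv e F) x = ∑ l, e l * evalAt (MvPolynomial.pderiv l F) x := by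
  simp [dirDeriv_apply, evalAt, MvPolynomial.smul_eval]

theorem evalAt_dirDeriv_eq_inner {d : ℕ} (e : RSp d) (F : MvPolynomial (Fin d) ℝ) (x : RSp d) :
    evalAt (dirDeriv e F) x = inner ℝ e (grad F x) := by
  rw [evalAt_dirDeriv]
  simp [grad, PiLp.inner_apply, mul_comm]

theorem dirDeriv_smul_left {d : ℕ} (c : ℝ) (e : RSp d) (F : MvPolynomial (Fin d) ℝ) :
    dirDeriv (c • e) F = c • dirDeriv e F := by
  simp [dirDeriv_apply, Finset.smul_sum, mul_smul]

/-- Turns the algebraic iterates of `dirDeriv e` into successive derivatives along a line, as the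
sublevel estimate requires. -/
theorem hasDerivAt_evalAt_line {d : ℕ} (x e : RSp d) (F : MvPolynomial (Fin d) ℝ) (t : ℝ) :
    HasDerivAt (fun t : ℝ => evalAt F (x + t • e)) (evalAt (dirDeriv e F) (x + t • e)) t := by
  induction F using MvPolynomial.induction_on with
  | C a =>
    have : dirDeriv e (MvPolynomial.C a) = 0 := by simp [dirDeriv_apply]
    simpa [evalAt, this] using hasDerivAt_const t a
  | add p q hp hq =>
    simp only [map_add, evalAt] at hp hq ⊢
    exact hp.add hq
  | mul_X p i hp =>
    have hX : HasDerivAt (fun t : ℝ => (x + t • e) i) (e i) t := by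
      simpa using ((hasDerivAt_id t).mul_const (e i)).const_add (x i)
    have h := hp.mul hX
    have e1 : (fun t : ℝ => evalAt (p * MvPolynomial.X i) (x + t • e)) =
        (fun t : ℝ => evalAt p (x + t • e)) * fun t : ℝ => (x + t • e) i := by
      ext t; simp [evalAt]
    rw [e1]
    refine h.congr_deriv ?_
    rw [evalAt_dirDeriv, evalAt_dirDeriv]
    simp only [MvPolynomial.pderiv_mul, MvPolynomial.pderiv_X, evalAt, map_add,
      map_mul, MvPolynomial.eval_X, mul_add, Finset.sum_add_distrib]
    congr 1
    · rw [Finset.sum_mul]; exact Finset.sum_congr rfl fun l _ => by ring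
    · rw [Finset.sum_eq_single i]
      · simp [mul_comm]
      · intro b _ hb; simp [hb.symm]
      · simp

/-- The sum of the absolute values of the coefficients. -/
noncomputable def coeffNorm {d : ℕ} (F : MvPolynomial (Fin d) ℝ) : ℝ :=
  ∑ α ∈ F.support, |F.coeff α|

theorem coeffNorm_eq_sum {d : ℕ} (F : MvPolynomial (Fin d) ℝ) (s : Finset (Fin d →₀ ℕ))
    (h : F.support ⊆ s) : coeffNorm F = ∑ α ∈ s, |F.coeff α| :=
  Finset.sum_subset h fun α _ hα => by simp [MvPolynomial.notMem_support_iff.1 hα]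

theorem coeffNorm_nonneg {d : ℕ} (F : MvPolynomial (Fin d) ℝ) : 0 ≤ coeffNorm F :=
  Finset.sum_nonneg fun _ _ => abs_nonneg _

theorem coeffNorm_add_le {d : ℕ} (F G : MvPolynomial (Fin d) ℝ) :
    coeffNorm (F + G) ≤ coeffNorm F + coeffNorm G := by
  classical
  rw [coeffNorm_eq_sum (F + G) _ MvPolynomial.support_add,
    coeffNorm_eq_sum F _ Finset.subset_union_left,
    coeffNorm_eq_sum G _ Finset.subset_union_right, ← Finset.sum_add_distrib]
  exact Finset.sum_le_sum fun α _ => by rw [MvPolynomial.coeff_add]; exact abs_add_le _ _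

theorem coeffNorm_zero {d : ℕ} : coeffNorm (0 : MvPolynomial (Fin d) ℝ) = 0 := by simp [coeffNorm]

theorem coeffNorm_sum_le {d : ℕ} {ι : Type*} (s : Finset ι) (F : ι → MvPolynomial (Fin d) ℝ) :
    coeffNorm (∑ i ∈ s, F i) ≤ ∑ i ∈ s, coeffNorm (F i) := by
  classical
  induction s using Finset.induction_on with
  | empty => simp [coeffNorm_zero]
  | insert a s ha ih =>
    rw [Finset.sum_insert ha, Finset.sum_insert ha]
    exact (coeffNorm_add_le _ _).trans (by gcongr)

theorem coeffNorm_monomial {d : ℕ} (α : Fin d →₀ ℕ) (c : ℝ) :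
    coeffNorm (MvPolynomial.monomial α c) = |c| := by
  rw [coeffNorm_eq_sum _ {α} MvPolynomial.support_monomial_subset]
  simp

theorem abs_evalAt_monomial_le {d : ℕ} (α : Fin d →₀ ℕ) (c : ℝ) (x : RSp d) :
    |evalAt (MvPolynomial.monomial α c) x| ≤ |c| * ‖x‖ ^ α.degree := by
  rw [evalAt, MvPolynomial.eval_monomial, abs_mul]
  gcongr
  rw [Finsupp.prod, Finset.abs_prod, Finsupp.degree_apply, ← Finset.prod_pow_eq_pow_sum]
  refine Finset.prod_le_prod (fun _ _ => abs_nonneg _) fun i _ => ?_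
  rw [abs_pow]
  gcongr
  exact PiLp.norm_apply_le x i

theorem abs_evalAt_le {d : ℕ} (F : MvPolynomial (Fin d) ℝ) (p : ℕ) (hF : F.IsHomogeneous p)
    (x : RSp d) : |evalAt F x| ≤ coeffNorm F * ‖x‖ ^ p := by
  have h : evalAt F x = ∑ α ∈ F.support, evalAt (MvPolynomial.monomial α (F.coeff α)) x := by
    simp only [evalAt]
    rw [← map_sum, ← F.as_sum]
  rw [h, coeffNorm, Finset.sum_mul]
  refine (Finset.abs_sum_le_sum_abs _ _).trans (Finset.sum_le_sum fun α hα => ?_)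
  refine (abs_evalAt_monomial_le _ _ _).trans_eq ?_
  have := hF (MvPolynomial.mem_support_iff.1 hα)
  rw [← this, Finsupp.degree_eq_weight_one]
  rfl

theorem isHomogeneous_dirDeriv {d : ℕ} (e : RSp d) (F : MvPolynomial (Fin d) ℝ) (p : ℕ)
    (hF : F.IsHomogeneous p) : (dirDeriv e F).IsHomogeneous (p - 1) := by
  rw [dirDeriv_apply]
  refine MvPolynomial.IsHomogeneous.sum _ _ _ fun l _ => ?_
  rw [MvPolynomial.smul_eq_C_mul]
  exact (hF.pderiv).C_mul _

/-- A monomial of exponent α contributes at most ∑ α_l = p times its coefficient. The ℓ¹ norm of the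
coefficients thus loses only the degree, with no constant depending on the dimension. -/
theorem coeffNorm_dirDeriv_le {d : ℕ} (e : RSp d) (he : ‖e‖ ≤ 1) (F : MvPolynomial (Fin d) ℝ)
    (p : ℕ) (hF : F.IsHomogeneous p) : coeffNorm (dirDeriv e F) ≤ p * coeffNorm F := by
  have h : dirDeriv e F = ∑ α ∈ F.support, dirDeriv e (MvPolynomial.monomial α (F.coeff α)) := by
    conv_lhs => rw [F.as_sum]
    rw [map_sum]
  rw [h]
  refine (coeffNorm_sum_le _ _).trans ?_
  rw [coeffNorm, Finset.mul_sum]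
  refine Finset.sum_le_sum fun α hα => ?_
  rw [dirDeriv_apply]
  refine (coeffNorm_sum_le _ _).trans ?_
  have hdeg : α.degree = p := by
    rw [← hF (MvPolynomial.mem_support_iff.1 hα), Finsupp.degree_eq_weight_one]; rfl
  have hp : (p : ℝ) = ∑ l, (α l : ℝ) := by
    rw [← hdeg, Finsupp.degree_eq_sum]; push_cast; rfl
  rw [hp, Finset.sum_mul]
  refine Finset.sum_le_sum fun l _ => ?_
  rw [MvPolynomial.pderiv_monomial, MvPolynomial.smul_monomial, coeffNorm_monomial, smul_eq_mul,
    abs_mul, abs_mul, Nat.abs_cast]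
  have h1 : |e l| ≤ 1 := (PiLp.norm_apply_le e l).trans he
  calc |e l| * (|F.coeff α| * (α l : ℝ)) ≤ 1 * (|F.coeff α| * (α l : ℝ)) := by gcongr
    _ = _ := by ring

theorem isHomogeneous_dirDeriv_iterate {d : ℕ} (e : RSp d) (F : MvPolynomial (Fin d) ℝ) (p j : ℕ)
    (hF : F.IsHomogeneous p) : ((dirDeriv e)^[j] F).IsHomogeneous (p - j) := by
  induction j with
  | zero => simpa using hF
  | succ j ih =>
    rw [Function.iterate_succ_apply']
    simpa [Nat.sub_sub] using isHomogeneous_dirDeriv e _ _ ih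

theorem coeffNorm_dirDeriv_iterate_le {d : ℕ} (e : RSp d) (he : ‖e‖ ≤ 1)
    (F : MvPolynomial (Fin d) ℝ) (p j : ℕ) (hF : F.IsHomogeneous p) :
    coeffNorm ((dirDeriv e)^[j] F) ≤ p ^ j * coeffNorm F := by
  induction j with
  | zero => simp
  | succ j ih =>
    rw [Function.iterate_succ_apply']
    refine (coeffNorm_dirDeriv_le e he _ _ (isHomogeneous_dirDeriv_iterate e F p j hF)).trans ?_
    rw [pow_succ', mul_assoc]
    have : ((p - j : ℕ) : ℝ) ≤ p := by exact_mod_cast Nat.sub_le _ _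
    have := coeffNorm_nonneg ((dirDeriv e)^[j] F)
    gcongr

theorem dirDeriv_eq_zero_of_isHomogeneous_zero {d : ℕ} (e : RSp d) (F : MvPolynomial (Fin d) ℝ)
    (hF : F.IsHomogeneous 0) : dirDeriv e F = 0 := by
  have h := MvPolynomial.totalDegree_eq_zero_iff_eq_C.1
    (Nat.le_zero.1 hF.totalDegree_le)
  rw [h, dirDeriv_apply]; simp

/-- The variation of an iterated directional derivative of a homogeneous polynomial between the
origin and a point `x`. -/
theorem abs_evalAt_dirDeriv_iterate_sub_le {d : ℕ} (e u : RSp d) (he : ‖e‖ ≤ 1) (hu : ‖u‖ ≤ 1)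
    (F : MvPolynomial (Fin d) ℝ) (p j : ℕ) (hF : F.IsHomogeneous p) (x : RSp d) :
    |evalAt ((dirDeriv e)^[j] (dirDeriv u F)) x - evalAt ((dirDeriv e)^[j] (dirDeriv u F)) 0| ≤
      if j + 2 ≤ p then (p : ℝ) ^ (j + 1) * coeffNorm F * ‖x‖ ^ (p - (j + 1)) else 0 := by
  have hG : ((dirDeriv e)^[j] (dirDeriv u F)).IsHomogeneous (p - (j + 1)) := by
    have := isHomogeneous_dirDeriv_iterate e _ (p - 1) j (isHomogeneous_dirDeriv u F p hF)
    rwa [Nat.sub_sub, add_comm] at this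
  split_ifs with hp
  · have h0 : evalAt ((dirDeriv e)^[j] (dirDeriv u F)) 0 = 0 := by
      have := abs_evalAt_le _ _ hG 0
      rw [norm_zero, zero_pow (by omega), mul_zero] at this
      exact abs_nonpos_iff.1 this
    rw [h0, sub_zero]
    refine (abs_evalAt_le _ _ hG x).trans ?_
    gcongr
    refine (coeffNorm_dirDeriv_iterate_le e he _ (p - 1) j (isHomogeneous_dirDeriv u F p hF)).trans ?_
    rw [pow_succ, mul_assoc]
    have h1 : ((p - 1 : ℕ) : ℝ) ≤ p := by exact_mod_cast Nat.sub_le _ _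
    have := coeffNorm_nonneg (dirDeriv u F)
    gcongr
    exact coeffNorm_dirDeriv_le u hu F p hF
  -- For p ≤ j + 1 the differentiated polynomial is constant and does not vary at all.
  · have hd0 : p - (j + 1) = 0 := by omega
    rw [hd0] at hG
    rw [MvPolynomial.totalDegree_eq_zero_iff_eq_C.1 (Nat.le_zero.1 hG.totalDegree_le)]
    simp [evalAt]

/-! ### Derivatives at the origin determine a polynomial -/

/-- The factor is a product of factorial type, but only its positivity is needed to recover a
coefficient from a derivative. -/
theorem coeff_pderiv_iterate {d : ℕ} (i : Fin d) (n : ℕ) (F : MvPolynomial (Fin d) ℝ)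
    (β : Fin d →₀ ℕ) : ∃ c : ℝ, 0 < c ∧
      MvPolynomial.coeff β ((MvPolynomial.pderiv i)^[n] F) =
        c * MvPolynomial.coeff (β + Finsupp.single i n) F := by
  induction n generalizing β with
  | zero => exact ⟨1, one_pos, by simp⟩
  | succ n ih =>
    obtain ⟨c, hc, h⟩ := ih (β + Finsupp.single i 1)
    refine ⟨c * (β i + 1), by positivity, ?_⟩
    rw [Function.iterate_succ_apply', MvPolynomial.coeff_pderiv, h, add_assoc,
      ← Finsupp.single_add, add_comm 1 n]
    ring

theorem coeff_foldr_pderiv {d : ℕ} (α : Fin d → ℕ) (L : List (Fin d))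
    (F : MvPolynomial (Fin d) ℝ) (β : Fin d →₀ ℕ) : ∃ c : ℝ, 0 < c ∧
      MvPolynomial.coeff β (L.foldr (fun j Q => (MvPolynomial.pderiv j)^[α j] Q) F) =
        c * MvPolynomial.coeff (β + (L.map fun j => Finsupp.single j (α j)).sum) F := by
  induction L generalizing β with
  | nil => exact ⟨1, one_pos, by simp⟩
  | cons a L ih =>
    obtain ⟨c, hc, h⟩ := coeff_pderiv_iterate a (α a)
      (L.foldr (fun j Q => (MvPolynomial.pderiv j)^[α j] Q) F) β
    obtain ⟨c', hc', h'⟩ := ih (β + Finsupp.single a (α a))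
    refine ⟨c * c', by positivity, ?_⟩
    rw [List.foldr_cons, h, h', List.map_cons, List.sum_cons, add_assoc, mul_assoc]

theorem evalAt_zero {d : ℕ} (F : MvPolynomial (Fin d) ℝ) :
    evalAt F 0 = MvPolynomial.coeff 0 F := by
  rw [evalAt, ← MvPolynomial.constantCoeff_eq, ← MvPolynomial.eval_zero]
  rfl

theorem eq_zero_of_multiDeriv_eq_zero {d : ℕ} (F : MvPolynomial (Fin d) ℝ)
    (h : ∀ α, evalAt (multiDeriv α F) 0 = 0) : F = 0 := by
  ext α
  obtain ⟨c, hc, h'⟩ := coeff_foldr_pderiv α (List.finRange d) F 0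
  have h2 := h α
  rw [evalAt_zero, multiDeriv, h', mul_eq_zero] at h2
  have hα : ((List.finRange d).map fun j => Finsupp.single j (α j)).sum = α := by
    rw [← List.sum_toFinset _ (List.nodup_finRange d)]
    simp
  rw [zero_add, hα] at h2
  simpa using h2.resolve_left hc.ne'

theorem pderiv_comm_dirDeriv {d : ℕ} (i : Fin d) (e : RSp d) (F : MvPolynomial (Fin d) ℝ) :
    MvPolynomial.pderiv i (dirDeriv e F) = dirDeriv e (MvPolynomial.pderiv i F) := by
  rw [dirDeriv_apply, dirDeriv_apply, map_sum]
  refine Finset.sum_congr rfl fun l _ => ?_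
  rw [Derivation.map_smul]
  congr 1
  ext β
  simp only [MvPolynomial.coeff_pderiv]
  by_cases h : i = l
  · subst h; ring
  · simp [h, Ne.symm h, add_right_comm]
    ring_nf

theorem multiDeriv_dirDeriv {d : ℕ} (α : Fin d → ℕ) (e : RSp d) (F : MvPolynomial (Fin d) ℝ) :
    multiDeriv α (dirDeriv e F) = dirDeriv e (multiDeriv α F) := by
  have h1 : ∀ (i : Fin d) (n : ℕ) (G : MvPolynomial (Fin d) ℝ),
      (MvPolynomial.pderiv i)^[n] (dirDeriv e G) = dirDeriv e ((MvPolynomial.pderiv i)^[n] G) := by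
    intro i n G
    induction n with
    | zero => rfl
    | succ n ih => rw [Function.iterate_succ_apply', ih, pderiv_comm_dirDeriv,
        Function.iterate_succ_apply']
  have h2 : ∀ L : List (Fin d),
      L.foldr (fun j Q => (MvPolynomial.pderiv j)^[α j] Q) (dirDeriv e F) =
        dirDeriv e (L.foldr (fun j Q => (MvPolynomial.pderiv j)^[α j] Q) F) := by
    intro L
    induction L with
    | nil => rfl
    | cons a L ih => rw [List.foldr_cons, ih, h1, List.foldr_cons]
  exact h2 _

theorem multiDeriv_zero {d : ℕ} (α : Fin d → ℕ) :
    multiDeriv α (0 : MvPolynomial (Fin d) ℝ) = 0 := by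
  have h := multiDeriv_dirDeriv α 0 (0 : MvPolynomial (Fin d) ℝ)
  simpa [dirDeriv_apply] using h

/-- The directional derivative of a truncated normal form vanishes if and only if the direction is
orthogonal to the space of frequencies. -/
theorem dirDeriv_truncBNF_eq_zero_iff {d : ℕ} (N : MvPowerSeries (Fin d) ℝ) (m : ℕ) (u : RSp d) :
    dirDeriv u (truncBNF N m) = 0 ↔ u ∈ (freqSpace N m)ᗮ := by
  constructor
  · intro h
    rw [Submodule.mem_orthogonal']
    intro w hw
    refine Submodule.span_induction ?_ (by simp) ?_ ?_ hw
    · rintro _ ⟨α, rfl⟩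
      rw [← evalAt_dirDeriv_eq_inner, ← multiDeriv_dirDeriv, h, multiDeriv_zero]
      simp [evalAt]
    · intro x y _ _ hx hy; rw [inner_add_right, hx, hy, add_zero]
    · intro c x _ hx; rw [inner_smul_right, hx, mul_zero]
  · intro h
    refine eq_zero_of_multiDeriv_eq_zero _ fun α => ?_
    rw [multiDeriv_dirDeriv, evalAt_dirDeriv_eq_inner]
    exact (Submodule.mem_orthogonal' _ _).1 h _ (Submodule.subset_span ⟨α, rfl⟩)

/-- Directions orthogonal to `freqSpace N m` annihilate the whole polynomial, not only its jet at 0,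
so the gradient at any point lies in the double orthogonal. -/
theorem grad_mem_freqSpace {d : ℕ} (N : MvPowerSeries (Fin d) ℝ) (m : ℕ) (x : RSp d) :
    grad (truncBNF N m) x ∈ freqSpace N m := by
  rw [← (freqSpace N m).orthogonal_orthogonal, Submodule.mem_orthogonal]
  intro u hu
  rw [← evalAt_dirDeriv_eq_inner, (dirDeriv_truncBNF_eq_zero_iff N m u).2 hu]
  simp [evalAt]

/-- On each ray through the origin F is a one-variable polynomial of degree below n with vanishing
derivatives at 0. Hence pure directional derivatives suffice and mixed ones can be avoided. -/
theorem eq_zero_of_dirDeriv_iterate_eq_zero {d : ℕ} (F : MvPolynomial (Fin d) ℝ) (n : ℕ)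
    (hF : F.totalDegree < n) (h : ∀ j < n, ∀ e : RSp d, evalAt ((dirDeriv e)^[j] F) 0 = 0) :
    F = 0 := by
  have hn : ∀ e : RSp d, (dirDeriv e)^[n] F = 0 := by
    intro e
    rw [← Module.End.pow_apply, ← MvPolynomial.sum_homogeneousComponent F, map_sum]
    refine Finset.sum_eq_zero fun p hp => ?_
    have hp' : p < n := by rw [Finset.mem_range] at hp; omega
    rw [Module.End.pow_apply]
    have h1 := isHomogeneous_dirDeriv_iterate e _ p p
      (MvPolynomial.homogeneousComponent_isHomogeneous p F)
    rw [Nat.sub_self] at h1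
    obtain ⟨k, rfl⟩ : ∃ k, n = k + 1 + p := ⟨n - 1 - p, by omega⟩
    rw [Function.iterate_add_apply, Function.iterate_succ_apply,
      dirDeriv_eq_zero_of_isHomogeneous_zero e _ h1, iterate_map_zero]
  -- Integration from the top: the n-th derivative vanishes identically, and each lower one is
  -- constant along the ray with value 0 at the origin.
  have key : ∀ e : RSp d, ∀ i ≤ n, ∀ t : ℝ, evalAt ((dirDeriv e)^[n - i] F) (0 + t • e) = 0 := by
    intro e i
    induction i with
    | zero => intro _ t; simp [hn e, evalAt]
    | succ i ih =>
      intro hi t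
      have hc := is_const_of_deriv_eq_zero (f := fun t : ℝ =>
          evalAt ((dirDeriv e)^[n - (i + 1)] F) (0 + t • e))
        (fun t => (hasDerivAt_evalAt_line 0 e _ t).differentiableAt)
        (fun t => by
          rw [(hasDerivAt_evalAt_line 0 e _ t).deriv, ← Function.iterate_succ_apply' (dirDeriv e),
            show (n - (i + 1)).succ = n - i by omega]
          exact ih (by omega) t) t 0
      rw [hc]
      simpa using h (n - (i + 1)) (by omega) e
  refine MvPolynomial.funext fun x => ?_
  have := key (WithLp.toLp 2 x) n le_rfl 1
  simpa [evalAt] using this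

/-! ### Truncated normal forms and their homogeneous parts -/

theorem coeff_dirDeriv {d : ℕ} (u : RSp d) (F : MvPolynomial (Fin d) ℝ) (β : Fin d →₀ ℕ) :
    MvPolynomial.coeff β (dirDeriv u F) =
      ∑ l, u l * (MvPolynomial.coeff (β + Finsupp.single l 1) F * (β l + 1)) := by
  simp [dirDeriv_apply, MvPolynomial.coeff_sum, MvPolynomial.coeff_pderiv]

theorem coeff_truncBNF {d : ℕ} (N : MvPowerSeries (Fin d) ℝ) (m : ℕ) (β : Fin d →₀ ℕ) :
    MvPolynomial.coeff β (truncBNF N m) = if β.degree ≤ m then MvPowerSeries.coeff β N else 0 := by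
  rw [truncBNF, MvPowerSeries.coeff_truncTotal_eq_ite]
  simp

theorem totalDegree_truncBNF_le {d : ℕ} (N : MvPowerSeries (Fin d) ℝ) (m : ℕ) :
    (truncBNF N m).totalDegree ≤ m :=
  Nat.lt_succ_iff.1 (MvPowerSeries.totalDegree_truncTotal_lt _ (Nat.succ_ne_zero m))

theorem totalDegree_dirDeriv_lt {d : ℕ} (u : RSp d) (F : MvPolynomial (Fin d) ℝ) (m : ℕ)
    (hm : 0 < m) (hF : F.totalDegree ≤ m) : (dirDeriv u F).totalDegree < m := by
  rw [MvPolynomial.totalDegree, Finset.sup_lt_iff (by simpa using hm)]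
  intro β hβ
  rw [MvPolynomial.mem_support_iff, coeff_dirDeriv] at hβ
  obtain ⟨l, _, hl⟩ := Finset.exists_ne_zero_of_sum_ne_zero hβ
  have h1 : MvPolynomial.coeff (β + Finsupp.single l 1) F ≠ 0 := by
    intro h; rw [h] at hl; simp at hl
  have h2 := MvPolynomial.le_totalDegree (MvPolynomial.mem_support_iff.2 h1)
  rw [Finsupp.sum_add_index' (by simp) (by simp), Finsupp.sum_single_index rfl] at h2
  omega

/-- The homogeneous part of degree `j` of a formal power series. -/
noncomputable def homPart {d : ℕ} (N : MvPowerSeries (Fin d) ℝ) (j : ℕ) :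
    MvPolynomial (Fin d) ℝ :=
  MvPolynomial.homogeneousComponent j (truncBNF N j)

theorem isHomogeneous_homPart {d : ℕ} (N : MvPowerSeries (Fin d) ℝ) (j : ℕ) :
    (homPart N j).IsHomogeneous j :=
  MvPolynomial.homogeneousComponent_isHomogeneous _ _

theorem truncBNF_eq_sum {d : ℕ} (N : MvPowerSeries (Fin d) ℝ) (n : ℕ) :
    truncBNF N n = ∑ p ∈ Finset.range (n + 1), homPart N p := by
  ext β
  simp [MvPolynomial.coeff_sum, homPart, MvPolynomial.coeff_homogeneousComponent, coeff_truncBNF]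

/-- By duality: a direction that annihilates the longer truncation annihilates the shorter one,
because the derivative is read off coefficient by coefficient in each degree. -/
theorem freqSpace_mono {d : ℕ} (N : MvPowerSeries (Fin d) ℝ) : Monotone (freqSpace N) := by
  intro m n hmn
  rw [← (freqSpace N n).orthogonal_orthogonal, ← (freqSpace N m).orthogonal_orthogonal]
  refine Submodule.orthogonal_le fun u hu => ?_
  rw [← dirDeriv_truncBNF_eq_zero_iff] at hu ⊢
  ext β
  have h1 := congrArg (MvPolynomial.coeff β) hu
  rw [coeff_dirDeriv] at h1 ⊢
  by_cases hβ : β.degree + 1 ≤ m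
  · rw [← h1]
    refine Finset.sum_congr rfl fun l _ => ?_
    rw [coeff_truncBNF, coeff_truncBNF]
    simp [hβ, hβ.trans hmn]
  · rw [MvPolynomial.coeff_zero]
    refine Finset.sum_eq_zero fun l _ => ?_
    rw [coeff_truncBNF]
    simp [hβ]

/-- Ascending chains of subspaces stabilize in finite dimension, so the infimum is over a nonempty
set and is attained. -/
theorem mStar_spec {d : ℕ} (N : MvPowerSeries (Fin d) ℝ) :
    1 ≤ mStar N ∧ ∀ n, mStar N ≤ n → freqSpace N n = freqSpace N (mStar N) := by
  have hne : {m : ℕ | 1 ≤ m ∧ ∀ n, m ≤ n → freqSpace N n = freqSpace N m}.Nonempty := by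
    obtain ⟨n, hn⟩ := WellFoundedGT.monotone_chain_condition
      (⟨freqSpace N, freqSpace_mono N⟩ : ℕ →o Submodule ℝ (RSp d))
    refine ⟨n + 1, by omega, fun k hk => ?_⟩
    have h1 := hn k (by omega)
    have h2 := hn (n + 1) (by omega)
    exact h1.symm.trans h2
  exact Nat.sInf_mem hne

/-! ### Non-degeneracy -/

theorem continuous_evalAt_dirDeriv_iterate {d : ℕ} (e : RSp d) (j : ℕ)
    (P : MvPolynomial (Fin d) ℝ) (x : RSp d) :
    Continuous fun u : RSp d => evalAt ((dirDeriv e)^[j] (dirDeriv u P)) x := by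
  have : ∀ u : RSp d, evalAt ((dirDeriv e)^[j] (dirDeriv u P)) x =
      ∑ l, u l * evalAt ((dirDeriv e)^[j] (MvPolynomial.pderiv l P)) x := by
    intro u
    rw [dirDeriv_apply]
    simp only [← Module.End.pow_apply, map_sum, map_smul, evalAt, MvPolynomial.smul_eval]
  simp only [this]
  fun_prop

theorem dirDeriv_iterate_smul_left {d : ℕ} (c : ℝ) (e : RSp d) (j : ℕ)
    (F : MvPolynomial (Fin d) ℝ) : (dirDeriv (c • e))^[j] F = c ^ j • (dirDeriv e)^[j] F := by
  induction j with
  | zero => simp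
  | succ j ih =>
    rw [Function.iterate_succ_apply', ih, dirDeriv_smul_left, map_smul, smul_smul,
      Function.iterate_succ_apply', pow_succ']

/-- If all these derivatives vanished at a unit vector u of the frequency space, u would also be
orthogonal to that space. A pair (j, e) that works for u works nearby with half the bound, and the
unit sphere is compact. Orders j < m are enough because the differentiated truncation has degree
below m. -/
theorem exists_dirDeriv_lower_bound {d : ℕ} (N : MvPowerSeries (Fin d) ℝ) (m : ℕ) (hm : 0 < m) :
    ∃ σ : ℝ, 0 < σ ∧ ∀ u ∈ freqSpace N m, ‖u‖ = 1 → ∃ j < m, ∃ e : RSp d, ‖e‖ ≤ 1 ∧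
      σ ≤ |evalAt ((dirDeriv e)^[j] (dirDeriv u (truncBNF N m))) 0| := by
  set P := truncBNF N m with hP
  have hcomp : IsCompact ((freqSpace N m : Set (RSp d)) ∩ Metric.sphere 0 1) :=
    (isCompact_sphere _ _).inter_left (Submodule.closed_of_finiteDimensional _)
  have := hcomp.induction_on (p := fun s => ∃ σ : ℝ, 0 < σ ∧ ∀ u ∈ s, ∃ j < m, ∃ e : RSp d,
      ‖e‖ ≤ 1 ∧ σ ≤ |evalAt ((dirDeriv e)^[j] (dirDeriv u P)) 0|)
    ⟨1, one_pos, by simp⟩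
    (fun s t hst ⟨σ, hσ, h⟩ => ⟨σ, hσ, fun u hu => h u (hst hu)⟩)
    (fun s t ⟨σ, hσ, h⟩ ⟨σ', hσ', h'⟩ => ⟨min σ σ', lt_min hσ hσ', fun u hu => by
      rcases hu with hu | hu
      · obtain ⟨j, hj, e, he, h1⟩ := h u hu
        exact ⟨j, hj, e, he, (min_le_left _ _).trans h1⟩
      · obtain ⟨j, hj, e, he, h1⟩ := h' u hu
        exact ⟨j, hj, e, he, (min_le_right _ _).trans h1⟩⟩)
    ?_
  · obtain ⟨σ, hσ, h⟩ := this
    exact ⟨σ, hσ, fun u hu hu1 => h u ⟨hu, by simpa using hu1⟩⟩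
  · rintro u ⟨hu, hu1⟩
    have hex : ∃ j < m, ∃ e : RSp d, ‖e‖ ≤ 1 ∧
        evalAt ((dirDeriv e)^[j] (dirDeriv u P)) 0 ≠ 0 := by
      by_contra hcon
      push Not at hcon
      have h0 : dirDeriv u P = 0 := by
        refine eq_zero_of_dirDeriv_iterate_eq_zero _ m
          (totalDegree_dirDeriv_lt u P m hm (totalDegree_truncBNF_le N m)) fun j hj e => ?_
        have h1 := hcon j hj ((‖e‖ + 1)⁻¹ • e) (by
          rw [norm_smul, norm_inv, Real.norm_of_nonneg (by positivity)]
          rw [inv_mul_le_one₀ (by positivity)]; linarith)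
        rw [dirDeriv_iterate_smul_left, evalAt, MvPolynomial.smul_eval, mul_eq_zero] at h1
        exact h1.resolve_left (by positivity)
      have h1 := (dirDeriv_truncBNF_eq_zero_iff N m u).1 h0
      have h2 := Submodule.inner_left_of_mem_orthogonal hu h1
      rw [inner_self_eq_zero] at h2
      rw [h2] at hu1
      simp at hu1
    obtain ⟨j, hj, e, he, hne⟩ := hex
    have hpos : 0 < |evalAt ((dirDeriv e)^[j] (dirDeriv u P)) 0| := abs_pos.2 hne
    have hc : Continuous fun u : RSp d => |evalAt ((dirDeriv e)^[j] (dirDeriv u P)) 0| :=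
      (continuous_evalAt_dirDeriv_iterate e j P 0).abs
    refine ⟨{v | |evalAt ((dirDeriv e)^[j] (dirDeriv u P)) 0| / 2 <
        |evalAt ((dirDeriv e)^[j] (dirDeriv v P)) 0|}, mem_nhdsWithin_of_mem_nhds
          ((isOpen_lt continuous_const hc).mem_nhds (by simpa using hne)),
        _, half_pos hpos, fun v hv => ⟨j, hj, e, he, le_of_lt hv⟩⟩

/-- If the chain were stationary from 1 on, only j = 0 would be available in the lower bound, so
pairing with the single vector ∇N_1(0) would be injective and the dimension at most 1. -/
theorem two_le_mStar {d : ℕ} (N : MvPowerSeries (Fin d) ℝ)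
    (h : 2 ≤ Module.finrank ℝ (freqSpaceLim N)) : 2 ≤ mStar N := by
  by_contra hlt
  have h1 : mStar N = 1 := by have := (mStar_spec N).1; omega
  rw [freqSpaceLim, h1] at h
  obtain ⟨σ, hσ, hu⟩ := exists_dirDeriv_lower_bound N 1 one_pos
  let f : freqSpace N 1 →ₗ[ℝ] ℝ :=
    (innerₗ (RSp d) (grad (truncBNF N 1) 0)).comp (freqSpace N 1).subtype
  have hf : Function.Injective f := by
    rw [← LinearMap.ker_eq_bot, LinearMap.ker_eq_bot']
    intro v hv
    by_contra hv0
    have hv1 : (v : RSp d) ≠ 0 := by simpa using hv0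
    obtain ⟨j, hj, e, he, hle⟩ := hu (‖(v : RSp d)‖⁻¹ • (v : RSp d))
      (Submodule.smul_mem _ _ v.2) (norm_smul_inv_norm hv1)
    have hj0 : j = 0 := by omega
    subst hj0
    rw [Function.iterate_zero_apply, evalAt_dirDeriv_eq_inner, inner_smul_left,
      real_inner_comm] at hle
    have : inner ℝ (grad (truncBNF N 1) 0) (v : RSp d) = 0 := hv
    rw [this] at hle
    simp at hle
    linarith
  have := LinearMap.finrank_le_finrank_of_injective hf
  rw [Module.finrank_self] at this
  omega

/-! ### Sums over integer vectors -/

theorem summable_prod_pi {ι κ : Type*} [Fintype ι] (f : ι → κ → ℝ) (h0 : ∀ i x, 0 ≤ f i x)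
    (hf : ∀ i, Summable (f i)) : Summable fun x : ι → κ => ∏ i, f i (x i) := by
  classical
  refine summable_of_sum_le (c := ∏ i, ∑' x, f i x)
    (fun x => Finset.prod_nonneg fun i _ => h0 i _) fun s => ?_
  calc ∑ x ∈ s, ∏ i, f i (x i)
      ≤ ∑ x ∈ Fintype.piFinset fun i => s.image fun x => x i, ∏ i, f i (x i) := by
        refine Finset.sum_le_sum_of_subset_of_nonneg (fun x hx => ?_)
          fun x _ _ => Finset.prod_nonneg fun i _ => h0 i _
        rw [Fintype.mem_piFinset]
        exact fun i => Finset.mem_image_of_mem (fun x : ι → κ => x i) hx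
    _ = ∏ i, ∑ y ∈ s.image fun x => x i, f i y := (Finset.prod_univ_sum _ _).symm
    _ ≤ _ := Finset.prod_le_prod (fun i _ => Finset.sum_nonneg fun y _ => h0 i y)
        fun i _ => (hf i).sum_le_tsum _ fun y _ => h0 i y

theorem one_le_sum_abs {d : ℕ} (k : Fin d → ℤ) (hk : k ≠ 0) : 1 ≤ ∑ i, |(k i : ℝ)| := by
  obtain ⟨i, hi⟩ := Function.ne_iff.1 hk
  calc (1 : ℝ) ≤ |(k i : ℝ)| := by exact_mod_cast Int.one_le_abs hi
    _ ≤ _ := Finset.single_le_sum (f := fun i => |(k i : ℝ)|) (fun _ _ => abs_nonneg _)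
        (Finset.mem_univ i)

/-- Comparison with a product of one-dimensional series: the exponent d + 1 is split evenly, giving
the summable exponent 1 + 1/d in each coordinate, and 1 + |k_i| ≤ 2|k| for k ≠ 0. -/
theorem summable_sum_abs_inv_pow (d : ℕ) (hd : 0 < d) :
    Summable fun k : Fin d → ℤ => (∑ i, |(k i : ℝ)|)⁻¹ ^ (d + 1) := by
  have hd' : (0 : ℝ) < d := by exact_mod_cast hd
  have h1 : Summable fun n : ℤ => (1 + |(n : ℝ)|) ^ (-(1 + 1 / (d : ℝ))) := by
    have h2 : Summable fun n : ℕ => (1 + (n : ℝ)) ^ (-(1 + 1 / (d : ℝ))) := by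
      have := (summable_nat_add_iff 1).2
        (Real.summable_nat_rpow.2 (show -(1 + 1 / (d : ℝ)) < -1 by
          have : 0 < 1 / (d : ℝ) := by positivity
          linarith))
      refine this.congr fun n => ?_
      push_cast; rw [add_comm]
    refine Summable.of_nat_of_neg ?_ ?_
    · simpa using h2
    · simpa using h2
  have h3 := summable_prod_pi (fun (_ : Fin d) (n : ℤ) => (1 + |(n : ℝ)|) ^ (-(1 + 1 / (d : ℝ))))
    (fun _ _ => by positivity) (fun _ => h1)
  refine Summable.of_nonneg_of_le (fun k => by positivity) (fun k => ?_) (h3.mul_left (2 ^ (d + 1)))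
  by_cases hk : k = 0
  · subst hk; simp
  have hs := one_le_sum_abs k hk
  set s := ∑ i, |(k i : ℝ)| with hsdef
  have h4 : ∀ i, (2 * s) ^ (-(1 + 1 / (d : ℝ))) ≤ (1 + |(k i : ℝ)|) ^ (-(1 + 1 / (d : ℝ))) := by
    intro i
    refine Real.rpow_le_rpow_of_nonpos (by positivity) ?_ (by
      have : 0 < 1 / (d : ℝ) := by positivity
      linarith)
    have : |(k i : ℝ)| ≤ s := Finset.single_le_sum (f := fun i => |(k i : ℝ)|)
        (fun _ _ => abs_nonneg _) (Finset.mem_univ i)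
    linarith
  have h5 : ((2 * s) ^ (-(1 + 1 / (d : ℝ)))) ^ d ≤
      ∏ i, (1 + |(k i : ℝ)|) ^ (-(1 + 1 / (d : ℝ))) := by
    have := Finset.prod_le_prod (s := Finset.univ) (fun i _ => by positivity) (fun i _ => h4 i)
    simpa using this
  have h6 : ((2 * s) ^ (-(1 + 1 / (d : ℝ)))) ^ d = (2 * s)⁻¹ ^ (d + 1) := by
    rw [← Real.rpow_mul_natCast (by positivity), ← Real.rpow_natCast, Real.inv_rpow (by positivity),
      ← Real.rpow_neg (by positivity)]
    congr 1
    push_cast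
    field_simp
  rw [h6] at h5
  calc s⁻¹ ^ (d + 1) = 2 ^ (d + 1) * (2 * s)⁻¹ ^ (d + 1) := by
        rw [← mul_pow]; congr 1; field_simp
    _ ≤ _ := by gcongr

/-! ### Variation of the derivatives of a truncated normal form -/

/-- In degree p the Gevrey bound supplies p - 1 factors y = B p^{τ+1} and the size of x supplies p -
j - 1 factors 6r. For p ≤ n one has 6ry ≤ 1/2, so all but one of the factors 6r are absorbed into a
geometric series, and the remaining one makes the variation O(r). -/
theorem abs_evalAt_truncBNF_sub_le {d : ℕ} (N : MvPowerSeries (Fin d) ℝ) (B τ c r : ℝ)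
    (hτ : 0 ≤ τ + 1) (hr : 0 < r) (hB : 0 < B) (hc : 6 * B * c ^ (τ + 1) ≤ 1 / 2)
    (hN : ∀ j, 2 ≤ j → coeffNorm (homPart N j) ≤ (B * (j : ℝ) ^ (τ + 1)) ^ (j - 1))
    (m n : ℕ) (hmn : m ≤ n) (hn : (n : ℝ) ^ (τ + 1) * r ≤ c ^ (τ + 1))
    (j : ℕ) (hj : j < m) (e u : RSp d) (he : ‖e‖ ≤ 1) (hu : ‖u‖ ≤ 1) (x : RSp d)
    (hx : ‖x‖ ≤ 6 * r) :
    |evalAt ((dirDeriv e)^[j] (dirDeriv u (truncBNF N n))) x -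
      evalAt ((dirDeriv e)^[j] (dirDeriv u (truncBNF N m))) 0| ≤
      ∑ p ∈ Finset.range (n + 1), (p : ℝ) ^ (j + 1) * (B * (p : ℝ) ^ (τ + 1)) ^ (j + 1) * 2 ^ (j + 2) *
        (1 / 2) ^ p * (6 * r) := by
  let D : MvPolynomial (Fin d) ℝ → RSp d → ℝ := fun F x => evalAt ((dirDeriv e)^[j] (dirDeriv u F)) x
  have hD : ∀ n x, D (truncBNF N n) x = ∑ p ∈ Finset.range (n + 1), D (homPart N p) x := by
    intro n x
    simp only [D]
    rw [truncBNF_eq_sum]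
    simp only [← Module.End.pow_apply, map_sum, evalAt]
  have h0 : ∀ p, m + 1 ≤ p → D (homPart N p) 0 = 0 := by
    intro p hp
    have hG : ((dirDeriv e)^[j] (dirDeriv u (homPart N p))).IsHomogeneous (p - 1 - j) :=
      isHomogeneous_dirDeriv_iterate e _ (p - 1) j
        (isHomogeneous_dirDeriv u _ p (isHomogeneous_homPart N p))
    have := abs_evalAt_le _ _ hG 0
    rw [norm_zero, zero_pow (by omega), mul_zero] at this
    exact abs_nonpos_iff.1 this
  -- Only j + 1 ≤ m derivatives are taken, so terms of degree above m do not contribute at the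
  -- origin.
  have h1 : D (truncBNF N m) 0 = D (truncBNF N n) 0 := by
    rw [hD, hD]
    refine Finset.sum_subset (by simpa using hmn) fun p _ hp => h0 p (by simpa using hp)
  change |D (truncBNF N n) x - D (truncBNF N m) 0| ≤ _
  rw [h1, hD, hD, ← Finset.sum_sub_distrib]
  refine (Finset.abs_sum_le_sum_abs _ _).trans (Finset.sum_le_sum fun p hp => ?_)
  refine (abs_evalAt_dirDeriv_iterate_sub_le e u he hu _ p j (isHomogeneous_homPart N p) x).trans ?_
  split_ifs with hjp
  · have hpn : (p : ℝ) ≤ n := by exact_mod_cast Nat.lt_succ_iff.1 (Finset.mem_range.1 hp)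
    set y := B * (p : ℝ) ^ (τ + 1) with hy
    have hy0 : 0 ≤ y := by positivity
    have hy1 : y * (6 * r) ≤ 1 / 2 := by
      calc y * (6 * r) = 6 * B * ((p : ℝ) ^ (τ + 1) * r) := by rw [hy]; ring
        _ ≤ 6 * B * ((n : ℝ) ^ (τ + 1) * r) := by gcongr
        _ ≤ 6 * B * c ^ (τ + 1) := by gcongr
        _ ≤ 1 / 2 := hc
    obtain ⟨q, rfl⟩ : ∃ q, p = q + (j + 2) := ⟨p - (j + 2), by omega⟩
    have e1 : q + (j + 2) - (j + 1) = q + 1 := by omega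
    have e2 : q + (j + 2) - 1 = q + (j + 1) := by omega
    have hNp := hN (q + (j + 2)) (by omega)
    rw [e2] at hNp
    rw [e1]
    calc (((q + (j + 2) : ℕ) : ℝ)) ^ (j + 1) * coeffNorm (homPart N (q + (j + 2))) * ‖x‖ ^ (q + 1)
        ≤ (((q + (j + 2) : ℕ) : ℝ)) ^ (j + 1) * y ^ (q + (j + 1)) * (6 * r) ^ (q + 1) := by
          gcongr
      _ = (((q + (j + 2) : ℕ) : ℝ)) ^ (j + 1) * y ^ (j + 1) * (y * (6 * r)) ^ q * (6 * r) := by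
          rw [mul_pow]; ring
      _ ≤ (((q + (j + 2) : ℕ) : ℝ)) ^ (j + 1) * y ^ (j + 1) * (1 / 2) ^ q * (6 * r) := by
          gcongr
      _ = _ := by
          have : (2 : ℝ) ^ (j + 2) * (1 / 2) ^ (q + (j + 2)) = (1 / 2) ^ q := by
            rw [pow_add (1 / 2 : ℝ) q, mul_left_comm, ← mul_pow]; norm_num
          rw [← this]; ring
  · positivity

/-- The geometric factor beats every power of p, so the bound is uniform in the order n of
truncation, which tends to infinity as r → 0. -/
theorem exists_variation_const (B τ : ℝ) (hτ : 0 < τ + 1) (hB : 0 < B) (m : ℕ) :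
    ∃ K : ℝ, 0 < K ∧ ∀ j < m, ∀ n, ∀ r, 0 < r → ∑ p ∈ Finset.range (n + 1), (p : ℝ) ^ (j + 1) *
      (B * (p : ℝ) ^ (τ + 1)) ^ (j + 1) * 2 ^ (j + 2) * (1 / 2) ^ p * (6 * r) ≤ K * r := by
  have hs : ∀ j, Summable fun p : ℕ => (p : ℝ) ^ (j + 1) *
      (B * (p : ℝ) ^ (τ + 1)) ^ (j + 1) * 2 ^ (j + 2) * (1 / 2) ^ p := by
    intro j
    obtain ⟨q, hq⟩ := exists_nat_ge (τ + 1)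
    have h1 := summable_pow_mul_geometric_of_norm_lt_one ((j + 1) + q * (j + 1))
      (show ‖(1 / 2 : ℝ)‖ < 1 by norm_num)
    refine Summable.of_nonneg_of_le (fun p => by positivity) (fun p => ?_)
      (h1.mul_left (B ^ (j + 1) * 2 ^ (j + 2)))
    have h2 : (p : ℝ) ^ (τ + 1) ≤ (p : ℝ) ^ q := by
      rcases Nat.eq_zero_or_pos p with rfl | hp
      · rw [Nat.cast_zero, Real.zero_rpow hτ.ne']; positivity
      · rw [← Real.rpow_natCast]
        exact Real.rpow_le_rpow_of_exponent_le (by exact_mod_cast hp) hq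
    calc (p : ℝ) ^ (j + 1) * (B * (p : ℝ) ^ (τ + 1)) ^ (j + 1) * 2 ^ (j + 2) * (1 / 2) ^ p
        ≤ (p : ℝ) ^ (j + 1) * (B * (p : ℝ) ^ q) ^ (j + 1) * 2 ^ (j + 2) * (1 / 2) ^ p := by
          gcongr
      _ = _ := by rw [mul_pow, ← pow_mul, pow_add]; ring
  refine ⟨∑ j ∈ Finset.range m, (∑' p : ℕ, (p : ℝ) ^ (j + 1) *
      (B * (p : ℝ) ^ (τ + 1)) ^ (j + 1) * 2 ^ (j + 2) * (1 / 2) ^ p) * 6 + 1, ?_, ?_⟩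
  · have : ∀ j, 0 ≤ ∑' p : ℕ, (p : ℝ) ^ (j + 1) *
      (B * (p : ℝ) ^ (τ + 1)) ^ (j + 1) * 2 ^ (j + 2) * (1 / 2) ^ p :=
      fun j => tsum_nonneg fun p => by positivity
    have h2 := Finset.sum_nonneg (s := Finset.range m) fun j _ => mul_nonneg (this j) (by norm_num : (0:ℝ) ≤ 6)
    linarith
  · intro j hj n r hr
    rw [← Finset.sum_mul, add_mul]
    have h1 := (hs j).sum_le_tsum (Finset.range (n + 1)) (fun p _ => by positivity)
    have h2 := Finset.single_le_sum (f := fun j => (∑' p : ℕ, (p : ℝ) ^ (j + 1) *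
      (B * (p : ℝ) ^ (τ + 1)) ^ (j + 1) * 2 ^ (j + 2) * (1 / 2) ^ p) * 6)
      (fun i _ => mul_nonneg (tsum_nonneg fun p => by positivity) (by norm_num))
      (Finset.mem_range.2 hj)
    nlinarith

/-! ### Measure of a single resonance zone -/

theorem volume_resonance_le {d : ℕ} (hd : 0 < d) (Q : MvPolynomial (Fin d) ℝ) (u e : RSp d)
    (he : ‖e‖ ≤ 1) (r ε σ : ℝ) (hr : 0 < r) (hε : 0 < ε) (hεσ : ε ≤ σ) (m j : ℕ) (hm : 2 ≤ m)
    (hj : j < m)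
    (hlow : ∀ x : RSp d, ‖x‖ ≤ 6 * r → σ ≤ |evalAt ((dirDeriv e)^[j] (dirDeriv u Q)) x|) :
    volume {I : RSp d | ‖I‖ < 2 * r ∧ |inner ℝ u (grad Q I)| < ε} ≤
      ENNReal.ofReal (2 * 2 ^ m * (2 * (ε / σ) ^ (1 / ((m : ℝ) - 1))) * (4 ^ d * r ^ (d - 1))) *
        volume (Metric.ball (0 : RSp d) 1) := by
  have hσ : 0 < σ := hε.trans_le hεσ
  have hm1 : (0 : ℝ) < (m : ℝ) - 1 := by
    have : (2 : ℝ) ≤ m := by exact_mod_cast hm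
    linarith
  set δ := 2 * (ε / σ) ^ (1 / ((m : ℝ) - 1)) with hδ
  have hδ0 : 0 < δ := by positivity
  have hcont : Continuous fun I : RSp d => inner ℝ u (grad Q I) := by
    have : (fun I : RSp d => inner ℝ u (grad Q I)) =
        fun I : RSp d => MvPolynomial.eval (fun i => I i) (dirDeriv u Q) := by
      ext I; rw [← evalAt_dirDeriv_eq_inner]; rfl
    rw [this]
    exact (MvPolynomial.continuous_eval _).comp (by fun_prop)
  refine volume_le_of_slices hd _ ?_ r _ hr ?_ e he ?_
  · exact ((isOpen_lt continuous_norm continuous_const).inter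
      (isOpen_lt hcont.abs continuous_const)).measurableSet
  · rintro I ⟨hI, _⟩
    simpa using hI
  · intro x hx
    -- This explains δ: 2/δ is the (m-1)-th root of σ/ε ≥ 1, and j ≤ m - 1, so one δ serves for
    -- every admissible order j.
    have hpow : ε * (2 / δ) ^ j ≤ σ := by
      have h1 : 2 / δ = (σ / ε) ^ (1 / ((m : ℝ) - 1)) := by
        rw [hδ, ← inv_div ε σ, Real.inv_rpow (by positivity)]
        field_simp
      have h2 : 1 ≤ σ / ε := by rwa [one_le_div hε]
      have h3 : (2 / δ) ^ j ≤ σ / ε := by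
        rw [h1, ← Real.rpow_mul_natCast (by positivity)]
        calc (σ / ε) ^ (1 / ((m : ℝ) - 1) * j) ≤ (σ / ε) ^ (1 : ℝ) := by
              refine Real.rpow_le_rpow_of_exponent_le h2 ?_
              rw [one_div, inv_mul_le_one₀ hm1]
              have : (j : ℝ) + 1 ≤ m := by exact_mod_cast hj
              linarith
          _ = _ := Real.rpow_one _
      calc ε * (2 / δ) ^ j ≤ ε * (σ / ε) := by gcongr
        _ = σ := by field_simp
    have h4 := volume_sublevel_le j
      (fun i t => evalAt ((dirDeriv e)^[i] (dirDeriv u Q)) (x + t • e))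
      (fun i t => by
        rw [Function.iterate_succ_apply']
        exact hasDerivAt_evalAt_line x e _ t) 0 (2 * r) ε δ hδ0
      (fun t ht => hpow.trans (hlow _ (by
        calc ‖x + t • e‖ ≤ ‖x‖ + ‖t • e‖ := norm_add_le _ _
          _ ≤ 4 * r + 2 * r := by
            refine add_le_add hx.le ?_
            rw [norm_smul, Real.norm_of_nonneg ht.1]
            nlinarith [norm_nonneg e, ht.1, ht.2]
          _ = 6 * r := by ring)))
    refine (measure_mono ?_).trans (h4.trans (ENNReal.ofReal_le_ofReal ?_))
    · rintro t ⟨ht, _, ht2⟩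
      refine ⟨ht, ?_⟩
      rw [← evalAt_dirDeriv_eq_inner] at ht2
      simpa using ht2
    · have : (2 : ℝ) ^ j ≤ 2 ^ m := pow_le_pow_right₀ (by norm_num) hj.le
      gcongr

/-! ### Measure of the set of non-Diophantine frequencies -/

theorem inner_intVec {d : ℕ} (k : Fin d → ℤ) (w : RSp d) :
    inner ℝ (intVec k) w = ∑ i, w i * (k i : ℝ) := by
  simp [intVec, PiLp.inner_apply]

/-- Of the exponent (m-1)(d+1) + τ + 1, the part τ pays for the possible smallness of the projection
of k to V, the part 1 is given away, and the rest becomes the summable power |k|^{-(d+1)} after the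
(m-1)-th root. -/
theorem volume_resonance_intVec_le {d : ℕ} (hd : 0 < d) (γ τ σ γb r : ℝ) (hγ : 0 < γ)
    (hσ : 0 < σ) (hr : 0 < r) (hγb : 0 < γb) (ω : RSp d) (hω : ω ∈ DC d τ γ)
    (m : ℕ) (hm : 2 ≤ m) (V : Submodule ℝ (RSp d)) (hωV : ω ∈ V) (Q : MvPolynomial (Fin d) ℝ)
    (hQ : ∀ x, grad Q x ∈ V) (hsmall : γb * (‖ω‖ + 1) / γ ≤ σ)
    (hnd : ∀ u ∈ V, ‖u‖ = 1 → ∃ j < m, ∃ e : RSp d, ‖e‖ ≤ 1 ∧ ∀ x : RSp d, ‖x‖ ≤ 6 * r →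
      σ ≤ |evalAt ((dirDeriv e)^[j] (dirDeriv u Q)) x|)
    (k : Fin d → ℤ) (hk : k ≠ 0) :
    volume {I : RSp d | ‖I‖ < 2 * r ∧ |∑ i, grad Q I i * (k i : ℝ)| <
        γb * (∑ i, |(k i : ℝ)|) ^ (-(((m : ℝ) - 1) * ((d : ℝ) + 1) + τ + 1))} ≤
      ENNReal.ofReal (2 * 2 ^ m * (2 * ((γb * (‖ω‖ + 1) / γ / σ) ^ (1 / ((m : ℝ) - 1)) *
        (∑ i, |(k i : ℝ)|)⁻¹ ^ (d + 1))) * (4 ^ d * r ^ (d - 1))) *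
        volume (Metric.ball (0 : RSp d) 1) := by
  have hs := one_le_sum_abs k hk
  set s := ∑ i, |(k i : ℝ)| with hsdef
  have hs0 : 0 < s := by linarith
  have hm1 : (0 : ℝ) < (m : ℝ) - 1 := by
    have : (2 : ℝ) ≤ m := by exact_mod_cast hm
    linarith
  set w := V.starProjection (intVec k) with hw
  have hwin : ∀ v ∈ V, ∑ i, v i * (k i : ℝ) = inner ℝ w v := by
    intro v hv
    rw [← inner_intVec, hw, Submodule.inner_starProjection_left_eq_right,
      Submodule.starProjection_eq_self_iff.2 hv]
  -- Since ω lies in V, the Diophantine condition on ω keeps w away from 0. Using ‖ω‖ + 1 keeps the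
  -- factor positive.
  have h1 : γ * s ^ (-τ) ≤ ‖w‖ * (‖ω‖ + 1) := by
    refine (hω k hk).trans ?_
    rw [hwin ω hωV]
    refine (abs_real_inner_le_norm _ _).trans ?_
    gcongr; linarith
  have hw0 : 0 < ‖w‖ := by
    have : 0 < ‖w‖ * (‖ω‖ + 1) := lt_of_lt_of_le (by positivity) h1
    exact pos_of_mul_pos_left this (by positivity)
  set ε := γb * (‖ω‖ + 1) / γ * s ^ (-(((m : ℝ) - 1) * ((d : ℝ) + 1))) with hε
  have hε0 : 0 < ε := by positivity
  have hεσ : ε ≤ σ := by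
    refine le_trans ?_ hsmall
    rw [hε]
    refine mul_le_of_le_one_right (by positivity) ?_
    exact Real.rpow_le_one_of_one_le_of_nonpos hs (by nlinarith)
  obtain ⟨j, hj, e, he, hlow⟩ := hnd (‖w‖⁻¹ • w) (V.smul_mem _ (V.starProjection_apply_mem _))
    (norm_smul_inv_norm (norm_pos_iff.1 hw0))
  have h2 := volume_resonance_le hd Q (‖w‖⁻¹ • w) e he r ε σ hr hε0 hεσ m j hm hj hlow
  have h3 : (ε / σ) ^ (1 / ((m : ℝ) - 1)) =
      (γb * (‖ω‖ + 1) / γ / σ) ^ (1 / ((m : ℝ) - 1)) * s⁻¹ ^ (d + 1) := by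
    rw [hε, mul_div_right_comm, Real.mul_rpow (by positivity) (by positivity),
      ← Real.rpow_mul hs0.le, ← Real.rpow_natCast, Real.inv_rpow hs0.le, ← Real.rpow_neg hs0.le]
    congr 2
    push_cast
    field_simp
  rw [h3] at h2
  refine (measure_mono ?_).trans h2
  rintro I ⟨hI, hI2⟩
  refine ⟨hI, ?_⟩
  rw [hwin _ (hQ I)] at hI2
  rw [inner_smul_left, abs_mul, conj_trivial, abs_inv, abs_norm, inv_mul_lt_iff₀ hw0]
  refine hI2.trans_le ?_
  have e1 : s ^ (-(((m : ℝ) - 1) * ((d : ℝ) + 1) + τ + 1)) =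
      s ^ (-(((m : ℝ) - 1) * ((d : ℝ) + 1))) * s ^ (-τ) * s ^ (-1 : ℝ) := by
    rw [← Real.rpow_add hs0, ← Real.rpow_add hs0]; congr 1; ring
  have e2 : s ^ (-1 : ℝ) ≤ 1 := Real.rpow_le_one_of_one_le_of_nonpos hs (by norm_num)
  calc γb * s ^ (-(((m : ℝ) - 1) * ((d : ℝ) + 1) + τ + 1))
      ≤ γb * (s ^ (-(((m : ℝ) - 1) * ((d : ℝ) + 1))) * s ^ (-τ)) := by
        rw [e1]
        exact mul_le_mul_of_nonneg_left (mul_le_of_le_one_right (by positivity) e2) hγb.le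
    _ = γb / γ * s ^ (-(((m : ℝ) - 1) * ((d : ℝ) + 1))) * (γ * s ^ (-τ)) := by field_simp
    _ ≤ γb / γ * s ^ (-(((m : ℝ) - 1) * ((d : ℝ) + 1))) * (‖w‖ * (‖ω‖ + 1)) := by gcongr
    _ = ‖w‖ * ε := by rw [hε]; ring

theorem volume_nonDiophantine_le {d : ℕ} (hd : 0 < d) (γ τ σ γb r : ℝ) (hγ : 0 < γ)
    (hσ : 0 < σ) (hr : 0 < r) (hγb : 0 < γb) (ω : RSp d) (hω : ω ∈ DC d τ γ)
    (m : ℕ) (hm : 2 ≤ m) (V : Submodule ℝ (RSp d)) (hωV : ω ∈ V) (Q : MvPolynomial (Fin d) ℝ)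
    (hQ : ∀ x, grad Q x ∈ V) (hsmall : γb * (‖ω‖ + 1) / γ ≤ σ)
    (hnd : ∀ u ∈ V, ‖u‖ = 1 → ∃ j < m, ∃ e : RSp d, ‖e‖ ≤ 1 ∧ ∀ x : RSp d, ‖x‖ ≤ 6 * r →
      σ ≤ |evalAt ((dirDeriv e)^[j] (dirDeriv u Q)) x|) :
    volume {I : RSp d | ‖I‖ < 2 * r ∧
        grad Q I ∉ DC d (((m : ℝ) - 1) * ((d : ℝ) + 1) + τ + 1) γb} ≤
      ENNReal.ofReal (2 * 2 ^ m * (2 * (((‖ω‖ + 1) / γ / σ) ^ (1 / ((m : ℝ) - 1)) *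
        ∑' k : Fin d → ℤ, (∑ i, |(k i : ℝ)|)⁻¹ ^ (d + 1))) * 4 ^ d *
        (volume (Metric.ball (0 : RSp d) 1)).toReal * γb ^ (1 / ((m : ℝ) - 1)) * r ^ (d - 1)) := by
  set vB := volume (Metric.ball (0 : RSp d) 1) with hvB
  have hvB' : vB ≠ ⊤ := measure_ball_lt_top.ne
  set a := 2 * 2 ^ m * (2 * (γb * (‖ω‖ + 1) / γ / σ) ^ (1 / ((m : ℝ) - 1))) *
    (4 ^ d * r ^ (d - 1)) * vB.toReal with ha
  have ha0 : 0 ≤ a := by positivity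
  have hsum := summable_sum_abs_inv_pow d hd
  have hsub : {I : RSp d | ‖I‖ < 2 * r ∧
        grad Q I ∉ DC d (((m : ℝ) - 1) * ((d : ℝ) + 1) + τ + 1) γb} ⊆
      ⋃ k : Fin d → ℤ, {I : RSp d | k ≠ 0 ∧ ‖I‖ < 2 * r ∧ |∑ i, grad Q I i * (k i : ℝ)| <
        γb * (∑ i, |(k i : ℝ)|) ^ (-(((m : ℝ) - 1) * ((d : ℝ) + 1) + τ + 1))} := by
    rintro I ⟨hI, hI2⟩
    simp only [DC, Set.mem_ofPred_eq, not_forall, not_le] at hI2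
    obtain ⟨k, hk, h⟩ := hI2
    exact Set.mem_iUnion.2 ⟨k, hk, hI, h⟩
  refine (measure_mono hsub).trans ((measure_iUnion_le _).trans ?_)
  have hk : ∀ k : Fin d → ℤ, volume {I : RSp d | k ≠ 0 ∧ ‖I‖ < 2 * r ∧
      |∑ i, grad Q I i * (k i : ℝ)| <
        γb * (∑ i, |(k i : ℝ)|) ^ (-(((m : ℝ) - 1) * ((d : ℝ) + 1) + τ + 1))} ≤
      ENNReal.ofReal (a * (∑ i, |(k i : ℝ)|)⁻¹ ^ (d + 1)) := by
    intro k
    by_cases hk0 : k = 0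
    · simp [hk0]
    have h1 := volume_resonance_intVec_le hd γ τ σ γb r hγ hσ hr hγb ω hω m hm V hωV Q hQ hsmall
      hnd k hk0
    refine (measure_mono fun I hI => hI.2).trans (h1.trans_eq ?_)
    conv_lhs => rw [← hvB, ← ENNReal.ofReal_toReal hvB', ← ENNReal.ofReal_mul (by positivity)]
    rw [ha]
    congr 1
    ring
  refine (ENNReal.tsum_le_tsum hk).trans_eq ?_
  rw [← ENNReal.ofReal_tsum_of_nonneg (fun k => by positivity) (hsum.mul_left a), tsum_mul_left, ha]
  congr 1
  have : γb * (‖ω‖ + 1) / γ / σ = γb * ((‖ω‖ + 1) / γ / σ) := by ring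
  rw [this, Real.mul_rpow hγb.le (by positivity)]
  ring

/-- The measure estimate for a normal form with Gevrey growth. -/
theorem exists_measure_bound_of_growth (d : ℕ) (hd : 3 ≤ d) (γ τ B c : ℝ) (hγ : 0 < γ)
    (hτ : (d : ℝ) - 1 ≤ τ) (hB : 0 < B) (hc : 0 < c) (hcB : 6 * B * c ^ (τ + 1) ≤ 1 / 2)
    (m : ℕ) (P : MvPolynomial (Fin d) ℝ) :
    ∃ C r' γ' : ℝ, 0 < C ∧ 0 < r' ∧ 0 < γ' ∧ ∀ (ω : RSp d) (N : MvPowerSeries (Fin d) ℝ),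
      ω ∈ DC d τ γ → grad (truncBNF N m) 0 = ω →
      (∀ j, 2 ≤ j → coeffNorm (homPart N j) ≤ (B * (j : ℝ) ^ (τ + 1)) ^ (j - 1)) →
      mStar N = m → truncBNF N m = P → 2 ≤ Module.finrank ℝ (freqSpaceLim N) →
      ∀ r γb : ℝ, 0 < r → r < r' → 0 < γb → γb < γ' →
        volume {I : RSp d | ‖I‖ < 2 * r ∧ grad (truncBNF N (truncOrder c τ r)) I ∉
            DC d (((m : ℝ) - 1) * ((d : ℝ) + 1) + τ + 1) γb} ≤
          ENNReal.ofReal (C * γb ^ (1 / ((m : ℝ) - 1)) * r ^ (d - 1)) := by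
  -- The constants may depend on P but not on N. They are built from an arbitrary series N₀ with
  -- truncation P, whose space V_m is that of N; without such a series nothing is claimed.
  by_cases hex : ∃ N₀ : MvPowerSeries (Fin d) ℝ, truncBNF N₀ m = P ∧ 2 ≤ m
  swap
  · refine ⟨1, 1, 1, one_pos, one_pos, one_pos, fun ω N _ _ _ hN hP hfr => absurd ?_ hex⟩
    exact ⟨N, hP, hN ▸ two_le_mStar N hfr⟩
  obtain ⟨N₀, hN₀, hm⟩ := hex
  have hd3 : (3 : ℝ) ≤ d := by exact_mod_cast hd
  have hτ1 : 0 < τ + 1 := by linarith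
  obtain ⟨σ, hσ, hlow⟩ := exists_dirDeriv_lower_bound N₀ m (by omega)
  obtain ⟨K, hK, hvar⟩ := exists_variation_const B τ hτ1 hB m
  set Ω := ‖grad P 0‖ + 1 with hΩ
  have hΩ0 : 0 < Ω := by positivity
  set A := 2 * 2 ^ m * (2 * ((Ω / γ / (σ / 2)) ^ (1 / ((m : ℝ) - 1)) *
        ∑' k : Fin d → ℤ, (∑ i, |(k i : ℝ)|)⁻¹ ^ (d + 1))) * 4 ^ d *
        (volume (Metric.ball (0 : RSp d) 1)).toReal with hA
  have hA0 : 0 ≤ A := by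
    have : 0 ≤ ∑' k : Fin d → ℤ, (∑ i, |(k i : ℝ)|)⁻¹ ^ (d + 1) :=
      tsum_nonneg fun k => by positivity
    positivity
  -- The first bound on r keeps the variation Kr below σ/2, the second forces m ≤ m(r), so that ∇N_r
  -- takes values in the limit space. The bound on γ̄ makes every sublevel height at most σ/2.
  refine ⟨A + 1, min (σ / (2 * K)) ((c / (m + 1)) ^ (τ + 1)), σ / 2 * γ / Ω, by positivity,
    by positivity, by positivity, ?_⟩
  intro ω N hω hgrad hgrow hmS hP hfr r γb hr hr' hγb hγb'
  set n := truncOrder c τ r with hn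
  have hr1 : r * K ≤ σ / 2 := by
    have := (hr'.trans_le (min_le_left _ _)).le
    rw [le_div_iff₀ (by positivity)] at this
    linarith
  have hr2 : r < (c / (m + 1)) ^ (τ + 1) := hr'.trans_le (min_le_right _ _)
  have hrr : 0 < r ^ (1 / (τ + 1)) := by positivity
  have hneg : r ^ (-(1 / (τ + 1))) = (r ^ (1 / (τ + 1)))⁻¹ := Real.rpow_neg hr.le _
  have hroot : r ^ (1 / (τ + 1)) ≤ c / (m + 1) := by
    have := Real.rpow_le_rpow hr.le hr2.le (show 0 ≤ 1 / (τ + 1) by positivity)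
    rwa [← Real.rpow_mul (by positivity), mul_one_div_cancel hτ1.ne', Real.rpow_one] at this
  have hmn : m ≤ n := by
    rw [hn, truncOrder]
    refine Nat.le_floor ?_
    rw [hneg, ← div_eq_mul_inv, le_div_iff₀ hrr]
    rw [le_div_iff₀ (by positivity)] at hroot
    nlinarith
  have hnr : (n : ℝ) ^ (τ + 1) * r ≤ c ^ (τ + 1) := by
    have h1 : (n : ℝ) ≤ c * r ^ (-(1 / (τ + 1))) := Nat.floor_le (by positivity)
    rw [hneg, ← div_eq_mul_inv, le_div_iff₀ hrr] at h1
    have h2 := Real.rpow_le_rpow (by positivity) h1 hτ1.le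
    rwa [Real.mul_rpow (by positivity) hrr.le, ← Real.rpow_mul hr.le,
      one_div_mul_cancel hτ1.ne', Real.rpow_one] at h2
  have hV : freqSpace N n = freqSpace N m := by
    have := (mStar_spec N).2 n (by rw [hmS]; exact hmn)
    rwa [hmS] at this
  have hV0 : freqSpace N m = freqSpace N₀ m := by simp only [freqSpace, hP, hN₀]
  have hΩω : ‖ω‖ + 1 = Ω := by rw [hΩ, ← hP, hgrad]
  have key := volume_nonDiophantine_le (by omega) γ τ (σ / 2) γb r hγ (by positivity) hr hγb ω hω m hm
    (freqSpace N m) (hgrad ▸ grad_mem_freqSpace N m 0) (truncBNF N n)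
    (fun x => hV ▸ grad_mem_freqSpace N n x)
    (by
      rw [hΩω, div_le_iff₀ hγ]
      rw [lt_div_iff₀ hΩ0] at hγb'
      exact hγb'.le)
    (by
      intro u hu hu1
      obtain ⟨j, hj, e, he, hle⟩ := hlow u (hV0 ▸ hu) hu1
      refine ⟨j, hj, e, he, fun x hx => ?_⟩
      have h1 := (abs_evalAt_truncBNF_sub_le N B τ c r hτ1.le hr hB hcB hgrow m n hmn hnr j hj e u he
        hu1.le x hx).trans (hvar j hj n r hr)
      rw [hN₀, ← hP] at hle
      have h2 := abs_sub_abs_le_abs_sub (evalAt ((dirDeriv e)^[j] (dirDeriv u (truncBNF N m))) 0)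
        (evalAt ((dirDeriv e)^[j] (dirDeriv u (truncBNF N n))) x)
      rw [abs_sub_comm] at h2
      linarith)
  refine key.trans (ENNReal.ofReal_le_ofReal ?_)
  rw [hΩω, ← hA]
  gcongr
  linarith

/-! ### Absolutely convergent trigonometric series with polynomial coefficients -/

/-- The phase `2π k · θ`. -/
noncomputable def phase {d : ℕ} (k : Fin d → ℤ) (θ : RSp d) : ℝ :=
  2 * Real.pi * ∑ l, (k l : ℝ) * θ l

/-- The `ℓ¹` norm of an integer vector. -/
noncomputable def latNorm {d : ℕ} (k : Fin d → ℤ) : ℝ := ∑ l, |(k l : ℝ)|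

/-- The monomial `I ^ α`. -/
noncomputable def powMon {d : ℕ} (α : Fin d →₀ ℕ) (I : RSp d) : ℝ := ∏ l, I l ^ α l

/-- `F(θ, I)` is a sum of terms `a cos(2π k · θ + φ) I ^ α` with `|α| = j`, and
`∑ |a| exp(s |k|) ≤ C`. -/
def IsTrig {d : ℕ} (s : ℝ) (j : ℕ) (C : ℝ) (F : RSp d × RSp d → ℝ) : Prop :=
  ∃ (ι : Type) (a φ : ι → ℝ) (k : ι → Fin d → ℤ) (α : ι → Fin d →₀ ℕ),
    (∀ i, (α i).degree = j) ∧ Summable (fun i => |a i| * Real.exp (s * latNorm (k i))) ∧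
    ∑' i, |a i| * Real.exp (s * latNorm (k i)) ≤ C ∧
    ∀ p, HasSum (fun i => a i * Real.cos (phase (k i) p.1 + φ i) * powMon (α i) p.2) (F p)

section Basic

variable {d : ℕ}

theorem latNorm_nonneg (k : Fin d → ℤ) : 0 ≤ latNorm k :=
  Finset.sum_nonneg fun _ _ => abs_nonneg _

theorem latNorm_add_le (k k' : Fin d → ℤ) : latNorm (k + k') ≤ latNorm k + latNorm k' := by
  rw [latNorm, latNorm, latNorm, ← Finset.sum_add_distrib]
  refine Finset.sum_le_sum fun l _ => ?_
  simpa using abs_add_le (k l : ℝ) (k' l)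

theorem latNorm_neg (k : Fin d → ℤ) : latNorm (-k) = latNorm k := by simp [latNorm]

theorem phase_add (k k' : Fin d → ℤ) (θ : RSp d) : phase (k + k') θ = phase k θ + phase k' θ := by
  simp [phase, add_mul, Finset.sum_add_distrib, mul_add]

theorem phase_neg (k : Fin d → ℤ) (θ : RSp d) : phase (-k) θ = -phase k θ := by
  simp [phase]

theorem phase_add_intVec (k k' : Fin d → ℤ) (θ : RSp d) :
    ∃ n : ℤ, phase k (θ + intVec k') = phase k θ + n * (2 * Real.pi) := by
  refine ⟨∑ l, k l * k' l, ?_⟩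
  simp only [phase, intVec, PiLp.add_apply, mul_add, Finset.sum_add_distrib]
  push_cast
  ring

theorem powMon_add (α β : Fin d →₀ ℕ) (I : RSp d) :
    powMon (α + β) I = powMon α I * powMon β I := by
  simp [powMon, pow_add, Finset.prod_mul_distrib]

theorem powMon_smul (α : Fin d →₀ ℕ) (t : ℝ) (I : RSp d) :
    powMon α (t • I) = t ^ α.degree * powMon α I := by
  simp [powMon, mul_pow, Finset.prod_mul_distrib, Finsupp.degree_eq_sum, Finset.prod_pow_eq_pow_sum]

theorem abs_powMon_le (α : Fin d →₀ ℕ) (I : RSp d) : |powMon α I| ≤ ‖I‖ ^ α.degree := by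
  rw [powMon, Finset.abs_prod, Finsupp.degree_eq_sum, ← Finset.prod_pow_eq_pow_sum]
  refine Finset.prod_le_prod (fun _ _ => abs_nonneg _) fun i _ => ?_
  rw [abs_pow]
  gcongr
  exact PiLp.norm_apply_le I i

theorem evalAt_monomial (α : Fin d →₀ ℕ) (c : ℝ) (I : RSp d) :
    evalAt (MvPolynomial.monomial α c) I = c * powMon α I := by
  rw [evalAt, MvPolynomial.eval_monomial, powMon, Finsupp.prod_fintype _ _ (by simp)]

theorem abs_le_abs_mul_exp (s : ℝ) (hs : 0 ≤ s) (a : ℝ) (k : Fin d → ℤ) :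
    |a| ≤ |a| * Real.exp (s * latNorm k) :=
  le_mul_of_one_le_right (abs_nonneg _)
    (Real.one_le_exp (mul_nonneg hs (latNorm_nonneg k)))

theorem abs_term_le (s : ℝ) (hs : 0 ≤ s) (a φ : ℝ) (k : Fin d → ℤ) (α : Fin d →₀ ℕ) (p : RSp d × RSp d) :
    |a * Real.cos (phase k p.1 + φ) * powMon α p.2| ≤
      |a| * Real.exp (s * latNorm k) * ‖p.2‖ ^ α.degree := by
  rw [abs_mul, abs_mul]
  refine mul_le_mul ?_ (abs_powMon_le _ _) (abs_nonneg _) (by positivity)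
  refine (mul_le_of_le_one_right (abs_nonneg _) (Real.abs_cos_le_one _)).trans ?_
  exact abs_le_abs_mul_exp s hs a k

theorem IsTrig.nonneg {s C : ℝ} {j : ℕ} {F : RSp d × RSp d → ℝ} (h : IsTrig s j C F) : 0 ≤ C := by
  obtain ⟨ι, a, φ, k, α, hα, hsum, hle, hF⟩ := h
  exact (tsum_nonneg fun i => by positivity).trans hle

theorem IsTrig.mono {s s' C C' : ℝ} {j : ℕ} {F : RSp d × RSp d → ℝ} (h : IsTrig s j C F)
    (hs : s' ≤ s) (hC : C ≤ C') : IsTrig s' j C' F := by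
  obtain ⟨ι, a, φ, k, α, hα, hsum, hle, hF⟩ := h
  have hmono : ∀ i, |a i| * Real.exp (s' * latNorm (k i)) ≤
      |a i| * Real.exp (s * latNorm (k i)) := by
    intro i
    have := latNorm_nonneg (k i)
    gcongr
  have hsum' := Summable.of_nonneg_of_le (fun i => by positivity) hmono hsum
  exact ⟨ι, a, φ, k, α, hα, hsum', (hsum'.tsum_le_tsum hmono hsum).trans (hle.trans hC), hF⟩

theorem IsTrig.abs_le {s C : ℝ} {j : ℕ} {F : RSp d × RSp d → ℝ} (h : IsTrig s j C F) (hs : 0 ≤ s)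
    (p : RSp d × RSp d) : |F p| ≤ C * ‖p.2‖ ^ j := by
  obtain ⟨ι, a, φ, k, α, hα, hsum, hle, hF⟩ := h
  have hb : ∀ i, ‖a i * Real.cos (phase (k i) p.1 + φ i) * powMon (α i) p.2‖ ≤
      |a i| * Real.exp (s * latNorm (k i)) * ‖p.2‖ ^ j := by
    intro i
    rw [← hα i]
    exact abs_term_le s hs _ _ _ _ _
  rw [← (hF p).tsum_eq]
  refine (tsum_of_norm_bounded (hsum.mul_right _).hasSum hb).trans ?_
  rw [tsum_mul_right]
  gcongr

theorem IsTrig.smul_right {s C : ℝ} {j : ℕ} {F : RSp d × RSp d → ℝ} (h : IsTrig s j C F)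
    (t : ℝ) (θ I : RSp d) : F (θ, t • I) = t ^ j * F (θ, I) := by
  obtain ⟨ι, a, φ, k, α, hα, hsum, hle, hF⟩ := h
  refine (hF (θ, t • I)).unique (((hF (θ, I)).mul_left (t ^ j)).congr_fun ?_)
  intro i
  simp only [powMon_smul, hα i]
  ring

theorem isTrig_zero (s : ℝ) (j : ℕ) : IsTrig (d := d) s j 0 0 :=
  ⟨Empty, Empty.elim, Empty.elim, fun i => i.elim, fun i => i.elim, fun i => i.elim, summable_empty,
    by simp, fun p => by simp⟩

theorem isTrig_monomial (s : ℝ) (c : ℝ) (α : Fin d →₀ ℕ) :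
    IsTrig (d := d) s α.degree |c| fun p => c * powMon α p.2 := by
  refine ⟨Unit, fun _ => c, fun _ => 0, fun _ => 0, fun _ => α, fun _ => rfl, ?_, ?_, fun p => ?_⟩
  · exact (hasSum_fintype _).summable
  · simp [latNorm]
  · simp [phase]

theorem isTrig_tsum (s : ℝ) (hs : 0 ≤ s) (j : ℕ) {ι : Type} (a φ : ι → ℝ) (k : ι → Fin d → ℤ)
    (α : ι → Fin d →₀ ℕ) (hα : ∀ i, (α i).degree = j) (w : ι → ℝ) (hw : Summable w)
    (h : ∀ i, |a i| * Real.exp (s * latNorm (k i)) ≤ w i) :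
    IsTrig s j (∑' i, w i)
      (fun p => ∑' i, a i * Real.cos (phase (k i) p.1 + φ i) * powMon (α i) p.2) ∧
    ∀ p : RSp d × RSp d,
      Summable fun i => a i * Real.cos (phase (k i) p.1 + φ i) * powMon (α i) p.2 := by
  have hsm : Summable fun i => |a i| * Real.exp (s * latNorm (k i)) :=
    Summable.of_nonneg_of_le (fun x => by positivity) h hw
  have hsp : ∀ p : RSp d × RSp d,
      Summable fun i => a i * Real.cos (phase (k i) p.1 + φ i) * powMon (α i) p.2 := by
    intro p
    refine Summable.of_norm_bounded (hsm.mul_right (‖p.2‖ ^ j)) fun x => ?_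
    refine (abs_term_le s hs _ _ _ _ _).trans_eq ?_
    rw [hα]
  exact ⟨⟨ι, a, φ, k, α, hα, hsm, hsm.tsum_le_tsum h hw, fun p => (hsp p).hasSum⟩, hsp⟩

theorem IsTrig.add {s C C' : ℝ} {j : ℕ} {F G : RSp d × RSp d → ℝ} (h : IsTrig s j C F)
    (h' : IsTrig s j C' G) : IsTrig s j (C + C') (F + G) := by
  obtain ⟨ι, a, φ, k, α, hα, hsum, hle, hF⟩ := h
  obtain ⟨ι', a', φ', k', α', hα', hsum', hle', hF'⟩ := h'
  have hs := HasSum.sum (f := fun i : ι ⊕ ι' => |Sum.elim a a' i| *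
    Real.exp (s * latNorm (Sum.elim k k' i))) (a := ∑' i, |a i| * Real.exp (s * latNorm (k i)))
    (b := ∑' i, |a' i| * Real.exp (s * latNorm (k' i))) hsum.hasSum hsum'.hasSum
  refine ⟨ι ⊕ ι', Sum.elim a a', Sum.elim φ φ', Sum.elim k k', Sum.elim α α', ?_, hs.summable, ?_,
    fun p => ?_⟩
  · rintro (i | i)
    · exact hα i
    · exact hα' i
  · rw [hs.tsum_eq]; gcongr
  · exact HasSum.sum (hF p) (hF' p)

theorem IsTrig.finset_sum {s : ℝ} {j : ℕ} {ι : Type*} (t : Finset ι) (C : ι → ℝ)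
    (F : ι → RSp d × RSp d → ℝ) (h : ∀ i ∈ t, IsTrig s j (C i) (F i)) :
    IsTrig s j (∑ i ∈ t, C i) (∑ i ∈ t, F i) := by
  classical
  induction t using Finset.induction_on with
  | empty => simpa using isTrig_zero s j
  | insert a t ha ih =>
    rw [Finset.sum_insert ha, Finset.sum_insert ha]
    exact (h a (Finset.mem_insert_self _ _)).add (ih fun i hi => h i (Finset.mem_insert_of_mem hi))

/-- Product-to-sum formula: a pair of terms gives frequencies k + k' and k - k', each with half the
product of the amplitudes. Both have ℓ¹ norm at most |k| + |k'|, so the weighted norm is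
submultiplicative with constant 1. -/
theorem IsTrig.mul {s C C' : ℝ} {j j' : ℕ} {F G : RSp d × RSp d → ℝ} (h : IsTrig s j C F)
    (h' : IsTrig s j' C' G) (hs : 0 ≤ s) : IsTrig s (j + j') (C * C') (F * G) := by
  have hC := h.nonneg
  obtain ⟨ι, a, φ, k, α, hα, hsum, hle, hF⟩ := h
  obtain ⟨ι', a', φ', k', α', hα', hsum', hle', hF'⟩ := h'
  set w : ι → ℝ := fun i => |a i| * Real.exp (s * latNorm (k i)) with hw
  set w' : ι' → ℝ := fun i => |a' i| * Real.exp (s * latNorm (k' i)) with hw'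
  have hww : Summable fun x : ι × ι' => w x.1 * w' x.2 :=
    summable_mul_of_summable_norm (by simpa [hw, abs_mul] using hsum)
      (by simpa [hw', abs_mul] using hsum')
  have hww' : ∑' x : ι × ι', w x.1 * w' x.2 = (∑' i, w i) * ∑' i, w' i :=
    (tsum_mul_tsum_of_summable_norm (by simpa [hw, abs_mul] using hsum)
      (by simpa [hw', abs_mul] using hsum')).symm
  let A : ι × ι' → ℝ := fun x => a x.1 * a' x.2 / 2
  have hA : ∀ (x : ι × ι') (κ : Fin d → ℤ), latNorm κ ≤ latNorm (k x.1) + latNorm (k' x.2) →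
      |A x| * Real.exp (s * latNorm κ) ≤ w x.1 * w' x.2 / 2 := by
    intro x κ hκ
    have : Real.exp (s * latNorm κ) ≤
        Real.exp (s * latNorm (k x.1)) * Real.exp (s * latNorm (k' x.2)) := by
      rw [← Real.exp_add, ← mul_add]; gcongr
    calc |A x| * Real.exp (s * latNorm κ)
        ≤ |A x| * (Real.exp (s * latNorm (k x.1)) * Real.exp (s * latNorm (k' x.2))) := by gcongr
      _ = _ := by simp only [A, hw, hw', abs_div, abs_mul, abs_two]; ring
  have hW : ∑' x : ι × ι', w x.1 * w' x.2 / 2 ≤ C * C' / 2 := by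
    rw [tsum_div_const, hww']
    gcongr
  have hplus := isTrig_tsum s hs (j + j') A (fun x => φ x.1 + φ' x.2) (fun x => k x.1 + k' x.2)
    (fun x => α x.1 + α' x.2) (fun x => by rw [map_add, hα, hα']) _ (hww.div_const 2)
    (fun x => hA x (k x.1 + k' x.2) (latNorm_add_le _ _))
  have hminus := isTrig_tsum s hs (j + j') A (fun x => φ x.1 - φ' x.2) (fun x => k x.1 + -k' x.2)
    (fun x => α x.1 + α' x.2) (fun x => by rw [map_add, hα, hα']) _ (hww.div_const 2)
    (fun x => hA x (k x.1 + -k' x.2) ((latNorm_add_le _ _).trans_eq (by rw [latNorm_neg])))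
  have hadd := (hplus.1.mono le_rfl hW).add (hminus.1.mono le_rfl hW)
  rw [add_halves] at hadd
  convert hadd using 1
  ext p
  have h1 : ∀ i, ‖a i * Real.cos (phase (k i) p.1 + φ i) * powMon (α i) p.2‖ ≤
      w i * ‖p.2‖ ^ j := fun i => by
    rw [← hα i]; exact abs_term_le s hs _ _ _ _ _
  have h2 : ∀ i, ‖a' i * Real.cos (phase (k' i) p.1 + φ' i) * powMon (α' i) p.2‖ ≤
      w' i * ‖p.2‖ ^ j' := fun i => by
    rw [← hα' i]; exact abs_term_le s hs _ _ _ _ _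
  rw [Pi.mul_apply, Pi.add_apply, ← (hplus.2 p).tsum_add (hminus.2 p), ← (hF p).tsum_eq,
    ← (hF' p).tsum_eq, tsum_mul_tsum_of_summable_norm
      (Summable.of_nonneg_of_le (fun _ => norm_nonneg _) h1 (hsum.mul_right _))
      (Summable.of_nonneg_of_le (fun _ => norm_nonneg _) h2 (hsum'.mul_right _))]
  refine tsum_congr fun x => ?_
  have e1 : phase (k x.1 + k' x.2) p.1 + (φ x.1 + φ' x.2) =
      (phase (k x.1) p.1 + φ x.1) + (phase (k' x.2) p.1 + φ' x.2) := by
    rw [phase_add]; ring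
  have e2 : phase (k x.1 + -k' x.2) p.1 + (φ x.1 - φ' x.2) =
      (phase (k x.1) p.1 + φ x.1) - (phase (k' x.2) p.1 + φ' x.2) := by
    rw [phase_add, phase_neg]; ring
  rw [e1, e2, powMon_add]
  generalize phase (k x.1) p.1 + φ x.1 = X
  generalize phase (k' x.2) p.1 + φ' x.2 = Y
  rw [Real.cos_add, Real.cos_sub]
  simp only [A]
  ring

end Basic

/-! ### The homological equation -/

/-- The inequality x ≤ exp x at x = σy/p, raised to the power p. -/
theorem rpow_mul_exp_neg_le (p σ y : ℝ) (hp : 0 < p) (hσ : 0 < σ) (hy : 0 ≤ y) :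
    y ^ p * Real.exp (-(σ * y)) ≤ (p / σ) ^ p := by
  have h1 : σ * y / p ≤ Real.exp (σ * y / p) := by
    have := Real.add_one_le_exp (σ * y / p); linarith
  have h2 : (σ * y / p) ^ p ≤ Real.exp (σ * y) := by
    calc (σ * y / p) ^ p ≤ Real.exp (σ * y / p) ^ p := by gcongr
      _ = _ := by rw [← Real.exp_mul]; congr 1; field_simp
  have h3 : y ^ p = (p / σ) ^ p * (σ * y / p) ^ p := by
    rw [← Real.mul_rpow (by positivity) (by positivity)]; congr 1; field_simp
  rw [h3, Real.exp_neg, mul_assoc]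
  refine mul_le_of_le_one_right (by positivity) ?_
  rw [mul_inv_le_iff₀ (Real.exp_pos _), one_mul]
  exact h2

theorem abs_coord_le_latNorm {d : ℕ} (k : Fin d → ℤ) (l : Fin d) : |(k l : ℝ)| ≤ latNorm k :=
  Finset.single_le_sum (f := fun l => |(k l : ℝ)|) (fun _ _ => abs_nonneg _) (Finset.mem_univ l)

theorem norm_intVec_le {d : ℕ} (k : Fin d → ℤ) : ‖intVec k‖ ≤ latNorm k := by
  rw [EuclideanSpace.norm_eq]
  refine Real.sqrt_le_iff.2 ⟨latNorm_nonneg k, ?_⟩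
  simp only [intVec, latNorm, Real.norm_eq_abs]
  exact Finset.sum_sq_le_sq_sum_of_nonneg fun _ _ => abs_nonneg _

/-- The small divisor costs |k|^τ and the angular derivative one more |k|; the resulting |k|^{τ+1}
is traded for strip width. This is the source of the Gevrey exponent τ + 1. -/
theorem latNorm_div_le {d : ℕ} {γ τ : ℝ} (hγ : 0 < γ) (hτ : 0 < τ + 1) {ω : RSp d}
    (hω : ω ∈ DC d τ γ) {σ : ℝ} (hσ : 0 < σ) (k : Fin d → ℤ) (hk : k ≠ 0) :
    latNorm k / |∑ l, ω l * (k l : ℝ)| ≤ ((τ + 1) / σ) ^ (τ + 1) / γ * Real.exp (σ * latNorm k) := by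
  have h1 : 1 ≤ latNorm k := one_le_sum_abs k hk
  have h0 : 0 < latNorm k := by linarith
  have h2 : γ * latNorm k ^ (-τ) ≤ |∑ l, ω l * (k l : ℝ)| := hω k hk
  have h3 : 0 < γ * latNorm k ^ (-τ) := by positivity
  have h4 := rpow_mul_exp_neg_le (τ + 1) σ (latNorm k) hτ hσ h0.le
  rw [Real.exp_neg, mul_inv_le_iff₀ (Real.exp_pos _)] at h4
  calc latNorm k / |∑ l, ω l * (k l : ℝ)| ≤ latNorm k / (γ * latNorm k ^ (-τ)) := by gcongr
    _ = latNorm k ^ (τ + 1) / γ := by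
      rw [Real.rpow_neg h0.le, Real.rpow_add h0, Real.rpow_one]; field_simp
    _ ≤ ((τ + 1) / σ) ^ (τ + 1) * Real.exp (σ * latNorm k) / γ := by gcongr
    _ = _ := by ring

/-- Terms of degree `j` summed up to a homogeneous polynomial. -/
theorem exists_polynomial_of_summable {d : ℕ} {ι : Type} (j : ℕ) (a : ι → ℝ) (α : ι → Fin d →₀ ℕ)
    (hα : ∀ i, (α i).degree = j) (w : ι → ℝ) (hw : Summable w) (haw : ∀ i, |a i| ≤ w i) :
    ∃ n : MvPolynomial (Fin d) ℝ, n.IsHomogeneous j ∧ coeffNorm n ≤ ∑' i, w i ∧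
      ∀ I, evalAt n I = ∑' i, a i * powMon (α i) I := by
  classical
  set T := Finset.finsuppAntidiag (Finset.univ : Finset (Fin d)) j with hT
  have hmem : ∀ i, α i ∈ T := fun i => by
    rw [hT, Finset.mem_finsuppAntidiag, ← Finsupp.degree_eq_sum]
    exact ⟨hα i, Finset.subset_univ _⟩
  have hdeg : ∀ β ∈ T, β.degree = j := fun β hβ => by
    rw [hT, Finset.mem_finsuppAntidiag, ← Finsupp.degree_eq_sum] at hβ
    exact hβ.1
  have hs1 : ∀ β, Summable fun i => if α i = β then w i else 0 := fun β =>
    Summable.of_nonneg_of_le (fun i => by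
      split_ifs
      · exact (abs_nonneg _).trans (haw i)
      · exact le_rfl) (fun i => by
      split_ifs
      · exact le_rfl
      · exact (abs_nonneg _).trans (haw i)) hw
  have hle : ∀ β i, ‖if α i = β then a i else 0‖ ≤ if α i = β then w i else 0 := fun β i => by
    split_ifs
    · exact haw i
    · simp
  have hs2 : ∀ β, Summable fun i => if α i = β then a i else 0 := fun β =>
    Summable.of_norm_bounded (hs1 β) (hle β)
  refine ⟨∑ β ∈ T, MvPolynomial.monomial β (∑' i, if α i = β then a i else 0), ?_, ?_, fun I => ?_⟩
  · refine MvPolynomial.IsHomogeneous.sum _ _ _ fun β hβ =>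
      MvPolynomial.isHomogeneous_monomial _ (hdeg β hβ)
  · refine (coeffNorm_sum_le _ _).trans ?_
    calc ∑ β ∈ T, coeffNorm (MvPolynomial.monomial β (∑' i, if α i = β then a i else 0))
        ≤ ∑ β ∈ T, ∑' i, if α i = β then w i else 0 := by
          refine Finset.sum_le_sum fun β _ => ?_
          rw [coeffNorm_monomial]
          exact tsum_of_norm_bounded (hs1 β).hasSum (hle β)
      _ = ∑' i, ∑ β ∈ T, if α i = β then w i else 0 :=
          (Summable.tsum_finsetSum fun β _ => hs1 β).symm
      _ = ∑' i, w i := tsum_congr fun i => by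
          rw [Finset.sum_ite_eq, if_pos (hmem i)]
      _ ≤ _ := le_rfl
  · have : evalAt (∑ β ∈ T, MvPolynomial.monomial β (∑' i, if α i = β then a i else 0)) I =
        ∑ β ∈ T, ∑' i, (if α i = β then a i else 0) * powMon β I := by
      rw [evalAt, map_sum]
      refine Finset.sum_congr rfl fun β _ => ?_
      rw [tsum_mul_right]
      exact evalAt_monomial _ _ _
    rw [this, ← Summable.tsum_finsetSum fun β _ => (hs2 β).mul_right _]
    refine tsum_congr fun i => ?_
    simp only [ite_mul, zero_mul]
    rw [Finset.sum_ite_eq, if_pos (hmem i)]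

theorem hasFDerivAt_phase {d : ℕ} (k : Fin d → ℤ) (θ : RSp d) :
    HasFDerivAt (phase k) ((2 * Real.pi) • innerSL ℝ (intVec k)) θ := by
  have : phase k = fun θ => ((2 * Real.pi) • innerSL ℝ (intVec k)) θ := by
    ext θ
    simp only [phase, FunLike.coe_smul, Pi.smul_apply, innerSL_apply_apply, inner_intVec, smul_eq_mul]
    congr 1
    exact Finset.sum_congr rfl fun l _ => mul_comm _ _
  rw [this]
  exact ContinuousLinearMap.hasFDerivAt _

/-- The homological equation `ω · ∂S + F = n`, solved with a loss `σ` in the width of the strip. -/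
theorem IsTrig.exists_homological {d : ℕ} {γ τ : ℝ} (hγ : 0 < γ) (hτ : 0 < τ + 1) {ω : RSp d}
    (hω : ω ∈ DC d τ γ) {s σ C : ℝ} (hσ : 0 < σ) (hs : σ ≤ s) {j : ℕ} {F : RSp d × RSp d → ℝ}
    (h : IsTrig s j C F) :
    ∃ (S : RSp d × RSp d → ℝ) (G : Fin d → RSp d × RSp d → ℝ) (n : MvPolynomial (Fin d) ℝ),
      (∀ l, IsTrig (s - σ) j (((τ + 1) / σ) ^ (τ + 1) / γ * C) (G l)) ∧
      (∀ θ I, ∃ S' : RSp d →L[ℝ] ℝ, HasFDerivAt (fun θ => S (θ, I)) S' θ ∧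
        ∀ v, S' v = ∑ l, G l (θ, I) * v l) ∧
      (∀ θ I k, S (θ + intVec k, I) = S (θ, I)) ∧
      n.IsHomogeneous j ∧ coeffNorm n ≤ C ∧
      ∀ θ I, ∑ l, ω l * G l (θ, I) + F (θ, I) = evalAt n I := by
  classical
  obtain ⟨ι, a, φ, k, α, hα, hsum, hle, hF⟩ := h
  have hs0 : 0 ≤ s := hσ.le.trans hs
  set K := ((τ + 1) / σ) ^ (τ + 1) / γ with hK
  have hK0 : 0 ≤ K := by positivity
  set w : ι → ℝ := fun i => |a i| * Real.exp (s * latNorm (k i)) with hw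
  have hw0 : ∀ i, 0 ≤ w i := fun i => by positivity
  let q : ι → ℝ := fun i => ∑ l, ω l * (k i l : ℝ)
  have hq : ∀ i, k i ≠ 0 → q i ≠ 0 := by
    intro i hi h0
    have h1 := hω (k i) hi
    have h2 := one_le_sum_abs (k i) hi
    have h3 : 0 < γ * (∑ l, |(k i l : ℝ)|) ^ (-τ) := by
      have : 0 < ∑ l, |(k i l : ℝ)| := by linarith
      positivity
    have h4 : |∑ l, ω l * (k i l : ℝ)| = 0 := by simpa [q] using h0
    linarith
  -- Amplitudes of the derivative of the solution, up to the components of k. Only this derivative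
  -- enters the scheme, so only it is measured in the weighted norm.
  let b : ι → ℝ := fun i => if k i = 0 then 0 else -(a i / q i)
  have hb : ∀ i, |b i| * latNorm (k i) * Real.exp ((s - σ) * latNorm (k i)) ≤ K * w i := by
    intro i
    by_cases hi : k i = 0
    · simp only [b, if_pos hi, abs_zero, zero_mul]; exact mul_nonneg hK0 (hw0 i)
    · have h1 := latNorm_div_le hγ hτ hω hσ (k i) hi
      simp only [b, if_neg hi, abs_neg, abs_div]
      calc |a i| / |q i| * latNorm (k i) * Real.exp ((s - σ) * latNorm (k i))
          = |a i| * (latNorm (k i) / |q i|) * Real.exp ((s - σ) * latNorm (k i)) := by ring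
        _ ≤ |a i| * (K * Real.exp (σ * latNorm (k i))) * Real.exp ((s - σ) * latNorm (k i)) := by
            gcongr
        _ = K * w i := by
            have : s * latNorm (k i) = σ * latNorm (k i) + (s - σ) * latNorm (k i) := by ring
            simp only [hw]
            rw [this, Real.exp_add]; ring
  have hKw : Summable fun i => K * w i := hsum.mul_left K
  have hexp : ∀ i, 1 ≤ Real.exp ((s - σ) * latNorm (k i)) := fun i =>
    Real.one_le_exp (mul_nonneg (by linarith) (latNorm_nonneg _))
  have hG := fun l => isTrig_tsum (s - σ) (by linarith) j (fun i => b i * (k i l : ℝ)) φ k α hα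
    (fun i => K * w i) hKw (fun i => by
      refine le_trans ?_ (hb i)
      rw [abs_mul]
      gcongr
      exact abs_coord_le_latNorm _ _)
  let D : ι → RSp d → RSp d → (RSp d →L[ℝ] ℝ) := fun i θ I =>
    (b i * Real.cos (phase (k i) θ + φ i) * powMon (α i) I) • innerSL ℝ (intVec (k i))
  have hDb : ∀ i θ I, ‖D i θ I‖ ≤ K * w i * ‖I‖ ^ j := by
    intro i θ I
    simp only [D]
    rw [norm_smul, innerSL_apply_norm, Real.norm_eq_abs, abs_mul, abs_mul]
    calc |b i| * |Real.cos (phase (k i) θ + φ i)| * |powMon (α i) I| * ‖intVec (k i)‖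
        ≤ |b i| * 1 * ‖I‖ ^ j * latNorm (k i) := by
          gcongr
          · exact Real.abs_cos_le_one _
          · rw [← hα i]; exact abs_powMon_le _ _
          · exact norm_intVec_le _
      _ = |b i| * latNorm (k i) * 1 * ‖I‖ ^ j := by ring
      _ ≤ |b i| * latNorm (k i) * Real.exp ((s - σ) * latNorm (k i)) * ‖I‖ ^ j := by
          have := latNorm_nonneg (k i)
          gcongr
          exact hexp i
      _ ≤ _ := mul_le_mul_of_nonneg_right (hb i) (by positivity)
  let f : ι → RSp d → RSp d → ℝ := fun i θ I =>
    b i / (2 * Real.pi) * Real.sin (phase (k i) θ + φ i) * powMon (α i) I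
  have hf : ∀ i θ I, HasFDerivAt (fun θ => f i θ I) (D i θ I) θ := by
    intro i θ I
    have h1 := (((hasFDerivAt_phase (k i) θ).add_const (φ i)).sin.const_mul
      (b i / (2 * Real.pi))).mul_const (powMon (α i) I)
    refine h1.congr_fderiv ?_
    ext v
    simp only [D, FunLike.coe_smul, Pi.smul_apply, smul_eq_mul]
    field_simp
  have hfb : ∀ i θ I, ‖f i θ I‖ ≤ K * w i * ‖I‖ ^ j := by
    intro i θ I
    simp only [f]
    by_cases hi : k i = 0
    · simp only [b, if_pos hi, zero_div, zero_mul, norm_zero]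
      exact mul_nonneg (mul_nonneg hK0 (hw0 i)) (by positivity)
    have h1 : 1 ≤ latNorm (k i) := one_le_sum_abs (k i) hi
    rw [Real.norm_eq_abs, abs_mul, abs_mul, abs_div, abs_of_pos Real.two_pi_pos]
    have h2pi : 1 ≤ 2 * Real.pi := by linarith [Real.pi_gt_three]
    calc |b i| / (2 * Real.pi) * |Real.sin (phase (k i) θ + φ i)| * |powMon (α i) I|
        ≤ |b i| * 1 * ‖I‖ ^ j := by
          gcongr
          · exact div_le_self (abs_nonneg _) h2pi
          · exact Real.abs_sin_le_one _
          · rw [← hα i]; exact abs_powMon_le _ _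
      _ ≤ |b i| * (latNorm (k i) * Real.exp ((s - σ) * latNorm (k i))) * ‖I‖ ^ j := by
          gcongr
          exact one_le_mul_of_one_le_of_one_le h1 (hexp i)
      _ ≤ _ := by
          rw [← mul_assoc]
          exact mul_le_mul_of_nonneg_right (hb i) (by positivity)
  -- The terms with k = 0 form the angular mean, which cannot be removed and becomes the normal form
  -- part.
  obtain ⟨n, hn1, hn2, hn3⟩ := exists_polynomial_of_summable j
    (fun i => if k i = 0 then a i * Real.cos (φ i) else 0) α hα w hsum (fun i => by
      split_ifs
      · rw [abs_mul]
        exact (mul_le_of_le_one_right (abs_nonneg _) (Real.abs_cos_le_one _)).trans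
          (abs_le_abs_mul_exp s hs0 _ _)
      · simpa using hw0 i)
  refine ⟨fun p => ∑' i, f i p.1 p.2, fun l p => ∑' i, b i * (k i l : ℝ) *
    Real.cos (phase (k i) p.1 + φ i) * powMon (α i) p.2, n, fun l => ?_, fun θ I => ?_,
    fun θ I κ => ?_, hn1, hn2.trans hle, fun θ I => ?_⟩
  · refine (hG l).1.mono le_rfl ?_
    rw [tsum_mul_left]
    gcongr
  · have hsm : Summable fun i => K * w i * ‖I‖ ^ j := hKw.mul_right _
    refine ⟨∑' i, D i θ I, ?_, fun v => ?_⟩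
    · exact hasFDerivAt_tsum hsm (fun i x => hf i x I) (fun i x => hDb i x I)
        (Summable.of_norm_bounded hsm fun i => hfb i 0 I) θ
    · have hDs : Summable fun i => D i θ I := Summable.of_norm_bounded hsm fun i => hDb i θ I
      have h1 : (∑' i, D i θ I) v = ∑' i, D i θ I v :=
        ((ContinuousLinearMap.apply ℝ ℝ v).map_tsum hDs)
      rw [h1]
      simp only [← tsum_mul_right]
      rw [← Summable.tsum_finsetSum fun l _ => ((hG l).2 (θ, I)).mul_right _]
      refine tsum_congr fun i => ?_
      simp only [D, FunLike.coe_smul, Pi.smul_apply, innerSL_apply_apply, inner_intVec, smul_eq_mul]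
      rw [Finset.mul_sum]
      exact Finset.sum_congr rfl fun l _ => by ring
  · refine tsum_congr fun i => ?_
    obtain ⟨z, hz⟩ := phase_add_intVec (k i) κ θ
    simp only [f]
    rw [hz, add_right_comm, Real.sin_add_int_mul_two_pi]
  · rw [hn3, ← (hF (θ, I)).tsum_eq]
    simp only [← tsum_mul_left]
    rw [← Summable.tsum_finsetSum fun l _ => ((hG l).2 (θ, I)).mul_left _,
      ← Summable.tsum_add (summable_sum fun l _ => ((hG l).2 (θ, I)).mul_left _)
        (hF (θ, I)).summable]
    refine tsum_congr fun i => ?_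
    have h1 : ∑ l, ω l * (b i * (k i l : ℝ) * Real.cos (phase (k i) θ + φ i) * powMon (α i) I) =
        b i * q i * (Real.cos (phase (k i) θ + φ i) * powMon (α i) I) := by
      simp only [q, Finset.mul_sum, Finset.sum_mul]
      exact Finset.sum_congr rfl fun l _ => by ring
    simp only [h1]
    by_cases hi : k i = 0
    · simp [b, hi, phase]
    · simp only [b, if_neg hi]
      have := hq i hi
      field_simp
      simp

/-! ### The formal Hamilton-Jacobi equation -/

/-- The algebra of functions of `(θ, I)` that are bounded in `θ` for every `I`. -/
def bddAlg (d : ℕ) : Subalgebra ℝ (RSp d × RSp d → ℝ) where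
  carrier := {F | ∀ I, ∃ C, ∀ θ, |F (θ, I)| ≤ C}
  mul_mem' := by
    intro F G hF hG I
    obtain ⟨C, hC⟩ := hF I
    obtain ⟨C', hC'⟩ := hG I
    refine ⟨C * C', fun θ => ?_⟩
    rw [Pi.mul_apply, abs_mul]
    exact mul_le_mul (hC θ) (hC' θ) (abs_nonneg _) ((abs_nonneg _).trans (hC θ))
  add_mem' := by
    intro F G hF hG I
    obtain ⟨C, hC⟩ := hF I
    obtain ⟨C', hC'⟩ := hG I
    exact ⟨C + C', fun θ => (abs_add_le _ _).trans (add_le_add (hC θ) (hC' θ))⟩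
  algebraMap_mem' := fun r I => ⟨|r|, fun θ => by simp⟩

theorem IsTrig.mem_bddAlg {d : ℕ} {s C : ℝ} {j : ℕ} {F : RSp d × RSp d → ℝ} (h : IsTrig s j C F)
    (hs : 0 ≤ s) : F ∈ bddAlg d :=
  fun I => ⟨C * ‖I‖ ^ j, fun θ => h.abs_le hs (θ, I)⟩

/-- The coordinate function `I_l`. -/
def coordAct {d : ℕ} (l : Fin d) : bddAlg d :=
  ⟨fun p => p.2 l, fun I => ⟨|I l|, fun _ => le_rfl⟩⟩

theorem isTrig_coordAct {d : ℕ} (s : ℝ) (l : Fin d) :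
    IsTrig s 1 1 (coordAct l : RSp d × RSp d → ℝ) := by
  have h := isTrig_monomial s 1 (Finsupp.single l 1)
  rw [Finsupp.degree_single, abs_one] at h
  convert h using 1
  ext p
  rw [powMon, Finset.prod_eq_single l (by
    intro b _ hb; simp [hb]) (by simp)]
  simp [coordAct]

/-- The substitution of `X * W` in the terms of `∑ h_α I ^ α` with `α ∈ T`. -/
noncomputable def substH {d : ℕ} (T : Finset (Fin d →₀ ℕ)) (h : (Fin d →₀ ℕ) → bddAlg d)
    (W : Fin d → Polynomial (bddAlg d)) : Polynomial (bddAlg d) :=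
  ∑ α ∈ T, Polynomial.C (h α) * (Polynomial.X ^ α.degree * ∏ l, W l ^ α l)

theorem coeff_substH {d : ℕ} (T : Finset (Fin d →₀ ℕ)) (h : (Fin d →₀ ℕ) → bddAlg d)
    (W : Fin d → Polynomial (bddAlg d)) (n : ℕ) :
    (substH T h W).coeff n = ∑ α ∈ T, if α.degree ≤ n then
      h α * (∏ l, W l ^ α l).coeff (n - α.degree) else 0 := by
  rw [substH, Polynomial.finsetSum_coeff]
  refine Finset.sum_congr rfl fun α _ => ?_
  rw [Polynomial.coeff_C_mul, Polynomial.coeff_X_pow_mul']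
  split_ifs <;> simp

theorem dvd_prod_pow_sub_prod_pow {A ι : Type*} [CommRing A] [Fintype ι] (a : A) (f g : ι → A)
    (h : ∀ i, a ∣ g i - f i) (α : ι → ℕ) : a ∣ ∏ i, g i ^ α i - ∏ i, f i ^ α i := by
  rw [← Ideal.mem_span_singleton, ← Ideal.Quotient.mk_eq_mk_iff_sub_mem]
  simp only [map_prod, map_pow]
  refine Finset.prod_congr rfl fun i _ => ?_
  congr 1
  rw [Ideal.Quotient.mk_eq_mk_iff_sub_mem, Ideal.mem_span_singleton]
  exact h i

/-- The system is triangular. A term of degree at least 2 carries a factor X², so its coefficient of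
order J + 1 sees the unknowns only below order J. -/
theorem coeff_substH_congr {d : ℕ} (T : Finset (Fin d →₀ ℕ)) (hT : ∀ α ∈ T, 2 ≤ α.degree)
    (h : (Fin d →₀ ℕ) → bddAlg d) (W W' : Fin d → Polynomial (bddAlg d)) (J : ℕ)
    (hW : ∀ l, (Polynomial.X : Polynomial (bddAlg d)) ^ J ∣ W' l - W l) (n : ℕ) (hn : n ≤ J + 1) :
    (substH T h W').coeff n = (substH T h W).coeff n := by
  rw [coeff_substH, coeff_substH]
  refine Finset.sum_congr rfl fun α hα => ?_
  split_ifs with hαn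
  · congr 1
    have h1 : (Polynomial.X : Polynomial (bddAlg d)) ^ J ∣ ∏ l, W' l ^ α l - ∏ l, W l ^ α l := dvd_prod_pow_sub_prod_pow _ W W' hW α
    have h2 := Polynomial.X_pow_dvd_iff.1 h1 (n - α.degree) (by have := hT α hα; omega)
    rwa [Polynomial.coeff_sub, sub_eq_zero] at h2
  · rfl

/-! ### Majorants for the Taylor coefficients, stable under multiplication -/

section Majorant

variable {d : ℕ}

/-- The weights 1/(j+1)² reproduce themselves under convolution up to the constant 8, so products of
many series lose only powers of 8 and no power of j. The inequality (a+b+1)² ≤ 2(a+1)² + 2(b+1)²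
splits the sum into two copies of ∑ 1/(i+1)² ≤ 2. -/
theorem sum_antidiagonal_inv_sq_le (j : ℕ) :
    ∑ x ∈ Finset.HasAntidiagonal.antidiagonal j, 1 / (((x.1 : ℝ) + 1) ^ 2 * ((x.2 : ℝ) + 1) ^ 2) ≤
      8 / ((j : ℝ) + 1) ^ 2 := by
  have hS : ∀ n : ℕ, ∑ i ∈ Finset.range (n + 1), 1 / ((i : ℝ) + 1) ^ 2 ≤ 2 - 1 / ((n : ℝ) + 1) := by
    intro n
    induction n with
    | zero => norm_num
    | succ n ih =>
      rw [Finset.sum_range_succ]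
      have h1 : 1 / ((((n + 1 : ℕ) : ℝ)) + 1) ^ 2 ≤
          1 / ((n : ℝ) + 1) - 1 / (((n + 1 : ℕ) : ℝ) + 1) := by
        push_cast
        rw [div_sub_div _ _ (by positivity) (by positivity),
          div_le_div_iff₀ (by positivity) (by positivity)]
        nlinarith [show (0 : ℝ) ≤ n by positivity]
      linarith
  have h1 : ∀ x ∈ Finset.HasAntidiagonal.antidiagonal j, 1 / (((x.1 : ℝ) + 1) ^ 2 * ((x.2 : ℝ) + 1) ^ 2) ≤
      2 / ((j : ℝ) + 1) ^ 2 * (1 / ((x.1 : ℝ) + 1) ^ 2) +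
        2 / ((j : ℝ) + 1) ^ 2 * (1 / ((x.2 : ℝ) + 1) ^ 2) := by
    intro x hx
    have hx' : (j : ℝ) = x.1 + x.2 := by exact_mod_cast (Finset.HasAntidiagonal.mem_antidiagonal.1 hx).symm
    rw [hx']
    have ha : (0 : ℝ) ≤ x.1 := by positivity
    have hb : (0 : ℝ) ≤ x.2 := by positivity
    generalize (x.1 : ℝ) = a at *
    generalize (x.2 : ℝ) = b at *
    rw [div_mul_div_comm, div_mul_div_comm, div_add_div _ _ (by positivity) (by positivity),
      div_le_div_iff₀ (by positivity) (by positivity)]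
    have h5 : (a + b + 1) ^ 2 ≤ 2 * (a + 1) ^ 2 + 2 * (b + 1) ^ 2 := by nlinarith [sq_nonneg (a - b)]
    have h6 : 0 ≤ (a + b + 1) ^ 2 * ((a + 1) ^ 2 * (b + 1) ^ 2) := by positivity
    nlinarith [mul_le_mul_of_nonneg_left h5 h6]
  refine (Finset.sum_le_sum h1).trans ?_
  rw [Finset.sum_add_distrib, ← Finset.mul_sum, ← Finset.mul_sum,
    Finset.Nat.sum_antidiagonal_eq_sum_range_succ_mk, Finset.Nat.sum_antidiagonal_eq_sum_range_succ_mk]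
  have h2 : ∑ i ∈ Finset.range j.succ, 1 / (((j - i : ℕ) : ℝ) + 1) ^ 2 =
      ∑ i ∈ Finset.range j.succ, 1 / ((i : ℝ) + 1) ^ 2 := by
    rw [← Finset.sum_range_reflect]
    refine Finset.sum_congr rfl fun i hi => ?_
    have : j - (j.succ - 1 - i) = i := by rw [Finset.mem_range] at hi; omega
    rw [this]
  simp only [h2]
  have h3 := hS j
  have h4 : ∑ i ∈ Finset.range j.succ, 1 / ((i : ℝ) + 1) ^ 2 ≤ 2 := by
    have : 0 ≤ 1 / ((j : ℝ) + 1) := by positivity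
    linarith
  calc _ ≤ 2 / ((j : ℝ) + 1) ^ 2 * 2 + 2 / ((j : ℝ) + 1) ^ 2 * 2 := by gcongr
    _ = _ := by ring

/-- The coefficient of degree `j ≤ J` of `p` is a trigonometric series of degree `j + e` in the
strip of width `s j`, of norm at most `D κ ^ j / (j + 1) ^ 2`. -/
def Dominated (s : ℕ → ℝ) (κ : ℝ) (J e : ℕ) (D : ℝ) (p : Polynomial (bddAlg d)) : Prop :=
  ∀ j ≤ J, IsTrig (s j) (j + e) (D * κ ^ j / ((j : ℝ) + 1) ^ 2) (p.coeff j : RSp d × RSp d → ℝ)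

theorem coe_sum_bddAlg {ι : Type*} (t : Finset ι) (f : ι → bddAlg d) :
    ((∑ i ∈ t, f i : bddAlg d) : RSp d × RSp d → ℝ) =
      ∑ i ∈ t, (f i : RSp d × RSp d → ℝ) := by
  exact map_sum (bddAlg d).val f t

theorem Dominated.mul {s : ℕ → ℝ} (hs0 : ∀ j, 0 ≤ s j) (hs : Antitone s) {κ : ℝ} (hκ : 0 ≤ κ)
    {J e e' : ℕ} {D D' : ℝ} (hD : 0 ≤ D) (hD' : 0 ≤ D') {p q : Polynomial (bddAlg d)}
    (hp : Dominated s κ J e D p)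
    (hq : Dominated s κ J e' D' q) : Dominated s κ J (e + e') (8 * (D * D')) (p * q) := by
  intro j hj
  rw [Polynomial.coeff_mul, coe_sum_bddAlg]
  have h1 : ∀ x ∈ Finset.HasAntidiagonal.antidiagonal j, IsTrig (s j) (j + (e + e'))
      (D * D' * κ ^ j * (1 / (((x.1 : ℝ) + 1) ^ 2 * ((x.2 : ℝ) + 1) ^ 2)))
      ((p.coeff x.1 * q.coeff x.2 : bddAlg d) : RSp d × RSp d → ℝ) := by
    intro x hx
    rw [Finset.HasAntidiagonal.mem_antidiagonal] at hx
    have h2 := ((hp x.1 (by omega)).mono (hs (show x.1 ≤ j by omega)) le_rfl).mul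
      ((hq x.2 (by omega)).mono (hs (show x.2 ≤ j by omega)) le_rfl) (hs0 j)
    have e1 : x.1 + e + (x.2 + e') = j + (e + e') := by omega
    rw [e1] at h2
    refine h2.mono le_rfl (le_of_eq ?_)
    rw [← hx, pow_add]
    field_simp
  refine (IsTrig.finset_sum _ _ _ h1).mono le_rfl ?_
  rw [← Finset.mul_sum]
  calc D * D' * κ ^ j * _ ≤ D * D' * κ ^ j * (8 / ((j : ℝ) + 1) ^ 2) := by
        gcongr
        exact sum_antidiagonal_inv_sq_le j
    _ = _ := by ring

theorem dominated_one (s : ℕ → ℝ) (κ : ℝ) (J : ℕ) (hκ : 0 ≤ κ) :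
    Dominated s κ J 0 1 (1 : Polynomial (bddAlg d)) := by
  intro j _
  rw [Polynomial.coeff_one]
  split_ifs with hj
  · subst hj
    have h := isTrig_monomial (d := d) (s 0) 1 0
    rw [abs_one, map_zero] at h
    simp only [pow_zero, Nat.cast_zero, zero_add, one_pow, mul_one, div_one]
    convert h using 1
    ext p
    simp [powMon]
  · exact (isTrig_zero (s j) (j + 0)).mono le_rfl (by positivity)

theorem Dominated.pow {s : ℕ → ℝ} (hs0 : ∀ j, 0 ≤ s j) (hs : Antitone s) {κ : ℝ} (hκ : 0 ≤ κ)
    {J : ℕ} {p : Polynomial (bddAlg d)} (hp : Dominated s κ J 1 1 p) (n : ℕ) :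
    Dominated s κ J n (8 ^ n) (p ^ n) := by
  induction n with
  | zero => simpa using dominated_one s κ J hκ
  | succ n ih =>
    have := ih.mul hs0 hs hκ (by positivity) zero_le_one hp
    rw [pow_succ, pow_succ]
    convert this using 1
    ring

theorem Dominated.prod {s : ℕ → ℝ} (hs0 : ∀ j, 0 ≤ s j) (hs : Antitone s) {κ : ℝ} (hκ : 0 ≤ κ)
    {J : ℕ} {W : Fin d → Polynomial (bddAlg d)} (hW : ∀ l, Dominated s κ J 1 1 (W l))
    (α : Fin d →₀ ℕ) : Dominated s κ J α.degree (8 ^ (α.degree + d)) (∏ l, W l ^ α l) := by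
  classical
  have key : ∀ t : Finset (Fin d), Dominated s κ J (∑ l ∈ t, α l) (8 ^ (∑ l ∈ t, α l + t.card))
      (∏ l ∈ t, W l ^ α l) := by
    intro t
    induction t using Finset.induction_on with
    | empty => simpa using dominated_one s κ J hκ
    | insert a t ha ih =>
      have := ((hW a).pow hs0 hs hκ (α a)).mul hs0 hs hκ (by positivity) (by positivity) ih
      rw [Finset.prod_insert ha, Finset.sum_insert ha, Finset.card_insert_of_notMem ha]
      convert this using 1
      ring
  simpa [Finsupp.degree_eq_sum] using key Finset.univ

/-- What matters is the power J - 1 instead of J: as every term has degree at least 2, one factor κ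
is left over to pay for the small divisor. The constant 32 is 8 · 4, with 8 per factor from the
products and 4 per factor from the change of weight from i + 1 to J + 1. The condition 32 ≤ Rκ
absorbs both in degrees above 2. -/
theorem isTrig_coeff_substH {s : ℕ → ℝ} (hs0 : ∀ j, 0 ≤ s j) (hs : Antitone s) {κ R A : ℝ}
    (hR : 0 < R) (hκR : 32 ≤ R * κ) {J : ℕ} (hJ : 1 ≤ J) {W : Fin d → Polynomial (bddAlg d)}
    (hW : ∀ l, Dominated s κ (J - 1) 1 1 (W l)) (T : Finset (Fin d →₀ ℕ))
    (hT : ∀ α ∈ T, 2 ≤ α.degree) (h : (Fin d →₀ ℕ) → bddAlg d) (c : (Fin d →₀ ℕ) → ℝ)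
    (hh : ∀ α, IsTrig (s 0) 0 (c α) (h α : RSp d × RSp d → ℝ))
    (hc : ∑ α ∈ T, c α * R ^ α.degree ≤ A) :
    IsTrig (s (J - 1)) (J + 1) (8 ^ d * A * (32 / R) ^ 2 * κ ^ (J - 1) / ((J : ℝ) + 1) ^ 2)
      ((substH T h W).coeff (J + 1) : RSp d × RSp d → ℝ) := by
  have hκ : 0 < κ := by
    by_contra hcon
    push Not at hcon
    nlinarith
  rw [coeff_substH, coe_sum_bddAlg]
  have h1 : ∀ α ∈ T, IsTrig (s (J - 1)) (J + 1)
      (c α * R ^ α.degree * (8 ^ d * (32 / R) ^ 2 * κ ^ (J - 1) / ((J : ℝ) + 1) ^ 2))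
      ((if α.degree ≤ J + 1 then h α * (∏ l, W l ^ α l).coeff (J + 1 - α.degree) else 0 :
        bddAlg d) : RSp d × RSp d → ℝ) := by
    intro α hα
    have hc0 := (hh α).nonneg
    have h2 := hT α hα
    split_ifs with hαJ
    · have h3 := Dominated.prod hs0 hs hκ.le hW α (J + 1 - α.degree) (by omega)
      have h4 := ((hh α).mono (hs (Nat.zero_le (J - 1))) le_rfl).mul
        (h3.mono (hs (show J + 1 - α.degree ≤ J - 1 by omega)) le_rfl) (hs0 _)
      have e1 : 0 + (J + 1 - α.degree + α.degree) = J + 1 := by omega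
      rw [e1] at h4
      refine h4.mono le_rfl ?_
      generalize α.degree = n at *
      obtain ⟨i, rfl⟩ : ∃ i, J = i + n - 1 := ⟨J + 1 - n, by omega⟩
      have e2 : i + n - 1 + 1 - n = i := by omega
      have e3 : i + n - 1 - 1 = i + (n - 2) := by omega
      have e4 : ((i + n - 1 : ℕ) : ℝ) + 1 = i + n := by
        rw [Nat.cast_sub (by omega)]; push_cast; ring
      rw [e2, e3, e4, mul_assoc (c α)]
      refine mul_le_mul_of_nonneg_left ?_ hc0
      have hn2 : (2 : ℝ) ≤ n := by exact_mod_cast h2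
      have h5 : ((i : ℝ) + n) ^ 2 ≤ 4 ^ n * ((i : ℝ) + 1) ^ 2 := by
        have h6 : (n : ℝ) ≤ 2 ^ n := by exact_mod_cast Nat.lt_two_pow_self.le
        have h7 : (i : ℝ) + n ≤ 2 ^ n * ((i : ℝ) + 1) := by
          have : (0 : ℝ) ≤ i := by positivity
          nlinarith
        calc ((i : ℝ) + n) ^ 2 ≤ (2 ^ n * ((i : ℝ) + 1)) ^ 2 := by gcongr
          _ = _ := by rw [mul_pow, ← pow_mul, mul_comm n 2, pow_mul]; norm_num
      have h8 : (32 : ℝ) ^ n ≤ R ^ n * ((32 / R) ^ 2 * κ ^ (n - 2)) := by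
        obtain ⟨q, rfl⟩ : ∃ q, n = q + 2 := ⟨n - 2, by omega⟩
        rw [Nat.add_sub_cancel]
        calc (32 : ℝ) ^ (q + 2) = 32 ^ q * 32 ^ 2 := pow_add _ _ _
          _ ≤ (R * κ) ^ q * 32 ^ 2 := by gcongr
          _ = _ := by rw [mul_pow, div_pow]; field_simp; ring
      rw [mul_div_assoc', div_le_div_iff₀ (by positivity) (by positivity)]
      calc (8 : ℝ) ^ (n + d) * κ ^ i * ((i : ℝ) + n) ^ 2
          ≤ 8 ^ (n + d) * κ ^ i * (4 ^ n * ((i : ℝ) + 1) ^ 2) := by gcongr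
        _ = 32 ^ n * (8 ^ d * κ ^ i * ((i : ℝ) + 1) ^ 2) := by
            rw [pow_add, show (32 : ℝ) = 8 * 4 by norm_num, mul_pow]; ring
        _ ≤ R ^ n * ((32 / R) ^ 2 * κ ^ (n - 2)) * (8 ^ d * κ ^ i * ((i : ℝ) + 1) ^ 2) := by gcongr
        _ = _ := by rw [pow_add κ i]; ring
    · exact (isTrig_zero _ _).mono le_rfl (by positivity)
  refine (IsTrig.finset_sum _ _ _ h1).mono le_rfl ?_
  rw [← Finset.sum_mul]
  calc _ ≤ A * (8 ^ d * (32 / R) ^ 2 * κ ^ (J - 1) / ((J : ℝ) + 1) ^ 2) := by gcongr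
    _ = _ := by ring

end Majorant

/-! ### Recursive solution and truncated equation -/

/-- The equation of degree `j + 1` for the generating function `∑ S_{j+1}`, whose derivative has the
Taylor coefficients of `X * W`, and the normal form `∑ n_{j+1}`. -/
structure IsFormalStep {d : ℕ} (ω : RSp d) (T : Finset (Fin d →₀ ℕ))
    (h : (Fin d →₀ ℕ) → bddAlg d) (κ : ℝ) (W : Fin d → Polynomial (bddAlg d)) (j : ℕ)
    (S : RSp d × RSp d → ℝ) (n : MvPolynomial (Fin d) ℝ) : Prop where
  hasFDerivAt : ∀ θ I, ∃ S' : RSp d →L[ℝ] ℝ, HasFDerivAt (fun θ => S (θ, I)) S' θ ∧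
    ∀ v, S' v = ∑ l, ((W l).coeff j : RSp d × RSp d → ℝ) (θ, I) * v l
  periodic : ∀ θ I k, S (θ + intVec k, I) = S (θ, I)
  homogeneous : n.IsHomogeneous (j + 1)
  coeffNorm_le : coeffNorm n ≤ κ ^ j
  equation : ∀ θ I, ∑ l, ω l * ((W l).coeff j : RSp d × RSp d → ℝ) (θ, I) +
    ((substH T h W).coeff (j + 1) : RSp d × RSp d → ℝ) (θ, I) = evalAt n I

/-- Solution of the formal Hamilton-Jacobi equation, with estimates. -/
theorem exists_formal_solution {d : ℕ} {γ τ : ℝ} (hγ : 0 < γ) (hτ : 0 < τ + 1) {ω : RSp d}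
    (hω : ω ∈ DC d τ γ) {s R A κ : ℝ} (hs : 0 < s) (hR : 0 < R) (m : ℕ) (hm : 1 ≤ m)
    (T : Finset (Fin d →₀ ℕ)) (hT : ∀ α ∈ T, 2 ≤ α.degree) (h : (Fin d →₀ ℕ) → bddAlg d)
    (c : (Fin d →₀ ℕ) → ℝ) (hh : ∀ α, IsTrig s 0 (c α) (h α : RSp d × RSp d → ℝ))
    (hc : ∑ α ∈ T, c α * R ^ α.degree ≤ A) (hκR : 32 ≤ R * κ)
    (hκA : 8 ^ d * A * (32 / R) ^ 2 ≤ κ)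
    (hκL : ((τ + 1) / (s / m)) ^ (τ + 1) / γ * (8 ^ d * A * (32 / R) ^ 2) ≤ κ) :
    ∃ (W : Fin d → Polynomial (bddAlg d)) (S : ℕ → RSp d × RSp d → ℝ)
      (n : ℕ → MvPolynomial (Fin d) ℝ), (∀ l, (W l).coeff 0 = coordAct l) ∧
      (∀ l j, m ≤ j → (W l).coeff j = 0) ∧
      ∀ j, 1 ≤ j → j < m → IsFormalStep ω T h κ W j (S j) (n j) := by
  have hκ : 0 < κ := by
    by_contra hcon
    push Not at hcon
    nlinarith
  have hm0 : (0 : ℝ) < m := by exact_mod_cast hm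
  set σ := s / m with hσ
  have hσ0 : 0 < σ := by positivity
  -- Each of the m - 1 steps costs the width s/m. The maximum with 0 only serves to have nonnegative
  -- decreasing widths for all indices.
  let sj : ℕ → ℝ := fun j => max (s - j * σ) 0
  have hsj0 : ∀ j, 0 ≤ sj j := fun j => le_max_right _ _
  have hsja : Antitone sj := by
    intro i j hij
    have : (i : ℝ) ≤ j := by exact_mod_cast hij
    simp only [sj]
    gcongr
  have hsjs : sj 0 = s := by simp [sj, hs.le]
  have hA0 : 0 ≤ A := (Finset.sum_nonneg fun α _ =>
    mul_nonneg (hh α).nonneg (by positivity)).trans hc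
  suffices key : ∀ J, 1 ≤ J → J ≤ m → ∃ (W : Fin d → Polynomial (bddAlg d))
      (S : ℕ → RSp d × RSp d → ℝ) (n : ℕ → MvPolynomial (Fin d) ℝ),
      (∀ l, (W l).coeff 0 = coordAct l) ∧ (∀ l j, J ≤ j → (W l).coeff j = 0) ∧
      (∀ l, Dominated sj κ (J - 1) 1 1 (W l)) ∧
      ∀ j, 1 ≤ j → j < J → IsFormalStep ω T h κ W j (S j) (n j) by
    obtain ⟨W, S, n, h1, h2, -, h4⟩ := key m hm le_rfl
    exact ⟨W, S, n, h1, h2, h4⟩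
  intro J hJ
  induction J, hJ using Nat.le_induction with
  | base =>
    intro _
    refine ⟨fun l => Polynomial.C (coordAct l), fun _ => 0, fun _ => 0, fun l => by simp, ?_, ?_, ?_⟩
    · intro l j hj
      rw [Polynomial.coeff_C, if_neg (by omega)]
    · intro l j hj
      obtain rfl : j = 0 := by omega
      simpa using isTrig_coordAct (sj 0) l
    · intro j h1 h2; omega
  | succ J hJ ih =>
    intro hJm
    obtain ⟨W, S, n, hW0, hWhigh, hdom, hstep⟩ := ih (by omega)
    have hF := isTrig_coeff_substH hsj0 hsja hR hκR hJ hdom T hT h c (by rwa [hsjs]) hc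
    have hJm' : (J : ℝ) + 1 ≤ m := by exact_mod_cast hJm
    have hmσ : m * σ = s := by rw [hσ]; field_simp
    have hcast : ((J - 1 : ℕ) : ℝ) = J - 1 := by rw [Nat.cast_sub hJ]; simp
    have hsJ : sj (J - 1) = s - (J - 1) * σ := by
      simp only [sj]
      rw [hcast, max_eq_left]
      nlinarith
    have hsJ' : sj J = sj (J - 1) - σ := by
      rw [hsJ]
      simp only [sj]
      rw [max_eq_left (by nlinarith)]
      ring
    have hσs : σ ≤ sj (J - 1) := by rw [hsJ]; nlinarith
    obtain ⟨S₁, G, n₁, hG, hS₁, hper, hn₁, hn₁', heq⟩ := hF.exists_homological hγ hτ hω hσ0 hσs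
    have hκpow : κ * κ ^ (J - 1) = κ ^ J := by
      rw [← pow_succ']; congr 1; omega
    have hJ1 : (1 : ℝ) ≤ ((J : ℝ) + 1) ^ 2 := by nlinarith [show (0 : ℝ) ≤ J by positivity]
    have hG' : ∀ l, IsTrig (sj J) (J + 1) (1 * κ ^ J / ((J : ℝ) + 1) ^ 2) (G l) := by
      intro l
      refine (hG l).mono hsJ'.le ?_
      rw [one_mul, ← hκpow]
      calc _ = ((τ + 1) / σ) ^ (τ + 1) / γ * (8 ^ d * A * (32 / R) ^ 2) * κ ^ (J - 1) /
            ((J : ℝ) + 1) ^ 2 := by ring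
        _ ≤ _ := by gcongr
    let g : Fin d → bddAlg d := fun l => ⟨G l, (hG' l).mem_bddAlg (hsj0 J)⟩
    -- The new term of order J leaves the equations already solved, and the right-hand side just
    -- used, unchanged by `coeff_substH_congr`.
    let W' : Fin d → Polynomial (bddAlg d) := fun l =>
      W l + Polynomial.C (g l) * Polynomial.X ^ J
    have hcoeff : ∀ l j, (W' l).coeff j = if j = J then g l else (W l).coeff j := by
      intro l j
      simp only [W', Polynomial.coeff_add, Polynomial.coeff_C_mul_X_pow]
      split_ifs with hj
      · rw [hj, hWhigh l J le_rfl, zero_add]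
      · rw [add_zero]
    have hsub : ∀ i ≤ J + 1, (substH T h W').coeff i = (substH T h W).coeff i := by
      intro i hi
      refine coeff_substH_congr T hT h W W' J (fun l => ?_) i hi
      exact ⟨Polynomial.C (g l), by simp only [W']; ring⟩
    refine ⟨W', Function.update S J S₁, Function.update n J n₁, ?_, ?_, ?_, ?_⟩
    · intro l; rw [hcoeff, if_neg (by omega)]; exact hW0 l
    · intro l j hj; rw [hcoeff, if_neg (by omega)]; exact hWhigh l j (by omega)
    · intro l j hj
      rw [hcoeff]
      split_ifs with hjJ
      · subst hjJ; exact hG' l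
      · exact hdom l j (by omega)
    · intro j hj1 hj2
      by_cases hjJ : j = J
      · subst hjJ
        simp only [Function.update_self]
        refine ⟨fun θ I => ?_, hper, hn₁, ?_, fun θ I => ?_⟩
        · obtain ⟨S', h1, h2⟩ := hS₁ θ I
          refine ⟨S', h1, fun v => ?_⟩
          rw [h2]
          simp only [hcoeff, if_true]
          rfl
        · refine hn₁'.trans ?_
          rw [← hκpow]
          refine (div_le_self (by positivity) hJ1).trans ?_
          gcongr
        · rw [← heq θ I, hsub _ le_rfl]
          simp only [hcoeff, if_true]
          rfl
      · simp only [Function.update_of_ne hjJ]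
        have h1 := hstep j hj1 (by omega)
        refine ⟨fun θ I => ?_, h1.periodic, h1.homogeneous, h1.coeffNorm_le, fun θ I => ?_⟩
        · obtain ⟨S', h3, h2⟩ := h1.hasFDerivAt θ I
          refine ⟨S', h3, fun v => ?_⟩
          rw [h2]
          simp only [hcoeff, if_neg hjJ]
        · rw [← h1.equation θ I, hsub _ (by omega)]
          simp only [hcoeff, if_neg hjJ]

/-- The approximate solution `t ↦ t * W(t)` along the ray through `v`. -/
noncomputable def rayAction {d : ℕ} (W : Fin d → Polynomial (bddAlg d)) (v : RSp d) (t : ℝ)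
    (θ : RSp d) : RSp d :=
  WithLp.toLp 2 fun l => ∑ j ∈ Finset.range ((W l).natDegree + 1),
    t ^ (j + 1) * ((W l).coeff j : RSp d × RSp d → ℝ) (θ, v)

/-- Evaluation at a point. -/
def evalPt {d : ℕ} (p : RSp d × RSp d) : bddAlg d →+* ℝ :=
  (Pi.evalRingHom (fun _ => ℝ) p).comp (bddAlg d).val.toRingHom

theorem evalPt_apply {d : ℕ} (p : RSp d × RSp d) (F : bddAlg d) :
    evalPt p F = (F : RSp d × RSp d → ℝ) p := rfl

theorem rayAction_apply {d : ℕ} (W : Fin d → Polynomial (bddAlg d)) (v : RSp d) (t : ℝ)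
    (θ : RSp d) (l : Fin d) : rayAction W v t θ l = t * (W l).eval₂ (evalPt (θ, v)) t := by
  simp only [rayAction, Polynomial.eval₂_eq_sum_range, Finset.mul_sum]
  exact Finset.sum_congr rfl fun j _ => by rw [evalPt_apply]; ring

/-- Coefficients in `bddAlg d` are bounded in θ for fixed action, so the constant is uniform in the
angles. This matters because the angle of the intersection point is not controlled. -/
theorem exists_tail_bound {d : ℕ} (Z : Polynomial (bddAlg d)) (v : RSp d) (m : ℕ) :
    ∃ C : ℝ, ∀ θ : RSp d, ∀ t : ℝ, 0 ≤ t → t ≤ 1 →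
      |Z.eval₂ (evalPt (θ, v)) t -
        ∑ j ∈ Finset.range (m + 1), (Z.coeff j : RSp d × RSp d → ℝ) (θ, v) * t ^ j| ≤
        C * t ^ (m + 1) := by
  choose C hC using fun j => (Z.coeff j).2 v
  refine ⟨∑ j ∈ Finset.range (Z.natDegree + 1 + (m + 1)), C j, fun θ t ht0 ht1 => ?_⟩
  have h1 : Z.eval₂ (evalPt (θ, v)) t = ∑ j ∈ Finset.range (Z.natDegree + 1 + (m + 1)),
      (Z.coeff j : RSp d × RSp d → ℝ) (θ, v) * t ^ j := by
    rw [Polynomial.eval₂_eq_sum_range' (evalPt (θ, v))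
      (show Z.natDegree < Z.natDegree + 1 + (m + 1) by omega)]
    rfl
  have hsub : Finset.range (m + 1) ⊆ Finset.range (Z.natDegree + 1 + (m + 1)) :=
    Finset.range_subset_range.2 (by omega)
  rw [h1, ← Finset.sum_sdiff hsub, add_sub_cancel_right, Finset.sum_mul]
  have hC0 : ∀ j, 0 ≤ C j := fun j => (abs_nonneg _).trans (hC j θ)
  calc _ ≤ ∑ j ∈ Finset.range (Z.natDegree + 1 + (m + 1)) \ Finset.range (m + 1),
        C j * t ^ (m + 1) := by
        refine (Finset.abs_sum_le_sum_abs _ _).trans (Finset.sum_le_sum fun j hj => ?_)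
        rw [abs_mul, abs_of_nonneg (pow_nonneg ht0 j)]
        refine mul_le_mul (hC j θ) ?_ (by positivity) (hC0 j)
        refine pow_le_pow_of_le_one ht0 ht1 ?_
        simp at hj
        omega
    _ ≤ _ := Finset.sum_le_sum_of_subset_of_nonneg Finset.sdiff_subset fun j _ _ =>
        mul_nonneg (hC0 j) (by positivity)

/-- The approximate solution satisfies the truncated Hamilton-Jacobi equation up to order `m`. -/
theorem exists_truncated_equation_bound {d : ℕ} {ω : RSp d} {κ : ℝ} (m : ℕ) 
    (T : Finset (Fin d →₀ ℕ)) (hT : ∀ α ∈ T, 2 ≤ α.degree) (h : (Fin d →₀ ℕ) → bddAlg d)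
    (W : Fin d → Polynomial (bddAlg d)) (S : ℕ → RSp d × RSp d → ℝ)
    (n : ℕ → MvPolynomial (Fin d) ℝ) (hW0 : ∀ l, (W l).coeff 0 = coordAct l)
    (hstep : ∀ j, 1 ≤ j → j < m → IsFormalStep ω T h κ W j (S j) (n j)) (hm : 1 ≤ m) (v : RSp d) :
    ∃ C : ℝ, ∀ θ : RSp d, ∀ t : ℝ, 0 ≤ t → t ≤ 1 →
      |∑ l, ω l * rayAction W v t θ l + ∑ α ∈ T, (h α : RSp d × RSp d → ℝ) (θ, v) *
          powMon α (rayAction W v t θ) -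
        (t * ∑ l, ω l * v l + ∑ j ∈ Finset.Ico 1 m, t ^ (j + 1) * evalAt (n j) v)| ≤
        C * t ^ (m + 1) := by
  -- Homogeneity in I is recorded by powers of X: evaluating X at t and the action at v gives the
  -- left-hand side along the ray, and the solved equations are the coefficients of Z up to order m.
  let Z : Polynomial (bddAlg d) :=
    ∑ l, Polynomial.C (algebraMap ℝ (bddAlg d) (ω l)) * (Polynomial.X * W l) + substH T h W
  obtain ⟨C, hC⟩ := exists_tail_bound Z v m
  refine ⟨C, fun θ t ht0 ht1 => ?_⟩
  have halg : ∀ r : ℝ, evalPt (θ, v) (algebraMap ℝ (bddAlg d) r) = r := fun r => rfl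
  have h1 : Z.eval₂ (evalPt (θ, v)) t = ∑ l, ω l * rayAction W v t θ l +
      ∑ α ∈ T, (h α : RSp d × RSp d → ℝ) (θ, v) * powMon α (rayAction W v t θ) := by
    simp only [Z, substH, Polynomial.eval₂_add, Polynomial.eval₂_finsetSum, Polynomial.eval₂_mul,
      Polynomial.eval₂_C, Polynomial.eval₂_X, Polynomial.eval₂_pow, Polynomial.eval₂_finsetProd,
      halg, rayAction_apply, powMon]
    congr 1
    refine Finset.sum_congr rfl fun α _ => ?_
    rw [evalPt_apply]
    congr 1
    simp only [mul_pow, Finset.prod_mul_distrib]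
    rw [Finset.prod_pow_eq_pow_sum, Finsupp.degree_eq_sum]
  have hco : ∀ j, (Z.coeff (j + 1) : RSp d × RSp d → ℝ) (θ, v) =
      ∑ l, ω l * ((W l).coeff j : RSp d × RSp d → ℝ) (θ, v) +
        ((substH T h W).coeff (j + 1) : RSp d × RSp d → ℝ) (θ, v) := by
    intro j
    simp only [Z, Polynomial.coeff_add, Polynomial.finsetSum_coeff, Polynomial.coeff_C_mul,
      Polynomial.coeff_X_mul]
    rw [← evalPt_apply, map_add, map_sum]
    simp only [map_mul, halg, evalPt_apply]
  have hlow : ∀ i < 2, (substH T h W).coeff i = 0 := by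
    intro i hi
    rw [coeff_substH]
    refine Finset.sum_eq_zero fun α hα => ?_
    rw [if_neg]
    have := hT α hα
    omega
  have h2 : ∑ j ∈ Finset.range (m + 1), (Z.coeff j : RSp d × RSp d → ℝ) (θ, v) * t ^ j =
      t * ∑ l, ω l * v l + ∑ j ∈ Finset.Ico 1 m, t ^ (j + 1) * evalAt (n j) v := by
    have hz0 : Z.coeff 0 = 0 := by
      simp [Z, Polynomial.finsetSum_coeff, hlow 0 (by omega), Polynomial.mul_coeff_zero]
    rw [Finset.sum_range_succ', hz0]
    rw [Finset.range_eq_Ico, Finset.sum_eq_sum_Ico_succ_bot (by omega)]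
    rw [hco 0, hlow 1 (by omega)]
    simp only [hW0]
    have : ∑ j ∈ Finset.Ico (0 + 1) m, (Z.coeff (j + 1) : RSp d × RSp d → ℝ) (θ, v) * t ^ (j + 1) =
        ∑ j ∈ Finset.Ico 1 m, t ^ (j + 1) * evalAt (n j) v := by
      refine Finset.sum_congr rfl fun j hj => ?_
      rw [Finset.mem_Ico] at hj
      rw [hco, (hstep j (by omega) hj.2).equation]
      ring
    rw [this]
    simp [coordAct]
    ring
  rw [← h1, ← h2]
  exact hC θ t ht0 ht1

/-! ### Uniqueness of the normal form -/

theorem exists_bound_of_isBigO_zeroSection {d : ℕ} {E E' : Type*} [NormedAddCommGroup E]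
    [NormedAddCommGroup E'] {f : RSp d × RSp d → E} {g : RSp d × RSp d → E'}
    (h : f =O[zeroSection d] g) : ∃ C δ : ℝ, 0 < C ∧ 0 < δ ∧ ∀ θ I : RSp d, ‖I‖ < δ →
      ‖f (θ, I)‖ ≤ C * ‖g (θ, I)‖ := by
  obtain ⟨C, hC, hb⟩ := h.exists_pos
  rw [IsBigOWith, zeroSection, Filter.eventually_iff, Filter.mem_prod_iff] at hb
  obtain ⟨t₁, ht₁, t₂, ht₂, hsub⟩ := hb
  rw [Filter.mem_top] at ht₁
  obtain ⟨δ, hδ, hball⟩ := Metric.mem_nhds_iff.1 ht₂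
  exact ⟨C, δ, hC, hδ, fun θ I hI => hsub (Set.mk_mem_prod (by simp [ht₁]) (hball (by simpa using hI)))⟩

theorem exists_intVec_translate {d : ℕ} (θ : RSp d) :
    ∃ k : Fin d → ℤ, ‖θ + intVec k‖ ≤ d := by
  refine ⟨fun l => -⌊θ l⌋, ?_⟩
  rw [EuclideanSpace.norm_eq]
  refine Real.sqrt_le_iff.2 ⟨by positivity, ?_⟩
  have h1 : ∀ l, ‖(θ + intVec fun l => -⌊θ l⌋) l‖ ^ 2 ≤ 1 := by
    intro l
    have e : (θ + intVec fun l => -⌊θ l⌋) l = Int.fract (θ l) := by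
      simp [intVec, Int.fract, sub_eq_add_neg]
    rw [e, Real.norm_of_nonneg (Int.fract_nonneg _)]
    have := Int.fract_nonneg (θ l)
    have := (Int.fract_lt_one (θ l)).le
    nlinarith
  calc ∑ l, ‖(θ + intVec fun l => -⌊θ l⌋) l‖ ^ 2 ≤ ∑ _l : Fin d, (1 : ℝ) :=
        Finset.sum_le_sum fun l _ => h1 l
    _ = d := by simp
    _ ≤ (d : ℝ) ^ 2 := by
        have : (d : ℕ) ≤ d ^ 2 := Nat.le_self_pow (by norm_num) d
        exact_mod_cast this

/-- The angular derivative of the angular component of a map of `ℝ^d × ℝ^d`. -/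
noncomputable def angDeriv {d : ℕ} (Ψ : RSp d × RSp d → RSp d × RSp d) (p : RSp d × RSp d) :
    RSp d →L[ℝ] RSp d :=
  (ContinuousLinearMap.fst ℝ (RSp d) (RSp d)).comp
    ((fderiv ℝ Ψ p).comp (ContinuousLinearMap.inl ℝ (RSp d) (RSp d)))

theorem hasFDerivAt_angle {d : ℕ} {s : ℝ} {Ψ : RSp d × RSp d → RSp d × RSp d}
    (hΨ : AnalyticOnNhd ℝ Ψ (Set.univ ×ˢ Metric.ball 0 s)) (θ I : RSp d) (hI : ‖I‖ < s) :
    HasFDerivAt (fun θ => (Ψ (θ, I)).1) (angDeriv Ψ (θ, I)) θ := by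
  have h1 : HasFDerivAt Ψ (fderiv ℝ Ψ (θ, I)) (θ, I) :=
    (hΨ (θ, I) ⟨Set.mem_univ _, by simpa using hI⟩).differentiableAt.hasFDerivAt
  have h2 : HasFDerivAt (fun θ : RSp d => (θ, I)) (ContinuousLinearMap.inl ℝ (RSp d) (RSp d)) θ :=
    hasFDerivAt_prodMk_left θ I
  exact ((hasFDerivAt_fst (p := Ψ (θ, I))).comp θ (h1.comp θ h2))

/-- At I = 0 the angular component is the identity, so its angular derivative is too; continuity and
the tube lemma extend this to small I uniformly over a compact set of angles. -/
theorem exists_angDeriv_near_id {d : ℕ} {s : ℝ} (hs : 0 < s) {Ψ : RSp d × RSp d → RSp d × RSp d}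
    (hΨ : AnalyticOnNhd ℝ Ψ (Set.univ ×ˢ Metric.ball 0 s)) (h0 : ∀ θ, (Ψ (θ, 0)).1 = θ)
    (K : Set (RSp d)) (hK : IsCompact K) :
    ∃ δ : ℝ, 0 < δ ∧ ∀ θ ∈ K, ∀ I : RSp d, ‖I‖ < δ →
      ‖angDeriv Ψ (θ, I) - ContinuousLinearMap.id ℝ (RSp d)‖ < 1 := by
  have hcont : ContinuousOn (angDeriv Ψ) (Set.univ ×ˢ Metric.ball 0 s) := by
    have := hΨ.fderiv.continuousOn
    unfold angDeriv
    exact continuousOn_const.clm_comp (this.clm_comp continuousOn_const)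
  have hopen : IsOpen ((Set.univ : Set (RSp d)) ×ˢ Metric.ball (0 : RSp d) s) :=
    isOpen_univ.prod Metric.isOpen_ball
  have hU := hcont.isOpen_inter_preimage hopen
    (Metric.isOpen_ball (x := ContinuousLinearMap.id ℝ (RSp d)) (ε := 1))
  have hid : ∀ θ, angDeriv Ψ (θ, 0) = ContinuousLinearMap.id ℝ (RSp d) := by
    intro θ
    have h1 := hasFDerivAt_angle hΨ θ 0 (by simpa using hs)
    simp only [h0] at h1
    exact h1.unique (hasFDerivAt_id θ)
  obtain ⟨u, v, hu, hv, hKu, h0v, huv⟩ := generalized_tube_lemma hK (isCompact_singleton (x := (0 : RSp d)))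
    hU (by
      rintro ⟨θ, I⟩ ⟨hθ, hI⟩
      rw [Set.mem_singleton_iff] at hI
      subst hI
      refine ⟨⟨Set.mem_univ _, by simpa using hs⟩, ?_⟩
      simp only [Set.mem_preimage]
      rw [hid θ]
      exact Metric.mem_ball_self one_pos)
  obtain ⟨δ, hδ, hball⟩ := Metric.isOpen_iff.1 hv 0 (h0v rfl)
  refine ⟨δ, hδ, fun θ hθ I hI => ?_⟩
  have := (huv (Set.mk_mem_prod (hKu hθ) (hball (by simpa using hI)))).2
  simpa [dist_eq_norm] using this

/-- Two exact Lagrangian tori of the same cohomology class, one of them the image of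
`𝕋^d × {I}` under an exact-symplectic transformation and the other one a graph, intersect. -/
theorem exists_intersection {d : ℕ} {s : ℝ} {Ψ : RSp d × RSp d → RSp d × RSp d}
    (hΨ : IsExactSymplectic d s Ψ) (I : RSp d) (hI : ‖I‖ < s)
    (hnear : ∀ θ : RSp d, ‖θ‖ ≤ d →
      ‖angDeriv Ψ (θ, I) - ContinuousLinearMap.id ℝ (RSp d)‖ < 1)
    (S : RSp d → ℝ) (U : RSp d → RSp d)
    (hS : ∀ θ, ∃ S' : RSp d →L[ℝ] ℝ, HasFDerivAt S S' θ ∧ ∀ v, S' v = inner ℝ (U θ - I) v)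
    (hper : ∀ θ k, S (θ + intVec k) = S θ) :
    ∃ θ, (Ψ (θ, I)).2 = U (Ψ (θ, I)).1 := by
  obtain ⟨X, hXper, hX⟩ := hΨ.exact
  -- The difference of the primitives of the two tori, pulled back to θ. With Ψ = (Θ, J), its
  -- differential is (J - U(Θ))·dΘ. It is periodic and has a maximum, where invertibility of dΘ
  -- forces J = U(Θ).
  let D : RSp d → ℝ := fun θ => X (θ, I) + inner ℝ I (θ - (Ψ (θ, I)).1) - S (Ψ (θ, I)).1
  have hDper : ∀ θ k, D (θ + intVec k) = D θ := by
    intro θ k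
    simp only [D]
    rw [hXper θ I hI k, hΨ.equivariant θ I hI k]
    simp [hper]
  have hDder : ∀ θ, ∃ D' : RSp d →L[ℝ] ℝ, HasFDerivAt D D' θ ∧
      ∀ v, D' v = inner ℝ ((Ψ (θ, I)).2 - U (Ψ (θ, I)).1) (angDeriv Ψ (θ, I) v) := by
    intro θ
    obtain ⟨S', hS', hS'v⟩ := hS (Ψ (θ, I)).1
    obtain ⟨hXd, hXv⟩ := hX (θ, I) hI
    have hA := hasFDerivAt_angle hΨ.analytic θ I hI
    have h1 : HasFDerivAt (fun θ => X (θ, I))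
        ((fderiv ℝ X (θ, I)).comp (ContinuousLinearMap.inl ℝ (RSp d) (RSp d))) θ :=
      hXd.hasFDerivAt.comp θ (hasFDerivAt_prodMk_left θ I)
    have h2 : HasFDerivAt (fun θ => inner ℝ I (θ - (Ψ (θ, I)).1))
        ((innerSL ℝ I).comp (ContinuousLinearMap.id ℝ (RSp d) - angDeriv Ψ (θ, I))) θ :=
      (innerSL ℝ I).hasFDerivAt.comp θ ((hasFDerivAt_id θ).sub hA)
    have h3 : HasFDerivAt (fun θ => S (Ψ (θ, I)).1) (S'.comp (angDeriv Ψ (θ, I))) θ :=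
      hS'.comp θ hA
    refine ⟨_, (h1.add h2).sub h3, fun v => ?_⟩
    have h4 := hXv (v, 0)
    have h5 : (fderiv ℝ Ψ (θ, I) (v, 0)).1 = angDeriv Ψ (θ, I) v := rfl
    simp only [FunLike.coe_sub, FunLike.coe_add, Pi.sub_apply,
      Pi.add_apply, ContinuousLinearMap.comp_apply, ContinuousLinearMap.inl_apply, h4, h5,
      innerSL_apply_apply, hS'v, inner_sub_left, inner_sub_right, ContinuousLinearMap.id_apply]
    ring
  have hDcont : Continuous D := continuous_iff_continuousAt.2 fun θ => by
    obtain ⟨D', h, _⟩ := hDder θ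
    exact h.continuousAt
  obtain ⟨θ, hθ, hmax⟩ := (isCompact_closedBall (0 : RSp d) (d : ℝ)).exists_isMaxOn
    ⟨0, by simp⟩ hDcont.continuousOn
  refine ⟨θ, ?_⟩
  have hglob : ∀ θ', D θ' ≤ D θ := by
    intro θ'
    obtain ⟨k, hk⟩ := exists_intVec_translate θ'
    rw [← hDper θ' k]
    exact hmax (by simpa using hk)
  obtain ⟨D', hD', hD'v⟩ := hDder θ
  have hzero : D' = 0 :=
    IsLocalMax.hasFDerivAt_eq_zero (Filter.Eventually.of_forall hglob) hD'
  set x := (Ψ (θ, I)).2 - U (Ψ (θ, I)).1 with hx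
  have h1 : inner ℝ x (angDeriv Ψ (θ, I) x) = 0 := by rw [← hD'v, hzero]; rfl
  have h2 := hnear θ (by simpa using hθ)
  have hx0 : x = 0 := by
    by_contra hne
    have hpos : 0 < ‖x‖ := norm_pos_iff.2 hne
    -- The vanishing differential is tested on x itself; a perturbation of the identity of norm
    -- below 1 cannot map x to a vector orthogonal to x unless x = 0.
    have h3 : inner ℝ x ((angDeriv Ψ (θ, I) - ContinuousLinearMap.id ℝ (RSp d)) x) = -‖x‖ ^ 2 := by
      rw [FunLike.coe_sub, Pi.sub_apply, inner_sub_right, h1, ContinuousLinearMap.id_apply,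
        real_inner_self_eq_norm_sq]
      ring
    have h4 := abs_real_inner_le_norm x
      ((angDeriv Ψ (θ, I) - ContinuousLinearMap.id ℝ (RSp d)) x)
    rw [h3, abs_neg, abs_of_pos (by positivity)] at h4
    have h5 := (angDeriv Ψ (θ, I) - ContinuousLinearMap.id ℝ (RSp d)).le_opNorm x
    nlinarith [mul_lt_mul_of_pos_right h2 hpos]
  exact sub_eq_zero.1 hx0

theorem coeff_eq_zero_of_bound (m : ℕ) : ∀ (a : ℕ → ℝ) (C δ : ℝ), 0 < δ →
    (∀ t, 0 < t → t < δ → |∑ p ∈ Finset.range (m + 1), a p * t ^ p| ≤ C * t ^ (m + 1)) →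
    ∀ p ≤ m, a p = 0 := by
  induction m with
  | zero =>
    intro a C δ hδ h p hp
    obtain rfl : p = 0 := by omega
    have h1 : Tendsto (fun t : ℝ => C * t ^ 1) (𝓝[>] 0) (𝓝 (C * 0 ^ 1)) :=
      ((continuous_const.mul (continuous_pow 1)).tendsto 0).mono_left nhdsWithin_le_nhds
    have h2 : |a 0| ≤ C * 0 ^ 1 := by
      refine ge_of_tendsto h1 ?_
      filter_upwards [Ioo_mem_nhdsGT hδ] with t ht
      simpa using h t ht.1 ht.2
    simpa using h2
  | succ m ih =>
    intro a C δ hδ h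
    have h0 : a 0 = 0 := by
      have h1 : Tendsto (fun t : ℝ => C * t ^ (m + 1 + 1) -
          |∑ p ∈ Finset.range (m + 1 + 1), a p * t ^ p|) (𝓝[>] 0)
          (𝓝 (C * 0 ^ (m + 1 + 1) - |∑ p ∈ Finset.range (m + 1 + 1), a p * 0 ^ p|)) := by
        refine Tendsto.mono_left (Continuous.tendsto ?_ 0) nhdsWithin_le_nhds
        fun_prop
      have h2 := ge_of_tendsto h1 (b := 0) (by
        filter_upwards [Ioo_mem_nhdsGT hδ] with t ht
        linarith [h t ht.1 ht.2])
      rw [Finset.sum_range_succ'] at h2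
      simpa using h2
    have h1 := ih (fun p => a (p + 1)) C δ hδ (fun t ht0 htδ => by
      have h2 := h t ht0 htδ
      rw [Finset.sum_range_succ', h0, zero_mul, add_zero] at h2
      have h3 : ∑ p ∈ Finset.range (m + 1), a (p + 1) * t ^ (p + 1) =
          t * ∑ p ∈ Finset.range (m + 1), a (p + 1) * t ^ p := by
        rw [Finset.mul_sum]; exact Finset.sum_congr rfl fun p _ => by ring
      rw [h3, abs_mul, abs_of_pos ht0, pow_succ' t (m + 1), mul_left_comm] at h2
      exact le_of_mul_le_mul_left h2 ht0)
    intro p hp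
    rcases p with _ | p
    · exact h0
    · exact h1 p (by omega)

theorem rayAction_eq_sum {d : ℕ} (W : Fin d → Polynomial (bddAlg d)) (m : ℕ) (hm : 1 ≤ m)
    (hW0 : ∀ l, (W l).coeff 0 = coordAct l) (hW : ∀ l j, m ≤ j → (W l).coeff j = 0)
    (v : RSp d) (t : ℝ) (θ : RSp d) (l : Fin d) :
    rayAction W v t θ l = t * v l + ∑ j ∈ Finset.Ico 1 m,
      t ^ (j + 1) * ((W l).coeff j : RSp d × RSp d → ℝ) (θ, v) := by
  have hdeg : (W l).natDegree < m := by
    have : (W l).natDegree ≤ m - 1 :=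
      Polynomial.natDegree_le_iff_coeff_eq_zero.2 fun j hj => hW l j (by omega)
    omega
  rw [rayAction_apply, Polynomial.eval₂_eq_sum_range' _ hdeg, Finset.range_eq_Ico,
    Finset.sum_eq_sum_Ico_succ_bot (by omega), hW0, mul_add, Finset.mul_sum]
  congr 1
  · simp [evalPt_apply, coordAct]
  · exact Finset.sum_congr rfl fun j _ => by rw [evalPt_apply]; ring

/-- On every ray, the truncated normal form agrees with the formal solution of the
Hamilton-Jacobi equation up to an error of order `m + 1`. -/
theorem exists_bound_sub_formal {d : ℕ} {ω : RSp d} {κ : ℝ} (m : ℕ) (hm : 1 ≤ m)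
    (T : Finset (Fin d →₀ ℕ)) (hT : ∀ α ∈ T, 2 ≤ α.degree) (h : (Fin d →₀ ℕ) → bddAlg d)
    (hconst : ∀ α θ I, (h α : RSp d × RSp d → ℝ) (θ, I) = (h α : RSp d × RSp d → ℝ) (θ, 0))
    (W : Fin d → Polynomial (bddAlg d)) (S : ℕ → RSp d × RSp d → ℝ)
    (n : ℕ → MvPolynomial (Fin d) ℝ) (hW0 : ∀ l, (W l).coeff 0 = coordAct l)
    (hW : ∀ l j, m ≤ j → (W l).coeff j = 0)
    (hstep : ∀ j, 1 ≤ j → j < m → IsFormalStep ω T h κ W j (S j) (n j))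
    (f : RSp d × RSp d → ℝ) (C₁ δ₁ : ℝ) (hδ₁ : 0 < δ₁) (hC₁ : 0 ≤ C₁)
    (hf : ∀ θ J : RSp d, ‖J‖ < δ₁ → |f (θ, J) - (∑ l, ω l * J l +
      ∑ α ∈ T, (h α : RSp d × RSp d → ℝ) (θ, 0) * powMon α J)| ≤ C₁ * ‖J‖ ^ (m + 1))
    (s : ℝ) (hs : 0 < s) (Ψ : RSp d × RSp d → RSp d × RSp d) (hΨ : IsExactSymplectic d s Ψ)
    (hΨ1 : (fun p => (Ψ p).1 - p.1) =O[zeroSection d] (fun p => ‖p.2‖))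
    (hΨ2 : (fun p => (Ψ p).2 - p.2) =O[zeroSection d] (fun p => ‖p.2‖ ^ 2))
    (P : MvPolynomial (Fin d) ℝ)
    (hP : (fun p => f (Ψ p) - evalAt P p.2) =O[zeroSection d] (fun p => ‖p.2‖ ^ (m + 1)))
    (v : RSp d) :
    ∃ C δ : ℝ, 0 < δ ∧ ∀ t, 0 < t → t < δ → |evalAt P (t • v) -
      (t * ∑ l, ω l * v l + ∑ j ∈ Finset.Ico 1 m, t ^ (j + 1) * evalAt (n j) v)| ≤
        C * t ^ (m + 1) := by
  obtain ⟨c₁, a₁, -, ha₁, hb₁⟩ := exists_bound_of_isBigO_zeroSection hΨ1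
  obtain ⟨c₂, a₂, hc₂, ha₂, hb₂⟩ := exists_bound_of_isBigO_zeroSection hΨ2
  obtain ⟨c₃, a₃, -, ha₃, hb₃⟩ := exists_bound_of_isBigO_zeroSection hP
  have h0 : ∀ θ, (Ψ (θ, 0)).1 = θ := by
    intro θ
    have := hb₁ θ 0 (by simpa using ha₁)
    simpa [sub_eq_zero] using this
  obtain ⟨a₄, ha₄, hnear⟩ := exists_angDeriv_near_id hs hΨ.analytic h0
    (Metric.closedBall 0 d) (isCompact_closedBall _ _)
  obtain ⟨C₅, hC₅⟩ := exists_truncated_equation_bound m T hT h W S n hW0 hstep hm v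
  -- The bound 1/c₂ gives |J| ≤ 2|I| at the intersection point, and δ₁/2 then keeps J in the range
  -- of the Taylor estimate.
  set a := min (min (min s a₂) (min a₃ a₄)) (min (1 / c₂) (δ₁ / 2)) with ha
  have ha0 : 0 < a := by positivity
  refine ⟨c₃ * ‖v‖ ^ (m + 1) + C₁ * (2 * ‖v‖) ^ (m + 1) + C₅, min (a / (‖v‖ + 1)) 1, by positivity, ?_⟩
  intro t ht0 htδ
  have ht1 : t ≤ 1 := (htδ.trans_le (min_le_right _ _)).le
  have hta : t * (‖v‖ + 1) < a := (lt_div_iff₀ (by positivity)).1 (htδ.trans_le (min_le_left _ _))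
  have hIn : ‖t • v‖ = t * ‖v‖ := by rw [norm_smul, Real.norm_of_nonneg ht0.le]
  have hIa : ‖t • v‖ < a := by rw [hIn]; nlinarith
  have hIs : ‖t • v‖ < s := hIa.trans_le ((min_le_left _ _).trans ((min_le_left _ _).trans (min_le_left _ _)))
  have hIa2 : ‖t • v‖ < a₂ := hIa.trans_le ((min_le_left _ _).trans ((min_le_left _ _).trans (min_le_right _ _)))
  have hIa3 : ‖t • v‖ < a₃ := hIa.trans_le ((min_le_left _ _).trans ((min_le_right _ _).trans (min_le_left _ _)))
  have hIa4 : ‖t • v‖ < a₄ := hIa.trans_le ((min_le_left _ _).trans ((min_le_right _ _).trans (min_le_right _ _)))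
  have hIc : ‖t • v‖ < 1 / c₂ := hIa.trans_le ((min_le_right _ _).trans (min_le_left _ _))
  have hId : ‖t • v‖ < δ₁ / 2 := hIa.trans_le ((min_le_right _ _).trans (min_le_right _ _))
  obtain ⟨θ, hθ⟩ := exists_intersection hΨ (t • v) hIs
    (fun θ hθ => hnear θ (by simpa using hθ) _ hIa4)
    (fun θ => ∑ j ∈ Finset.Ico 1 m, t ^ (j + 1) * S j (θ, v)) (rayAction W v t)
    (by
      intro θ
      have hd : ∀ j, ∃ S' : RSp d →L[ℝ] ℝ, j ∈ Finset.Ico 1 m →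
          (HasFDerivAt (fun θ => S j (θ, v)) S' θ ∧
            ∀ w, S' w = ∑ l, ((W l).coeff j : RSp d × RSp d → ℝ) (θ, v) * w l) := by
        intro j
        by_cases hj : j ∈ Finset.Ico 1 m
        · obtain ⟨S', h1, h2⟩ := (hstep j (Finset.mem_Ico.1 hj).1
            (Finset.mem_Ico.1 hj).2).hasFDerivAt θ v
          exact ⟨S', fun _ => ⟨h1, h2⟩⟩
        · exact ⟨0, fun hj' => absurd hj' hj⟩
      choose S' hS' using hd
      refine ⟨∑ j ∈ Finset.Ico 1 m, t ^ (j + 1) • S' j,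
        HasFDerivAt.fun_sum fun j hj => (hS' j hj).1.const_mul _, fun w => ?_⟩
      have e1 : (∑ j ∈ Finset.Ico 1 m, t ^ (j + 1) • S' j) w =
          ∑ j ∈ Finset.Ico 1 m, t ^ (j + 1) * ∑ l, ((W l).coeff j : RSp d × RSp d → ℝ) (θ, v) * w l := by
        rw [sum_apply]
        refine Finset.sum_congr rfl fun j hj => ?_
        rw [← (hS' j hj).2 w]
        rfl
      rw [e1, PiLp.inner_apply]
      simp only [Finset.mul_sum]
      rw [Finset.sum_comm]
      refine Finset.sum_congr rfl fun l _ => ?_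
      have e2 : (rayAction W v t θ - t • v) l = ∑ j ∈ Finset.Ico 1 m,
          t ^ (j + 1) * ((W l).coeff j : RSp d × RSp d → ℝ) (θ, v) := by
        rw [PiLp.sub_apply, rayAction_eq_sum W m hm hW0 hW]
        simp
      rw [e2]
      simp only [RCLike.inner_apply, conj_trivial, Finset.mul_sum]
      exact Finset.sum_congr rfl fun j _ => by ring)
    (by
      intro θ k
      refine Finset.sum_congr rfl fun j hj => ?_
      rw [(hstep j (Finset.mem_Ico.1 hj).1 (Finset.mem_Ico.1 hj).2).periodic])
  set Θ := (Ψ (θ, t • v)).1 with hΘ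
  set J := rayAction W v t Θ with hJ
  have hJn : ‖J‖ ≤ 2 * (t * ‖v‖) := by
    have h1 := hb₂ θ (t • v) hIa2
    simp only at h1
    rw [hθ, norm_pow, norm_norm] at h1
    have h2 : c₂ * ‖t • v‖ ≤ 1 := by
      have := (lt_div_iff₀ hc₂).1 hIc
      linarith
    have h3 : ‖J - t • v‖ ≤ ‖t • v‖ := by
      refine h1.trans ?_
      nlinarith [norm_nonneg (t • v)]
    calc ‖J‖ = ‖(J - t • v) + t • v‖ := by simp
      _ ≤ ‖J - t • v‖ + ‖t • v‖ := norm_add_le _ _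
      _ ≤ 2 * (t * ‖v‖) := by rw [← hIn]; linarith
  have hE1 : |f (Θ, J) - evalAt P (t • v)| ≤ c₃ * (t * ‖v‖) ^ (m + 1) := by
    have h1 := hb₃ θ (t • v) hIa3
    have h2 : Ψ (θ, t • v) = (Θ, J) := Prod.ext rfl hθ
    simp only [h2, norm_pow, hIn, Real.norm_of_nonneg (mul_nonneg ht0.le (norm_nonneg v))] at h1
    exact h1
  have hE2 := hf Θ J (by rw [hIn] at hId; linarith)
  have hE2' : C₁ * ‖J‖ ^ (m + 1) ≤ C₁ * (2 * (t * ‖v‖)) ^ (m + 1) := by gcongr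
  have hE3 := hC₅ Θ t ht0.le ht1
  simp only [hconst _ Θ v] at hE3
  rw [← hJ] at hE3
  -- At the common point: normal form, true Hamiltonian, Taylor polynomial and formal solution are
  -- compared in turn, each time up to O(t^{m+1}).
  have hfin : ∀ A B C D e₁ e₂ e₃ : ℝ, |B - A| ≤ e₁ → |B - C| ≤ e₂ → |C - D| ≤ e₃ →
      |A - D| ≤ e₁ + e₂ + e₃ := by
    intro A B C D e₁ e₂ e₃ h1 h2 h3
    rw [abs_le] at *
    constructor <;> linarith [h1.1, h1.2, h2.1, h2.2, h3.1, h3.2]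
  refine (hfin _ _ _ _ _ _ _ hE1 (hE2.trans hE2') hE3).trans_eq ?_
  ring

theorem evalAt_smul {d : ℕ} (F : MvPolynomial (Fin d) ℝ) (p : ℕ) (hF : F.IsHomogeneous p)
    (t : ℝ) (v : RSp d) : evalAt F (t • v) = t ^ p * evalAt F v := by
  have h : ∀ x : RSp d, evalAt F x = ∑ α ∈ F.support, F.coeff α * powMon α x := by
    intro x
    rw [evalAt, MvPolynomial.eval_eq']
    rfl
  rw [h, h, Finset.mul_sum]
  refine Finset.sum_congr rfl fun α hα => ?_
  have hdeg : α.degree = p := by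
    rw [← hF (MvPolynomial.mem_support_iff.1 hα), Finsupp.degree_eq_weight_one]; rfl
  rw [powMon_smul, hdeg]
  ring

/-- Uniqueness of the normal form. -/
theorem homPart_eq_formal {d : ℕ} {ω : RSp d} (m : ℕ) (hm : 1 ≤ m) (N : MvPowerSeries (Fin d) ℝ)
    (n : ℕ → MvPolynomial (Fin d) ℝ)
    (h : ∀ v : RSp d, ∃ C δ : ℝ, 0 < δ ∧ ∀ t, 0 < t → t < δ → |evalAt (truncBNF N m) (t • v) -
      (t * ∑ l, ω l * v l + ∑ j ∈ Finset.Ico 1 m, t ^ (j + 1) * evalAt (n j) v)| ≤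
        C * t ^ (m + 1)) :
    (∀ v, evalAt (homPart N 1) v = ∑ l, ω l * v l) ∧ ∀ j, 1 ≤ j → j < m → homPart N (j + 1) = n j := by
  have key : ∀ v : RSp d, ∀ p ≤ m, evalAt (homPart N p) v -
      (if p = 0 then 0 else if p = 1 then ∑ l, ω l * v l else evalAt (n (p - 1)) v) = 0 := by
    intro v
    obtain ⟨C, δ, hδ, hb⟩ := h v
    refine coeff_eq_zero_of_bound m _ C δ hδ fun t ht0 htδ => ?_
    refine (le_of_eq ?_).trans (hb t ht0 htδ)
    congr 1
    simp only [sub_mul, Finset.sum_sub_distrib]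
    congr 1
    · rw [truncBNF_eq_sum]
      have : evalAt (∑ p ∈ Finset.range (m + 1), homPart N p) (t • v) =
          ∑ p ∈ Finset.range (m + 1), evalAt (homPart N p) (t • v) := by simp [evalAt]
      rw [this]
      refine Finset.sum_congr rfl fun p _ => ?_
      rw [evalAt_smul _ p (isHomogeneous_homPart N p), mul_comm]
    · rw [Finset.sum_range_succ', Finset.range_eq_Ico, Finset.sum_eq_sum_Ico_succ_bot (by omega)]
      simp only [if_true, zero_mul, add_zero, Nat.add_eq_zero_iff, one_ne_zero, and_false, if_false,
        zero_add, pow_one]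
      congr 1
      · ring
      · refine Finset.sum_congr rfl fun j hj => ?_
        rw [Finset.mem_Ico] at hj
        rw [if_neg (by omega), Nat.add_sub_cancel, mul_comm]
  refine ⟨fun v => ?_, fun j hj1 hj2 => ?_⟩
  · have := key v 1 hm
    simpa [sub_eq_zero] using this
  · refine MvPolynomial.funext fun x => ?_
    have := key (WithLp.toLp 2 x) (j + 1) (by omega)
    rw [if_neg (by omega), if_neg (by omega), Nat.add_sub_cancel, sub_eq_zero] at this
    exact this

/-! ### Fourier series of periodic functions holomorphic on a strip -/

/-- The unit box `∏ (0, 1]`. -/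
def unitBox (ι : Type*) : Set (ι → ℝ) := {x | ∀ i, x i ∈ Set.Ioc (0 : ℝ) (0 + 1)}

/-- The complex strip of half-widths `b`. -/
def strip {ι : Type*} (b : ι → ℝ) : Set (ι → ℂ) := {z | ∀ l, |(z l).im| < b l}

/-- A real vector shifted by a complex multiple of another one. -/
noncomputable def shiftPt {ι : Type*} (y : ι → ℝ) (x : ι → ℝ) (ζ : ℂ) : ι → ℂ :=
  fun l => (x l : ℂ) + ζ * (y l : ℂ)

theorem shiftPt_mem_strip {ι : Type*} {b y : ι → ℝ} {x : ι → ℝ} {ζ : ℂ} :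
    shiftPt y x ζ ∈ strip b ↔ ∀ l, |ζ.im * y l| < b l := by
  simp [strip, shiftPt]

section

variable {ι : Type*} [Fintype ι]

theorem volume_unitBox : volume (unitBox ι) = 1 := by
  have : unitBox ι = Set.univ.pi fun _ => Set.Ioc (0 : ℝ) (0 + 1) := by
    ext x; simp [unitBox]
  rw [this, Real.volume_pi_Ioc]
  simp

/-- The integral of a bounded holomorphic function over a period box does not change when the
box is moved in the imaginary directions, if this is so for the real directions. -/
theorem integral_shift_eq {b : ι → ℝ} {K : (ι → ℂ) → ℂ}
    (hK : DifferentiableOn ℂ K (strip b)) {M : ℝ} (hM : ∀ z ∈ strip b, ‖K z‖ ≤ M) {c : ℂ}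
    {y : ι → ℝ} (hy : ∀ l, |y l| < b l)
    (hc : ∀ t : ℝ, ∫ x in unitBox ι, K (shiftPt y x t) = c) :
    ∫ x in unitBox ι, K (shiftPt y x Complex.I) = c := by
  set U : Set ℂ := {ζ | ∀ l, |ζ.im * y l| < b l} with hU
  have hUo : IsOpen U := by
    simp only [hU, Set.ofPred_forall]
    refine isOpen_iInter_of_finite fun l => isOpen_lt ?_ continuous_const
    exact (Complex.continuous_im.mul continuous_const).abs
  have hUc : Convex ℝ U := by
    have : U = ⋂ l, (fun ζ : ℂ => ζ.im * y l) ⁻¹' Metric.ball 0 (b l) := by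
      ext ζ; simp [hU]
    rw [this]
    refine convex_iInter fun l => ?_
    exact (convex_ball (0 : ℝ) (b l)).is_linear_preimage
      ⟨fun a e => by simp [add_mul], fun a e => by simp [mul_assoc]⟩
  have hb0 : ∀ l, 0 < b l := fun l => (abs_nonneg _).trans_lt (hy l)
  have hreal : ∀ t : ℝ, (t : ℂ) ∈ U := fun t l => by simpa using hb0 l
  have hI : Complex.I ∈ U := fun l => by simpa using hy l
  have hdiff : ∀ x : ι → ℝ, DifferentiableOn ℂ (fun ζ => K (shiftPt y x ζ)) U := by
    intro x
    refine hK.comp (t := strip b) ?_ fun ζ hζ => shiftPt_mem_strip.2 hζ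
    refine Differentiable.differentiableOn ?_
    unfold shiftPt
    fun_prop
  have hcont : ∀ ζ ∈ U, Continuous fun x : ι → ℝ => K (shiftPt y x ζ) := by
    intro ζ hζ
    refine hK.continuousOn.comp_continuous ?_ fun x => shiftPt_mem_strip.2 hζ
    unfold shiftPt
    fun_prop
  have hbd : ∀ ζ ∈ U, ∀ x, ‖K (shiftPt y x ζ)‖ ≤ M := fun ζ hζ x =>
    hM _ (shiftPt_mem_strip.2 hζ)
  have hfin : volume (unitBox ι) < ⊤ := by rw [volume_unitBox]; simp
  have : IsFiniteMeasure (volume.restrict (unitBox ι)) := ⟨by simpa using hfin⟩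
  have hder : ∀ ζ₀ ∈ U, DifferentiableAt ℂ (fun ζ => ∫ x in unitBox ι, K (shiftPt y x ζ)) ζ₀ := by
    intro ζ₀ hζ₀
    obtain ⟨ε, hε, hball⟩ := Metric.isOpen_iff.1 hUo ζ₀ hζ₀
    have hcl : ∀ ζ ∈ Metric.ball ζ₀ (ε / 2), Metric.closedBall ζ (ε / 4) ⊆ U := by
      intro ζ hζ w hw
      refine hball ?_
      rw [Metric.mem_ball] at hζ ⊢
      rw [Metric.mem_closedBall] at hw
      linarith [dist_triangle w ζ ζ₀]
    have hda : ∀ ζ ∈ U, ∀ x, DifferentiableAt ℂ (fun ζ => K (shiftPt y x ζ)) ζ :=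
      fun ζ hζ x => (hdiff x).differentiableAt (hUo.mem_nhds hζ)
    have hbU : ∀ ζ ∈ Metric.ball ζ₀ (ε / 2), ζ ∈ U := fun ζ hζ =>
      hcl ζ hζ (Metric.mem_closedBall_self (by positivity))
    refine (hasDerivAt_integral_of_dominated_loc_of_deriv_le
      (F := fun ζ x => K (shiftPt y x ζ))
      (F' := fun ζ x => deriv (fun ζ => K (shiftPt y x ζ)) ζ)
      (bound := fun _ => M / (ε / 4)) (Metric.ball_mem_nhds ζ₀ (half_pos hε)) ?_ ?_ ?_ ?_ ?_
      ?_).2.differentiableAt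
    · filter_upwards [hUo.mem_nhds hζ₀] with ζ hζ
      exact (hcont ζ hζ).aestronglyMeasurable
    · exact Integrable.of_bound (hcont ζ₀ hζ₀).aestronglyMeasurable M
        (ae_of_all _ (hbd ζ₀ hζ₀))
    -- Measurability of the derivative in x, as a pointwise limit of difference quotients.
    · set u : ℕ → ℂ := fun k => ζ₀ + ((ε / 2 * (1 / ((k : ℝ) + 1 + 1)) : ℝ) : ℂ) with hu
      have hpos : ∀ k : ℕ, 0 < ε / 2 * (1 / ((k : ℝ) + 1 + 1)) := fun k => by positivity
      have huU : ∀ k, u k ∈ U := by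
        intro k
        refine hball ?_
        rw [Metric.mem_ball, dist_eq_norm]
        simp only [hu, add_sub_cancel_left, Complex.norm_real, Real.norm_eq_abs]
        rw [abs_of_pos (hpos k)]
        have : 1 / ((k : ℝ) + 1 + 1) ≤ 1 := by
          rw [div_le_one (by positivity)]; linarith [(Nat.cast_nonneg k : (0 : ℝ) ≤ k)]
        nlinarith
      have hut : Tendsto u atTop (𝓝[≠] ζ₀) := by
        refine tendsto_nhdsWithin_iff.2 ⟨?_, Eventually.of_forall fun k => ?_⟩
        · have h1 : Tendsto (fun k : ℕ => ε / 2 * (1 / ((k : ℝ) + 1 + 1))) atTop (𝓝 0) := by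
            have := (tendsto_one_div_add_atTop_nhds_zero_nat (𝕜 := ℝ)).comp
              (tendsto_add_atTop_nat 1)
            simpa using this.const_mul (ε / 2)
          have h2 := (Complex.continuous_ofReal.tendsto 0).comp h1
          simpa [hu, Function.comp_def] using h2.const_add ζ₀
        · simp only [hu, Set.mem_compl_iff, Set.mem_singleton_iff, add_eq_left,
            Complex.ofReal_eq_zero]
          exact (hpos k).ne'
      refine aestronglyMeasurable_of_tendsto_ae atTop
        (f := fun k x => slope (fun ζ => K (shiftPt y x ζ)) ζ₀ (u k)) (fun k => ?_)
        (ae_of_all _ fun x => ((hda ζ₀ hζ₀ x).hasDerivAt.tendsto_slope).comp hut)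
      simp only [slope_def_field]
      exact (((hcont _ (huU k)).sub (hcont ζ₀ hζ₀)).div_const _).aestronglyMeasurable
    · refine ae_of_all _ fun x ζ hζ => ?_
      refine Complex.norm_deriv_le_of_forall_mem_sphere_norm_le (by positivity) ?_ fun w hw =>
        hbd w (hcl ζ hζ (Metric.sphere_subset_closedBall hw)) x
      exact ((hdiff x).mono (hcl ζ hζ)).diffContOnCl_ball subset_rfl
    · exact integrable_const _
    · exact ae_of_all _ fun x ζ hζ => (hda ζ (hbU ζ hζ) x).hasDerivAt
  -- Identity theorem in place of a contour shift: the integral is holomorphic in ζ and constant for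
  -- real ζ, hence constant on a connected domain containing i.
  have han : AnalyticOnNhd ℂ (fun ζ => ∫ x in unitBox ι, K (shiftPt y x ζ)) U :=
    DifferentiableOn.analyticOnNhd (fun ζ hζ => (hder ζ hζ).differentiableWithinAt) hUo
  refine han.eqOn_of_preconnected_of_frequently_eq (g := fun _ => c) analyticOnNhd_const
    hUc.isPreconnected (z₀ := 0) (by simpa using hreal 0) ?_ hI
  have hut : Tendsto (fun k : ℕ => ((1 / ((k : ℝ) + 1) : ℝ) : ℂ)) atTop (𝓝[≠] 0) := by
    refine tendsto_nhdsWithin_iff.2 ⟨?_, Eventually.of_forall fun k => ?_⟩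
    · simpa only [Function.comp_def, Complex.ofReal_zero] using
        (Complex.continuous_ofReal.tendsto 0).comp
          (tendsto_one_div_add_atTop_nhds_zero_nat (𝕜 := ℝ))
    · simp only [Set.mem_compl_iff, Set.mem_singleton_iff, Complex.ofReal_eq_zero]
      positivity
  exact hut.frequently (Frequently.of_forall fun k => hc _)

/-- The character `exp (2πi n·z)`. -/
noncomputable def character (n : ι → ℤ) (z : ι → ℂ) : ℂ :=
  Complex.exp (2 * Real.pi * Complex.I * ∑ l, (n l : ℂ) * z l)

theorem mFourier_coe (n : ι → ℤ) (x : ι → ℝ) :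
    UnitAddTorus.mFourier n (fun l => ((x l : ℝ) : UnitAddCircle)) =
      character n fun l => (x l : ℂ) := by
  simp only [UnitAddTorus.mFourier, ContinuousMap.coe_mk, fourier_coe_apply, character,
    ← Complex.exp_sum, Finset.mul_sum]
  congr 1
  refine Finset.sum_congr rfl fun l _ => ?_
  simp; ring

theorem norm_character (n : ι → ℤ) (z : ι → ℂ) :
    ‖character n z‖ = Real.exp (-(2 * Real.pi * ∑ l, (n l : ℝ) * (z l).im)) := by
  rw [character, Complex.norm_exp]
  congr 1
  simp [Complex.mul_re, Complex.mul_im]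

/-- Exponential decay of the Fourier coefficients of a periodic function that is bounded and
holomorphic on a strip, and convergence of its Fourier series. -/
theorem exists_fourier_series {b b' : ι → ℝ} (hb' : ∀ l, 0 < b' l) (hbb : ∀ l, b' l < b l)
    {g : (ι → ℂ) → ℂ} (hg : DifferentiableOn ℂ g (strip b)) {M : ℝ}
    (hM : ∀ z ∈ strip b, ‖g z‖ ≤ M)
    (hper : ∀ z ∈ strip b, ∀ k : ι → ℤ, g (fun l => z l + k l) = g z) :
    ∃ c : (ι → ℤ) → ℂ,
      (∀ n, ‖c n‖ ≤ M * Real.exp (-(2 * Real.pi * ∑ l, b' l * |(n l : ℝ)|))) ∧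
      ∀ x : ι → ℝ, HasSum (fun n => c n * character n fun l => (x l : ℂ))
        (g fun l => (x l : ℂ)) := by
  have hb : ∀ l, 0 < b l := fun l => (hb' l).trans (hbb l)
  have hreal : ∀ x : ι → ℝ, (fun l => (x l : ℂ)) ∈ strip b := fun x l => by simpa using hb l
  have hM0 : 0 ≤ M := (norm_nonneg _).trans (hM _ (hreal 0))
  set π : C(ι → ℝ, UnitAddTorus ι) :=
    ⟨Pi.map fun _ => (QuotientAddGroup.mk : ℝ → UnitAddCircle),
      (IsOpenQuotientMap.piMap fun _ => QuotientAddGroup.isOpenQuotientMap_mk).continuous⟩ with hπ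
  have hq : IsQuotientMap ⇑π :=
    (IsOpenQuotientMap.piMap fun _ => QuotientAddGroup.isOpenQuotientMap_mk).isQuotientMap
  set g₀ : C(ι → ℝ, ℂ) := ⟨fun x => g fun l => (x l : ℂ),
    hg.continuousOn.comp_continuous (by fun_prop) hreal⟩ with hg₀
  have hfac : Function.FactorsThrough g₀ π := by
    intro x x' h
    have : ∀ l, ∃ k : ℤ, x l = x' l + k := by
      intro l
      have hl : ((x l : ℝ) : UnitAddCircle) = ((x' l : ℝ) : UnitAddCircle) := congrFun h l
      rw [QuotientAddGroup.eq_iff_sub_mem, AddSubgroup.mem_zmultiples_iff] at hl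
      obtain ⟨k, hk⟩ := hl
      exact ⟨k, by simp at hk; linarith⟩
    choose k hk using this
    have := hper _ (hreal x') k
    simp only [hg₀, ContinuousMap.coe_mk]
    rw [← this]
    congr 1
    ext l
    rw [hk l]; push_cast; rfl
  set f : C(UnitAddTorus ι, ℂ) := hq.lift g₀ hfac with hf
  have hfx : ∀ x : ι → ℝ, f (fun l => ((x l : ℝ) : UnitAddCircle)) = g fun l => (x l : ℂ) := by
    intro x
    exact congrArg (fun F : C(ι → ℝ, ℂ) => F x) (hq.lift_comp g₀ hfac)
  set c : (ι → ℤ) → ℂ := UnitAddTorus.mFourierCoeff f with hc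
  have hshift : ∀ (n : ι → ℤ) (a : ι → ℝ), ∫ x in unitBox ι,
      character (-n) (fun l => ((x l + a l : ℝ) : ℂ)) * g (fun l => ((x l + a l : ℝ) : ℂ)) = c n := by
    intro n a
    rw [hc, UnitAddTorus.mFourierCoeff_eq_integral f n a]
    simp only [mFourier_coe, hfx, smul_eq_mul]
    have hpre : unitBox ι = (fun x => x + a) ⁻¹' {x | ∀ i, x i ∈ Set.Ioc (a i) (a i + 1)} := by
      ext x
      simp [unitBox, add_comm]
    have := (measurePreserving_add_right (volume : Measure (ι → ℝ)) a).setIntegral_preimage_emb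
      (MeasurableEquiv.addRight a).measurableEmbedding
      (fun x => character (-n) (fun l => (x l : ℂ)) * g fun l => (x l : ℂ))
      {x | ∀ i, x i ∈ Set.Ioc (a i) (a i + 1)}
    rw [← hpre] at this
    simpa using this
  have hbound : ∀ n, ‖c n‖ ≤ M * Real.exp (-(2 * Real.pi * ∑ l, b' l * |(n l : ℝ)|)) := by
    intro n
    -- The shift of size b' in the direction that makes the character decay in every coordinate; b'
    -- < b keeps it inside the open strip.
    set y : ι → ℝ := fun l => -(SignType.sign (n l : ℝ) : ℝ) * b' l with hy
    have hyb : ∀ l, |y l| ≤ b' l := by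
      intro l
      rw [hy, abs_mul, abs_of_pos (hb' l), abs_neg]
      refine mul_le_of_le_one_left (hb' l).le ?_
      rcases lt_trichotomy (n l : ℝ) 0 with h | h | h <;> simp [h]
    have hny : ∀ l, (n l : ℝ) * y l = -(b' l * |(n l : ℝ)|) := by
      intro l
      rw [hy, ← sign_mul_self (n l : ℝ)]
      ring
    have hKd : DifferentiableOn ℂ (fun z => character (-n) z * g z) (strip b) := by
      refine DifferentiableOn.mul (Differentiable.differentiableOn ?_) hg
      unfold character
      fun_prop
    have hKM : ∀ z ∈ strip b, ‖character (-n) z * g z‖ ≤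
        Real.exp (2 * Real.pi * ∑ l, |(n l : ℝ)| * b l) * M := by
      intro z hz
      rw [norm_mul, norm_character]
      refine mul_le_mul (Real.exp_le_exp.2 ?_) (hM z hz) (norm_nonneg _) (Real.exp_pos _).le
      rw [← mul_neg, ← Finset.sum_neg_distrib]
      refine mul_le_mul_of_nonneg_left (Finset.sum_le_sum fun l _ => ?_) (by positivity)
      have h1 : -(((-n) l : ℤ) : ℝ) * (z l).im ≤ |(n l : ℝ)| * |(z l).im| := by
        rw [← abs_mul]; simpa using le_abs_self ((n l : ℝ) * (z l).im)
      have h2 := mul_le_mul_of_nonneg_left (hz l).le (abs_nonneg (n l : ℝ))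
      linarith
    have key := integral_shift_eq hKd hKM (c := c n) (y := y)
      (fun l => (hyb l).trans_lt (hbb l)) fun t => by
        rw [← hshift n fun l => t * y l]
        congr 1
        ext x
        push_cast
        rfl
    rw [← key]
    refine (norm_setIntegral_le_of_norm_le_const (C := M * Real.exp
      (-(2 * Real.pi * ∑ l, b' l * |(n l : ℝ)|))) (by rw [volume_unitBox]; simp)
      fun x _ => ?_).trans ?_
    · rw [norm_mul, norm_character, mul_comm]
      refine mul_le_mul (hM _ (shiftPt_mem_strip.2 fun l => ?_)) (le_of_eq ?_)
        (Real.exp_pos _).le hM0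
      · simpa using (hyb l).trans_lt (hbb l)
      · simp only [shiftPt, Pi.neg_apply, Int.cast_neg, Complex.add_im, Complex.ofReal_im,
          Complex.mul_im, Complex.I_re, Complex.I_im, Complex.ofReal_re, zero_mul, one_mul,
          zero_add, neg_mul, hny, neg_neg]
    · simp [Measure.real, volume_unitBox]
  have hsum : Summable c := by
    refine Summable.of_norm_bounded (g := fun n : ι → ℤ => M * ∏ l,
      Real.exp (-(2 * Real.pi * b' l)) ^ (n l).natAbs) ?_ fun n => (hbound n).trans (le_of_eq ?_)
    · refine (summable_prod_pi (fun l (k : ℤ) => Real.exp (-(2 * Real.pi * b' l)) ^ k.natAbs)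
        (fun l k => by positivity) fun l => ?_).mul_left M
      have hlt : Real.exp (-(2 * Real.pi * b' l)) < 1 := by
        rw [Real.exp_lt_one_iff]
        have := hb' l
        have := Real.pi_pos
        have : 0 < 2 * Real.pi * b' l := by positivity
        linarith
      have hs := summable_geometric_of_lt_one (Real.exp_pos (-(2 * Real.pi * b' l))).le hlt
      exact Summable.of_nat_of_neg (by simpa using hs) (by simpa using hs)
    · congr 1
      rw [← mul_neg, ← Finset.sum_neg_distrib, Finset.mul_sum, Real.exp_sum]
      refine Finset.prod_congr rfl fun l _ => ?_
      rw [← Real.exp_nat_mul, Nat.cast_natAbs, Int.cast_abs]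
      congr 1; ring
  refine ⟨c, hbound, fun x => ?_⟩
  have := UnitAddTorus.hasSum_mFourier_series_apply_of_summable (f := f) hsum
    (fun l => ((x l : ℝ) : UnitAddCircle))
  simpa only [mFourier_coe, hfx, smul_eq_mul] using this

end

/-! ### Chebyshev expansion in the actions -/

open Polynomial in
theorem sum_abs_coeff_X_mul_le (p : ℝ[X]) (N : ℕ) :
    ∑ a ∈ Finset.range N, |(X * p).coeff a| ≤ ∑ a ∈ Finset.range N, |p.coeff a| := by
  cases N with
  | zero => simp
  | succ N =>
    rw [Finset.sum_range_succ']
    simp only [coeff_X_mul, mul_coeff_zero, coeff_X_zero, zero_mul, abs_zero, add_zero]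
    rw [Finset.sum_range_succ]
    linarith [abs_nonneg (p.coeff N)]

open Polynomial in
-- The recursion T_{n+2} = 2X T_{n+1} - T_n gives 2 · 3^{n+1} + 3^n ≤ 3^{n+2}. Any rate below e²
-- would do, as the cosine coefficients decay like e^{-2|n|}.
theorem sum_abs_coeff_chebyshev_le (n : ℤ) (N : ℕ) :
    ∑ a ∈ Finset.range N, |(Chebyshev.T ℝ n).coeff a| ≤ 3 ^ n.natAbs := by
  have hnat : ∀ n : ℕ, ∑ a ∈ Finset.range N, |(Chebyshev.T ℝ (n : ℤ)).coeff a| ≤ 3 ^ n ∧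
      ∑ a ∈ Finset.range N, |(Chebyshev.T ℝ ((n + 1 : ℕ) : ℤ)).coeff a| ≤ 3 ^ (n + 1) := by
    have h0 : ∑ a ∈ Finset.range N, |(1 : ℝ[X]).coeff a| ≤ 1 := by
      cases N with
      | zero => simp
      | succ N => rw [Finset.sum_range_succ']; simp [coeff_one]
    intro n
    induction n with
    | zero =>
      refine ⟨by simpa using h0, ?_⟩
      have := sum_abs_coeff_X_mul_le 1 N
      rw [mul_one] at this
      simp only [zero_add, Nat.cast_one, Chebyshev.T_one, pow_one]
      linarith
    | succ n ih =>
      refine ⟨ih.2, ?_⟩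
      have hrec : Chebyshev.T ℝ ((n + 1 + 1 : ℕ) : ℤ) =
          C 2 * (X * Chebyshev.T ℝ ((n + 1 : ℕ) : ℤ)) - Chebyshev.T ℝ (n : ℤ) := by
        have := Chebyshev.T_add_two ℝ (n : ℤ)
        push_cast
        rw [add_assoc, one_add_one_eq_two, this, ← mul_assoc]
        rfl
      have hle : ∑ a ∈ Finset.range N, |(Chebyshev.T ℝ ((n + 1 + 1 : ℕ) : ℤ)).coeff a| ≤
          2 * ∑ a ∈ Finset.range N, |(X * Chebyshev.T ℝ ((n + 1 : ℕ) : ℤ)).coeff a| +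
            ∑ a ∈ Finset.range N, |(Chebyshev.T ℝ (n : ℤ)).coeff a| := by
        rw [hrec, Finset.mul_sum, ← Finset.sum_add_distrib]
        refine Finset.sum_le_sum fun a _ => ?_
        rw [coeff_sub, coeff_C_mul]
        refine (abs_sub _ _).trans (le_of_eq ?_)
        rw [abs_mul, abs_two]
      have hX := sum_abs_coeff_X_mul_le (Chebyshev.T ℝ ((n + 1 : ℕ) : ℤ)) N
      have hp : (0 : ℝ) < 3 ^ n := by positivity
      have h1 := ih.1
      have h2 := ih.2
      rw [pow_succ] at h2 ⊢
      rw [pow_succ]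
      linarith
  rcases n.natAbs_eq with h | h
  · conv_lhs => rw [h]
    exact (hnat _).1
  · conv_lhs => rw [h, Chebyshev.T_neg]
    exact (hnat _).1

theorem hasSum_prod_finsupp {d : ℕ} (f : Fin d → ℕ → ℝ) (N : Fin d → ℕ)
    (h : ∀ l a, N l ≤ a → f l a = 0) :
    HasSum (fun α : Fin d →₀ ℕ => ∏ l, f l (α l)) (∏ l, ∑ a ∈ Finset.range (N l), f l a) := by
  have key : HasSum (fun α : Fin d → ℕ => ∏ l, f l (α l))
      (∏ l, ∑ a ∈ Finset.range (N l), f l a) := by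
    rw [Finset.prod_univ_sum]
    refine hasSum_sum_of_ne_finset_zero fun α hα => ?_
    simp only [Fintype.mem_piFinset, Finset.mem_range, not_forall, not_lt] at hα
    obtain ⟨l, hl⟩ := hα
    exact Finset.prod_eq_zero (Finset.mem_univ l) (h l _ hl)
  exact (Finsupp.equivFunOnFinite.hasSum_iff
    (f := fun α : Fin d → ℕ => ∏ l, f l (α l))).2 key

theorem norm_toLp_le_sum {𝕜 : Type*} [RCLike 𝕜] {d : ℕ} (z : Fin d → 𝕜) :
    ‖(WithLp.toLp 2 z : EuclideanSpace 𝕜 (Fin d))‖ ≤ ∑ l, ‖z l‖ := by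
  rw [EuclideanSpace.norm_eq]
  refine Real.sqrt_le_iff.2 ⟨Finset.sum_nonneg fun _ _ => norm_nonneg _, ?_⟩
  exact Finset.sum_sq_le_sq_sum_of_nonneg fun _ _ => norm_nonneg _

theorem norm_cos_le_exp (w : ℂ) : ‖Complex.cos w‖ ≤ Real.exp |w.im| := by
  have h1 : ‖Complex.exp (w * Complex.I)‖ ≤ Real.exp |w.im| := by
    rw [Complex.norm_exp]; simpa using neg_le_abs w.im
  have h2 : ‖Complex.exp (-w * Complex.I)‖ ≤ Real.exp |w.im| := by
    rw [Complex.norm_exp]; simpa using le_abs_self w.im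
  rw [Complex.cos, norm_div, Complex.norm_two]
  linarith [norm_add_le (Complex.exp (w * Complex.I)) (Complex.exp (-w * Complex.I))]

/-- Averaging over reflections x_l ↦ ±x_l extracts the cosine series of a function that is even in
each variable, without using symmetries of its Fourier coefficients. -/
theorem prod_cos_eq_average {d : ℕ} (x : Fin d → ℂ) :
    ∏ l, Complex.cos (x l) = ∑ ε : Fin d → Bool,
      (1 / 2 : ℂ) ^ d * ∏ l, Complex.exp ((if ε l then x l else -x l) * Complex.I) := by
  have : ∀ l, Complex.cos (x l) =
      ∑ e : Bool, (1 / 2 : ℂ) * Complex.exp ((if e then x l else -x l) * Complex.I) := by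
    intro l
    simp [Complex.cos]
    ring
  simp_rw [this]
  rw [Finset.prod_univ_sum, Fintype.piFinset_univ]
  simp [Finset.prod_mul_distrib]

/-- Expansion of a Hamiltonian in a Fourier series in the angles and, after the substitution
`I = R cos (2π x)`, in a cosine series in `x`. -/
theorem exists_cosine_expansion {d : ℕ} {ρ r₀ : ℝ} (hρ : 0 < ρ) (hr₀ : 0 < r₀)
    {H : CSp d × CSp d → ℂ} (hH : MemA d ρ r₀ H) {M : ℝ}
    (hM : ∀ z ∈ complexDomain d ρ r₀, ‖H z‖ ≤ M) :
    ∃ a φ : (Fin d ⊕ Fin d → ℤ) → ℝ,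
      (∀ κ, 0 ≤ a κ ∧ a κ ≤ M * Real.exp (-(∑ l, Real.pi * ρ / (d + 1) * |(κ (Sum.inl l) : ℝ)| +
        ∑ l, 2 * |(κ (Sum.inr l) : ℝ)|))) ∧
      ∀ (θ : RSp d) (x : Fin d → ℝ),
        HasSum (fun κ => a κ * Real.cos (phase (fun l => κ (Sum.inl l)) θ + φ κ) *
            ∏ l, Real.cos ((κ (Sum.inr l) : ℝ) * x l))
          (realHam H (θ, WithLp.toLp 2 fun l => (r₀ / ((d + 1) * Real.exp 3) * Real.cos (x l) : ℝ))) := by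
  have hd : (0 : ℝ) < d + 1 := by positivity
  have hpi := Real.pi_pos
  -- For |Im 2πx| < 3 each |R cos 2πx| is at most r₀/(d+1), so the d components have total norm
  -- below r₀. The decay rate obtained below is 2, strictly less than 3.
  set R : ℝ := r₀ / ((d + 1) * Real.exp 3) with hR
  have hR0 : 0 < R := by positivity
  set b : Fin d ⊕ Fin d → ℝ := Sum.elim (fun _ => ρ / (d + 1)) (fun _ => 3 / (2 * Real.pi)) with hb
  set b' : Fin d ⊕ Fin d → ℝ :=
    Sum.elim (fun _ => ρ / (d + 1) / 2) (fun _ => 2 / (2 * Real.pi)) with hb'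
  set j : (Fin d ⊕ Fin d → ℂ) → CSp d × CSp d := fun z =>
    (WithLp.toLp 2 fun l => z (Sum.inl l),
      WithLp.toLp 2 fun l => (R : ℂ) * Complex.cos (2 * Real.pi * z (Sum.inr l))) with hj
  have hjmem : ∀ z ∈ strip b, j z ∈ complexDomain d ρ r₀ := by
    intro z hz
    constructor
    · refine (norm_toLp_le_sum _).trans_lt ?_
      have : ∑ l : Fin d, ‖(z (Sum.inl l)).im‖ ≤ ∑ _l : Fin d, ρ / (d + 1) :=
        Finset.sum_le_sum fun l _ => (hz (Sum.inl l)).le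
      refine this.trans_lt ?_
      simp only [Finset.sum_const, Finset.card_univ, Fintype.card_fin, nsmul_eq_mul]
      rw [mul_div_assoc', div_lt_iff₀ hd]
      nlinarith
    · refine (norm_toLp_le_sum _).trans_lt ?_
      have : ∑ l : Fin d, ‖(R : ℂ) * Complex.cos (2 * Real.pi * z (Sum.inr l))‖ ≤
          ∑ _l : Fin d, R * Real.exp 3 := by
        refine Finset.sum_le_sum fun l _ => ?_
        rw [norm_mul, Complex.norm_real, Real.norm_eq_abs, abs_of_pos hR0]
        refine mul_le_mul_of_nonneg_left ((norm_cos_le_exp _).trans (Real.exp_le_exp.2 ?_)) hR0.le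
        have h1 : (2 * (Real.pi : ℂ) * z (Sum.inr l)).im = 2 * Real.pi * (z (Sum.inr l)).im := by
          simp [Complex.mul_im, Complex.mul_re]
        have h2 : |(z (Sum.inr l)).im| < 3 / (2 * Real.pi) := hz (Sum.inr l)
        rw [h1, abs_mul, abs_of_pos (by positivity)]
        rw [lt_div_iff₀ (by positivity)] at h2
        linarith
      refine this.trans_lt ?_
      simp only [Finset.sum_const, Finset.card_univ, Fintype.card_fin, nsmul_eq_mul]
      have : R * Real.exp 3 = r₀ / (d + 1) := by rw [hR]; field_simp
      rw [this, mul_div_assoc', div_lt_iff₀ hd]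
      nlinarith
  have hjdiff : Differentiable ℂ j := by
    have hE : Differentiable ℂ fun f : Fin d → ℂ => (WithLp.toLp 2 f : CSp d) :=
      (PiLp.continuousLinearEquiv 2 ℂ fun _ : Fin d => ℂ).symm.differentiable
    refine Differentiable.prodMk (hE.comp ?_) (hE.comp ?_) <;> fun_prop
  have hper : ∀ z ∈ strip b, ∀ k : Fin d ⊕ Fin d → ℤ, H (j fun l => z l + k l) = H (j z) := by
    intro z hz k
    rw [← hH.periodic (j z) (hjmem z hz) fun l => k (Sum.inl l)]
    congr 1
    simp only [hj, Prod.mk.injEq]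
    constructor
    · ext l; simp [toC, intVec]
    · ext l
      simp only
      congr 1
      rw [← Complex.cos_add_int_mul_two_pi (2 * Real.pi * z (Sum.inr l)) (k (Sum.inr l))]
      congr 1
      ring
  obtain ⟨c, hc, hsum⟩ := exists_fourier_series (b := b) (b' := b')
    (by rintro (l | l) <;> simp only [hb', Sum.elim_inl, Sum.elim_inr] <;> positivity)
    (by
      rintro (l | l) <;> simp only [hb', hb, Sum.elim_inl, Sum.elim_inr]
      · exact half_lt_self (by positivity)
      · gcongr; norm_num)
    (hH.holo.comp hjdiff.differentiableOn hjmem) (fun z hz => hM _ (hjmem z hz)) hper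
  refine ⟨fun κ => ‖c κ‖, fun κ => (c κ).arg, fun κ => ⟨norm_nonneg _, (hc κ).trans (le_of_eq ?_)⟩,
    fun θ x => ?_⟩
  · congr 3
    rw [Fintype.sum_sum_type, mul_add, Finset.mul_sum, Finset.mul_sum]
    congr 1 <;> refine Finset.sum_congr rfl fun l _ => ?_ <;>
      simp only [hb', Sum.elim_inl, Sum.elim_inr] <;> field_simp
  have hε : ∀ ε : Fin d → Bool, HasSum (fun κ : Fin d ⊕ Fin d → ℤ => (1 / 2 : ℂ) ^ d *
      (c κ * Complex.exp (phase (fun l => κ (Sum.inl l)) θ * Complex.I) *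
        ∏ l, Complex.exp ((if ε l then (((κ (Sum.inr l) : ℝ) * x l : ℝ) : ℂ) else
          -(((κ (Sum.inr l) : ℝ) * x l : ℝ) : ℂ)) * Complex.I)))
      ((1 / 2 : ℂ) ^ d * H (toC θ, toC (WithLp.toLp 2 fun l => R * Real.cos (x l)))) := by
    intro ε
    refine HasSum.mul_left _ ?_
    have h := hsum (Sum.elim (fun l => θ l)
      fun l => (if ε l then x l else -x l) / (2 * Real.pi))
    have hval : (H ∘ j) (fun l => ((Sum.elim (fun l => θ l)
        (fun l => (if ε l then x l else -x l) / (2 * Real.pi)) l : ℝ) : ℂ)) =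
        H (toC θ, toC (WithLp.toLp 2 fun l => R * Real.cos (x l))) := by
      simp only [Function.comp_apply]
      congr 1
      simp only [hj, toC, Prod.mk.injEq, Sum.elim_inl, Sum.elim_inr, true_and]
      ext l
      simp only
      push_cast
      congr 1
      have : (Real.pi : ℂ) ≠ 0 := by exact_mod_cast hpi.ne'
      split_ifs
      · congr 1; field_simp
      · rw [← Complex.cos_neg]; congr 1; push_cast; field_simp
    rw [hval] at h
    refine h.congr_fun fun κ => ?_
    rw [mul_assoc]
    congr 1
    rw [character, Fintype.sum_sum_type, mul_add, Complex.exp_add]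
    congr 1
    · congr 1
      simp only [phase, Sum.elim_inl]
      push_cast
      ring
    · rw [← Complex.exp_sum, Finset.mul_sum]
      congr 1
      refine Finset.sum_congr rfl fun l _ => ?_
      have : (Real.pi : ℂ) ≠ 0 := by exact_mod_cast hpi.ne'
      simp only [Sum.elim_inr]
      split_ifs <;> push_cast <;> field_simp
  have htot := hasSum_sum (s := Finset.univ) fun ε _ => hε ε
  have hre := Complex.hasSum_re htot
  have hval : (∑ _ε : Fin d → Bool, (1 / 2 : ℂ) ^ d *
      H (toC θ, toC (WithLp.toLp 2 fun l => R * Real.cos (x l)))).re =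
      realHam H (θ, WithLp.toLp 2 fun l => R * Real.cos (x l)) := by
    rw [realHam, Finset.sum_const, Finset.card_univ, Fintype.card_fun, Fintype.card_bool,
      Fintype.card_fin, nsmul_eq_mul, ← mul_assoc]
    push_cast
    rw [← mul_pow]
    norm_num
  rw [hval] at hre
  refine hre.congr_fun fun κ => ?_
  · have hprod := prod_cos_eq_average fun l => (((κ (Sum.inr l) : ℝ) * x l : ℝ) : ℂ)
    have : (∑ ε : Fin d → Bool, (1 / 2 : ℂ) ^ d *
        (c κ * Complex.exp (phase (fun l => κ (Sum.inl l)) θ * Complex.I) *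
        ∏ l, Complex.exp ((if ε l then (((κ (Sum.inr l) : ℝ) * x l : ℝ) : ℂ) else
          -(((κ (Sum.inr l) : ℝ) * x l : ℝ) : ℂ)) * Complex.I))) =
        ‖c κ‖ * Complex.exp ((phase (fun l => κ (Sum.inl l)) θ + (c κ).arg : ℝ) * Complex.I) *
          ((∏ l, Real.cos ((κ (Sum.inr l) : ℝ) * x l) : ℝ) : ℂ) := by
      rw [Complex.ofReal_prod]
      simp_rw [Complex.ofReal_cos]
      rw [hprod, Finset.mul_sum]
      refine Finset.sum_congr rfl fun ε _ => ?_
      conv_lhs => rw [← Complex.norm_mul_exp_arg_mul_I (c κ)]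
      rw [Complex.ofReal_add, add_mul, Complex.exp_add]
      ring
    rw [this, Complex.re_mul_ofReal, Complex.re_ofReal_mul, Complex.exp_ofReal_mul_I_re]

/-- The coefficient of `x ^ α` in the product of Chebyshev polynomials `∏ T_{n_l}(x_l)`. -/
noncomputable def chebCoeff {d : ℕ} (n : Fin d → ℤ) (α : Fin d →₀ ℕ) : ℝ :=
  ∏ l, (Polynomial.Chebyshev.T ℝ (n l)).coeff (α l)

theorem coeff_chebyshev_eq_zero {n : ℤ} {a : ℕ} (h : n.natAbs + 1 ≤ a) :
    (Polynomial.Chebyshev.T ℝ n).coeff a = 0 :=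
  Polynomial.coeff_eq_zero_of_natDegree_lt (by rw [Polynomial.Chebyshev.natDegree_T]; omega)

theorem hasSum_abs_chebCoeff {d : ℕ} (n : Fin d → ℤ) :
    ∃ S ≤ ∏ l, (3 : ℝ) ^ (n l).natAbs, HasSum (fun α => |chebCoeff n α|) S := by
  refine ⟨_, ?_, (hasSum_prod_finsupp
    (fun l a => |(Polynomial.Chebyshev.T ℝ (n l)).coeff a|) (fun l => (n l).natAbs + 1)
    fun l a h => by rw [coeff_chebyshev_eq_zero h, abs_zero]).congr_fun
    fun α => by rw [chebCoeff, Finset.abs_prod]⟩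
  exact Finset.prod_le_prod (fun l _ => Finset.sum_nonneg fun _ _ => abs_nonneg _)
    fun l _ => sum_abs_coeff_chebyshev_le _ _

theorem hasSum_chebCoeff {d : ℕ} (n : Fin d → ℤ) (x : Fin d → ℝ) :
    HasSum (fun α : Fin d →₀ ℕ => chebCoeff n α * ∏ l, Real.cos (x l) ^ α l)
      (∏ l, Real.cos ((n l : ℝ) * x l)) := by
  have h := hasSum_prod_finsupp
    (fun l a => (Polynomial.Chebyshev.T ℝ (n l)).coeff a * Real.cos (x l) ^ a)
    (fun l => (n l).natAbs + 1) fun l a h => by rw [coeff_chebyshev_eq_zero h, zero_mul]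
  have hval : ∏ l, ∑ a ∈ Finset.range ((n l).natAbs + 1),
      (Polynomial.Chebyshev.T ℝ (n l)).coeff a * Real.cos (x l) ^ a =
      ∏ l, Real.cos ((n l : ℝ) * x l) := by
    refine Finset.prod_congr rfl fun l _ => ?_
    rw [← Polynomial.Chebyshev.T_real_cos, Polynomial.eval_eq_sum_range' (n := (n l).natAbs + 1)]
    rw [Polynomial.Chebyshev.natDegree_T]
    omega
  rw [hval] at h
  exact h.congr_fun fun α => by rw [chebCoeff, Finset.prod_mul_distrib]

/-- Fourier-Taylor expansion of a Hamiltonian, with weighted coefficients summable in terms of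
its sup norm. -/
theorem exists_taylor_fourier_expansion (d : ℕ) {ρ r₀ : ℝ} (hρ : 0 < ρ) (hr₀ : 0 < r₀) :
    ∃ s R A : ℝ, 0 < s ∧ 0 < R ∧ 0 < A ∧ ∀ (H : CSp d × CSp d → ℂ) (M : ℝ), MemA d ρ r₀ H →
      (∀ z ∈ complexDomain d ρ r₀, ‖H z‖ ≤ M) →
      ∃ (h : (Fin d →₀ ℕ) → RSp d × RSp d → ℝ) (c : (Fin d →₀ ℕ) → ℝ),
        (∀ α, IsTrig s 0 (c α) (h α)) ∧ Summable (fun α => c α * R ^ α.degree) ∧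
        ∑' α, c α * R ^ α.degree ≤ A * M ∧
        ∀ θ J : RSp d, (∀ l, |J l| ≤ R) →
          HasSum (fun α => h α (θ, 0) * powMon α J) (realHam H (θ, J)) := by
  have hpi := Real.pi_pos
  have hd : (0 : ℝ) < d + 1 := by positivity
  -- Half of the available decay rate: one half is the weight of `IsTrig`, the other makes the sum
  -- over frequencies converge. In the actions the corresponding ratio is 3e^{-2} < 1.
  set s : ℝ := Real.pi * ρ / (d + 1) / 2 with hs
  have hs0 : 0 < s := by positivity
  set R : ℝ := r₀ / ((d + 1) * Real.exp 3) with hR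
  have hR0 : 0 < R := by positivity
  set q : Fin d ⊕ Fin d → ℝ :=
    Sum.elim (fun _ => Real.exp (-s)) (fun _ => 3 * Real.exp (-2)) with hq
  have hq0 : ∀ x, 0 < q x := by
    rintro (l | l) <;> simp only [hq, Sum.elim_inl, Sum.elim_inr] <;> positivity
  have hq1 : ∀ x, q x < 1 := by
    rintro (l | l) <;> simp only [hq, Sum.elim_inl, Sum.elim_inr]
    · rw [Real.exp_lt_one_iff]; linarith
    · rw [Real.exp_neg, mul_inv_lt_iff₀ (Real.exp_pos _), one_mul]
      have := Real.quadratic_le_exp_of_nonneg (x := 2) (by norm_num)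
      linarith
  have hQ : Summable fun κ : Fin d ⊕ Fin d → ℤ => ∏ x, q x ^ (κ x).natAbs := by
    refine summable_prod_pi (fun x (k : ℤ) => q x ^ k.natAbs)
      (fun x k => pow_nonneg (hq0 x).le _) fun x => ?_
    have := summable_geometric_of_lt_one (hq0 x).le (hq1 x)
    exact Summable.of_nat_of_neg (by simpa using this) (by simpa using this)
  set A₀ : ℝ := ∑' κ : Fin d ⊕ Fin d → ℤ, ∏ x, q x ^ (κ x).natAbs with hA₀
  have hA₀0 : 0 ≤ A₀ := tsum_nonneg fun κ => Finset.prod_nonneg fun x _ => pow_nonneg (hq0 x).le _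
  refine ⟨s, R, A₀ + 1, hs0, hR0, by linarith, fun H M hH hM => ?_⟩
  have hM0 : 0 ≤ M := by
    refine (norm_nonneg _).trans (hM (0, 0) ⟨?_, by simpa using hr₀⟩)
    have : imPart (0 : CSp d) = 0 := by ext l; simp [imPart]
    simpa [this] using hρ
  obtain ⟨a, φ, ha, hexp⟩ := exists_cosine_expansion hρ hr₀ hH hM
  -- Absolute summability over frequencies and monomials together, so that the Chebyshev polynomials
  -- can be expanded and the sum regrouped by powers of I.
  set W : (Fin d ⊕ Fin d → ℤ) × (Fin d →₀ ℕ) → ℝ := fun x =>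
    a x.1 * Real.exp (s * latNorm fun l => x.1 (Sum.inl l)) *
      |chebCoeff (fun l => x.1 (Sum.inr l)) x.2| with hW
  have hW0 : 0 ≤ W := fun x =>
    mul_nonneg (mul_nonneg (ha x.1).1 (Real.exp_pos _).le) (abs_nonneg _)
  have hrow : ∀ κ, ∃ D ≤ M * ∏ x, q x ^ (κ x).natAbs, HasSum (fun α => W (κ, α)) D := by
    intro κ
    obtain ⟨S, hS, hsum⟩ := hasSum_abs_chebCoeff fun l => κ (Sum.inr l)
    refine ⟨a κ * Real.exp (s * latNorm fun l => κ (Sum.inl l)) * S, ?_,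
      hsum.mul_left (a κ * Real.exp (s * latNorm fun l => κ (Sum.inl l)))⟩
    have h1 : a κ * Real.exp (s * latNorm fun l => κ (Sum.inl l)) * S ≤
        M * Real.exp (-(∑ l, Real.pi * ρ / (d + 1) * |(κ (Sum.inl l) : ℝ)| +
          ∑ l, 2 * |(κ (Sum.inr l) : ℝ)|)) * Real.exp (s * latNorm fun l => κ (Sum.inl l)) *
          ∏ l, (3 : ℝ) ^ (κ (Sum.inr l)).natAbs := by
      refine mul_le_mul (mul_le_mul_of_nonneg_right (ha κ).2 (Real.exp_pos _).le) hS ?_ ?_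
      · exact hsum.nonneg fun _ => abs_nonneg _
      · positivity
    refine h1.trans (le_of_eq ?_)
    rw [mul_assoc, mul_assoc, Fintype.prod_sum_type]
    congr 1
    have h2 : ∀ l, q (Sum.inl l) ^ (κ (Sum.inl l)).natAbs =
        Real.exp (-(s * |(κ (Sum.inl l) : ℝ)|)) := by
      intro l
      rw [hq, Sum.elim_inl, ← Real.exp_nat_mul, Nat.cast_natAbs, Int.cast_abs]
      congr 1; ring
    have h3 : ∀ l, q (Sum.inr l) ^ (κ (Sum.inr l)).natAbs =
        Real.exp (-(2 * |(κ (Sum.inr l) : ℝ)|)) * 3 ^ (κ (Sum.inr l)).natAbs := by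
      intro l
      rw [hq, Sum.elim_inr, mul_pow, ← Real.exp_nat_mul, Nat.cast_natAbs, Int.cast_abs, mul_comm]
      congr 2; ring
    simp_rw [h2, h3]
    rw [Finset.prod_mul_distrib, ← Real.exp_sum, ← Real.exp_sum, ← mul_assoc, ← mul_assoc,
      ← Real.exp_add, ← Real.exp_add]
    congr 2
    simp only [Finset.sum_neg_distrib, latNorm, ← Finset.mul_sum, hs]
    ring
  choose D hDle hD using hrow
  have hD0 : ∀ κ, 0 ≤ D κ := fun κ => (hD κ).nonneg fun α => hW0 (κ, α)
  have hDs : Summable D := Summable.of_nonneg_of_le hD0 hDle (hQ.mul_left M)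
  have hWs : Summable W := by
    refine (summable_prod_of_nonneg hW0).2 ⟨fun κ => (hD κ).summable, ?_⟩
    exact hDs.congr fun κ => (hD κ).tsum_eq.symm
  have hWt : HasSum W (∑' κ, D κ) := by
    have := hWs.hasSum.prod_fiberwise hD
    rw [this.tsum_eq]
    exact hWs.hasSum
  have hWs' : HasSum (fun x : (Fin d →₀ ℕ) × (Fin d ⊕ Fin d → ℤ) => W (x.2, x.1)) (∑' κ, D κ) :=
    (Equiv.prodComm (Fin d →₀ ℕ) (Fin d ⊕ Fin d → ℤ)).hasSum_iff (f := W).2 hWt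
  have hcol : ∀ α, Summable fun κ => W (κ, α) := fun α => hWs'.summable.prod_factor α
  have htr : ∀ α, _ := fun α => isTrig_tsum (d := d) s hs0.le 0
    (fun κ => a κ * chebCoeff (fun l => κ (Sum.inr l)) α / R ^ α.degree) φ
    (fun κ l => κ (Sum.inl l)) (fun _ => 0) (fun _ => by simp) (fun κ => W (κ, α) / R ^ α.degree)
    ((hcol α).div_const _) fun κ => le_of_eq <| by
      simp only [hW]
      rw [abs_div, abs_mul, abs_of_nonneg (ha κ).1, abs_of_pos (pow_pos hR0 _)]
      ring
  refine ⟨_, _, fun α => (htr α).1, ?_⟩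
  have hcR : ∀ α : Fin d →₀ ℕ, (∑' κ, W (κ, α) / R ^ α.degree) * R ^ α.degree = ∑' κ, W (κ, α) := by
    intro α
    rw [tsum_div_const, div_mul_cancel₀ _ (pow_pos hR0 _).ne']
  simp_rw [hcR]
  have hcs := hWs'.prod_fiberwise fun α => (hcol α).hasSum
  refine ⟨hcs.summable, ?_, fun θ J hJ => ?_⟩
  · rw [hcs.tsum_eq]
    have : ∑' κ, D κ ≤ M * A₀ := by
      rw [hA₀, ← tsum_mul_left]
      exact hDs.tsum_le_tsum hDle (hQ.mul_left M)
    linarith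
  set x : Fin d → ℝ := fun l => Real.arccos (J l / R) with hx
  have hJR : ∀ l, |J l / R| ≤ 1 := fun l => by
    rw [abs_div, abs_of_pos hR0, div_le_one hR0]; exact hJ l
  have hcos : ∀ l, Real.cos (x l) = J l / R := fun l =>
    Real.cos_arccos (abs_le.1 (hJR l)).1 (abs_le.1 (hJR l)).2
  set u : (Fin d ⊕ Fin d → ℤ) × (Fin d →₀ ℕ) → ℝ := fun y =>
    a y.1 * Real.cos (phase (fun l => y.1 (Sum.inl l)) θ + φ y.1) *
      (chebCoeff (fun l => y.1 (Sum.inr l)) y.2 * ∏ l, Real.cos (x l) ^ y.2 l) with hu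
  have huW : ∀ y, ‖u y‖ ≤ W y := by
    intro y
    simp only [hu, hW, Real.norm_eq_abs, abs_mul, abs_of_nonneg (ha y.1).1]
    have h1 : |∏ l, Real.cos (x l) ^ y.2 l| ≤ 1 := by
      rw [Finset.abs_prod]
      refine Finset.prod_le_one (fun _ _ => abs_nonneg _) fun l _ => ?_
      rw [abs_pow]
      exact pow_le_one₀ (abs_nonneg _) (Real.abs_cos_le_one _)
    have h2 : |Real.cos (phase (fun l => y.1 (Sum.inl l)) θ + φ y.1)| ≤
        Real.exp (s * latNorm fun l => y.1 (Sum.inl l)) :=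
      (Real.abs_cos_le_one _).trans (Real.one_le_exp (mul_nonneg hs0.le (latNorm_nonneg _)))
    refine mul_le_mul (mul_le_mul_of_nonneg_left h2 (ha y.1).1)
      (mul_le_of_le_one_right (abs_nonneg _) h1) (by positivity) ?_
    exact mul_nonneg (ha y.1).1 (Real.exp_pos _).le
  have hus : Summable u := Summable.of_norm_bounded hWs huW
  have huk := hus.hasSum.prod_fiberwise fun κ =>
    (hasSum_chebCoeff (fun l => κ (Sum.inr l)) x).mul_left
      (a κ * Real.cos (phase (fun l => κ (Sum.inl l)) θ + φ κ))
  have hJeq : (WithLp.toLp 2 fun l => R * Real.cos (x l) : RSp d) = J := by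
    ext l
    simp only [hcos]
    field_simp
  have hval : ∑' y, u y = realHam H (θ, J) := by
    rw [huk.unique (hexp θ x), ← hR, hJeq]
  have hut : HasSum (fun y : (Fin d →₀ ℕ) × (Fin d ⊕ Fin d → ℤ) => u (y.2, y.1))
      (realHam H (θ, J)) := by
    rw [← hval]
    exact (Equiv.prodComm (Fin d →₀ ℕ) (Fin d ⊕ Fin d → ℤ)).hasSum_iff (f := u).2 hus.hasSum
  refine hut.prod_fiberwise fun α => ?_
  refine (((htr α).2 (θ, 0)).hasSum.mul_right (powMon α J)).congr_fun fun κ => ?_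
  simp only [hu, hcos, powMon, div_pow, Finset.prod_div_distrib, Finset.prod_pow_eq_pow_sum,
    Finsupp.degree_eq_sum, Finsupp.coe_zero, Pi.zero_apply, pow_zero, Finset.prod_const_one]
  ring

/-! ### Taylor polynomials and the linear part -/

/-- The multi-indices of degree `p`. -/
def degSet (d p : ℕ) : Finset (Fin d →₀ ℕ) := Finset.finsuppAntidiag Finset.univ p

theorem mem_degSet {d p : ℕ} {α : Fin d →₀ ℕ} : α ∈ degSet d p ↔ α.degree = p := by
  simp [degSet, Finset.mem_finsuppAntidiag, Finsupp.degree_eq_sum]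

theorem pairwiseDisjoint_degSet {d : ℕ} (s : Set ℕ) : s.PairwiseDisjoint (degSet d) := by
  intro p _ q _ hpq
  refine Finset.disjoint_left.2 fun α hp hq => hpq ?_
  rw [← mem_degSet.1 hp, mem_degSet.1 hq]

/-- Taylor remainder estimate for a power series with bounded weighted coefficients. -/
theorem abs_sub_sum_degSet_le {d : ℕ} {a c : (Fin d →₀ ℕ) → ℝ} {R : ℝ} (hR : 0 < R)
    (ha : ∀ α, |a α| ≤ c α) (hc : Summable fun α => c α * R ^ α.degree) {J : RSp d} {F : ℝ}
    (hJ : ‖J‖ ≤ R) (hF : HasSum (fun α => a α * powMon α J) F) (m : ℕ) :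
    |F - ∑ p ∈ Finset.range (m + 1), ∑ α ∈ degSet d p, a α * powMon α J| ≤
      (∑' α, c α * R ^ α.degree) / R ^ (m + 1) * ‖J‖ ^ (m + 1) := by
  classical
  have hc0 : ∀ α, 0 ≤ c α := fun α => (abs_nonneg _).trans (ha α)
  set D := (Finset.range (m + 1)).biUnion (degSet d) with hD
  have hDm : ∀ α, α ∈ D ↔ α.degree ≤ m := by
    intro α
    simp [hD, mem_degSet]
  rw [← Finset.sum_biUnion (pairwiseDisjoint_degSet _), ← hD]
  have h1 : HasSum (fun α => if α ∈ D then a α * powMon α J else 0)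
      (∑ α ∈ D, a α * powMon α J) := by
    have := hasSum_sum_of_ne_finset_zero (s := D)
      (f := fun α => if α ∈ D then a α * powMon α J else 0) (L := SummationFilter.unconditional _)
      fun α hα => if_neg hα
    rwa [Finset.sum_congr rfl fun α hα => if_pos hα] at this
  have h2 := hc.hasSum.mul_right ((‖J‖ / R) ^ (m + 1))
  refine (HasSum.norm_le_of_bounded (hF.sub h1) h2 fun α => ?_).trans (le_of_eq ?_)
  · split_ifs with hα
    · rw [sub_self, norm_zero]
      have := hc0 α
      positivity
    · rw [hDm, not_le] at hα
      rw [sub_zero, Real.norm_eq_abs, abs_mul]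
      calc |a α| * |powMon α J| ≤ c α * ‖J‖ ^ α.degree :=
            mul_le_mul (ha α) (abs_powMon_le α J) (abs_nonneg _) (hc0 α)
        _ = c α * R ^ α.degree * (‖J‖ / R) ^ α.degree := by
            rw [div_pow]; field_simp
        _ ≤ c α * R ^ α.degree * (‖J‖ / R) ^ (m + 1) := by
            refine mul_le_mul_of_nonneg_left ?_ (mul_nonneg (hc0 α) (pow_pos hR _).le)
            exact pow_le_pow_of_le_one (by positivity) ((div_le_one hR).2 hJ) hα
  · rw [div_pow]; ring

theorem sum_degSet_smul {d : ℕ} (a : (Fin d →₀ ℕ) → ℝ) (p : ℕ) (t : ℝ) (J : RSp d) :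
    ∑ α ∈ degSet d p, a α * powMon α (t • J) = t ^ p * ∑ α ∈ degSet d p, a α * powMon α J := by
  rw [Finset.mul_sum]
  refine Finset.sum_congr rfl fun α hα => ?_
  rw [powMon_smul, mem_degSet.1 hα]
  ring

/-- The Taylor coefficients of order at most one are determined by the linear part. -/
theorem sum_degSet_low_order {d : ℕ} {a c : (Fin d →₀ ℕ) → ℝ} {R : ℝ} (hR : 0 < R)
    (ha : ∀ α, |a α| ≤ c α) (hc : Summable fun α => c α * R ^ α.degree) {F : RSp d → ℝ}
    (hF : ∀ J, ‖J‖ ≤ R → HasSum (fun α => a α * powMon α J) (F J)) {ω : RSp d} {C δ : ℝ}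
    (hδ : 0 < δ) (hlin : ∀ J, ‖J‖ < δ → |F J - ∑ l, ω l * J l| ≤ C * ‖J‖ ^ 2) (J : RSp d) :
    ∑ p ∈ Finset.range 2, ∑ α ∈ degSet d p, a α * powMon α J = ∑ l, ω l * J l := by
  set Q : ℕ → ℝ := fun p => ∑ α ∈ degSet d p, a α * powMon α J with hQ
  set b : ℕ → ℝ := fun p => if p = 0 then Q 0 else Q 1 - ∑ l, ω l * J l with hb
  -- Along the ray tJ the difference of the two affine functions of t is O(t²), so both of its
  -- coefficients vanish.
  have key := coeff_eq_zero_of_bound 1 b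
    ((C + (∑' α, c α * R ^ α.degree) / R ^ 2) * ‖J‖ ^ 2) (min δ R / (‖J‖ + 1)) (by positivity) ?_
  · have h0 := key 0 (by norm_num)
    have h1 := key 1 le_rfl
    simp only [hb, if_true, one_ne_zero, if_false] at h0 h1
    rw [Finset.sum_range_succ, Finset.sum_range_one]
    change Q 0 + Q 1 = _
    linarith
  intro t ht htδ
  rw [lt_div_iff₀ (by positivity)] at htδ
  have hn : ‖t • J‖ = t * ‖J‖ := by rw [norm_smul, Real.norm_of_nonneg ht.le]
  have hlt : ‖t • J‖ < min δ R := by rw [hn]; nlinarith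
  have e1 := hlin (t • J) (hlt.trans_le (min_le_left _ _))
  have hle : ‖t • J‖ ≤ R := (hlt.trans_le (min_le_right _ _)).le
  have e2 := abs_sub_sum_degSet_le hR ha hc hle (hF _ hle) 1
  simp only [sum_degSet_smul] at e2
  rw [Finset.sum_range_succ, Finset.sum_range_one] at e2
  change |F (t • J) - (t ^ 0 * Q 0 + t ^ 1 * Q 1)| ≤ _ at e2
  have e3 : ∑ l, ω l * (t • J) l = t * ∑ l, ω l * J l := by
    rw [Finset.mul_sum]
    exact Finset.sum_congr rfl fun l _ => by simp; ring
  rw [e3] at e1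
  rw [Finset.sum_range_succ, Finset.sum_range_one]
  have e4 : b 0 * t ^ 0 + b 1 * t ^ 1 = (F (t • J) - t * ∑ l, ω l * J l) -
      (F (t • J) - (t ^ 0 * Q 0 + t ^ 1 * Q 1)) := by
    simp only [hb, if_true, one_ne_zero, if_false]
    ring
  rw [e4]
  refine (abs_sub _ _).trans ((add_le_add e1 e2).trans (le_of_eq ?_))
  rw [hn]
  ring

theorem coeff_zero_pderiv {d : ℕ} (i : Fin d) (F : MvPolynomial (Fin d) ℝ) :
    (MvPolynomial.pderiv i F).coeff 0 = F.coeff (Finsupp.single i 1) := by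
  simp [MvPolynomial.coeff_pderiv]

theorem grad_truncBNF_zero {d : ℕ} {N : MvPowerSeries (Fin d) ℝ} {ω : RSp d}
    (h : ∀ v, evalAt (homPart N 1) v = ∑ l, ω l * v l) {m : ℕ} (hm : 1 ≤ m) :
    grad (truncBNF N m) 0 = ω := by
  have hpoly : homPart N 1 = ∑ l, MvPolynomial.C (ω l) * MvPolynomial.X l := by
    refine MvPolynomial.funext fun v => ?_
    have := h (WithLp.toLp 2 v)
    simpa [evalAt] using this
  ext i
  have h1 := congrArg (MvPolynomial.coeff (Finsupp.single i 1)) hpoly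
  simp only [homPart, MvPolynomial.coeff_homogeneousComponent, coeff_truncBNF,
    Finsupp.degree_single, if_true, le_refl, MvPolynomial.coeff_sum, MvPolynomial.coeff_C_mul,
    MvPolynomial.coeff_X, mul_ite, mul_one, mul_zero] at h1
  simp only [grad]
  rw [evalAt_zero, coeff_zero_pderiv, coeff_truncBNF, Finsupp.degree_single, if_pos hm, h1]
  rw [Finset.sum_eq_single i]
  · simp
  · intro l _ hl
    rw [if_neg]
    intro hs
    exact hl (Finsupp.single_left_injective one_ne_zero hs)
  · simp

/-! ### Gevrey growth of the normal form -/

/-- Growth estimate for the Birkhoff normal form. -/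
theorem exists_growth_bound (d : ℕ) {γ τ ρ r₀ : ℝ} (M : ℝ) (hγ : 0 < γ) (hτ : 0 < τ + 1)
    (hρ : 0 < ρ) (hr₀ : 0 < r₀) :
    ∃ B : ℝ, 0 < B ∧ ∀ (H : CSp d × CSp d → ℂ) (ω : RSp d) (N : MvPowerSeries (Fin d) ℝ),
      MemA d ρ r₀ H → supNorm d ρ r₀ H ≤ M → ω ∈ DC d τ γ → HasLinearPart H ω → IsBNF H N →
      (∀ j, 2 ≤ j → coeffNorm (homPart N j) ≤ (B * (j : ℝ) ^ (τ + 1)) ^ (j - 1)) ∧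
      ∀ m, 1 ≤ m → grad (truncBNF N m) 0 = ω := by
  classical
  obtain ⟨s, R, A, hs, hR, hA, hexp⟩ := exists_taylor_fourier_expansion d hρ hr₀
  -- The absolute value is needed because B is fixed before any H is given, and M is not assumed
  -- nonnegative.
  set A' := 8 ^ d * (A * |M|) * (32 / R) ^ 2 with hA'
  have hA'0 : 0 ≤ A' := by positivity
  set L := ((τ + 1) / s) ^ (τ + 1) / γ with hL
  have hL0 : 0 ≤ L := by positivity
  -- One summand for each of the three requirements on κ = B m^{τ+1}. The power of m comes from the
  -- last one, through the width s/m in the small divisor factor.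
  refine ⟨32 / R + A' + L * A', by positivity, fun H ω N hH hM hω hlin hN => ?_⟩
  set B := 32 / R + A' + L * A' with hB
  have hbd : ∀ z ∈ complexDomain d ρ r₀, ‖H z‖ ≤ |M| := fun z hz =>
    ((le_csSup hH.bounded (Set.mem_image_of_mem (fun z => ‖H z‖) hz)).trans hM).trans (le_abs_self M)
  obtain ⟨h, c, hh, hcs, hct, hsum⟩ := hexp H |M| hH hbd
  have hcoord : ∀ J : RSp d, ‖J‖ ≤ R → ∀ l, |J l| ≤ R := fun J hJ l =>
    (PiLp.norm_apply_le J l).trans hJ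
  have hhc : ∀ θ α, |h α (θ, 0)| ≤ c α := fun θ α => by
    simpa using (hh α).abs_le hs.le (θ, 0)
  obtain ⟨C₀, δ₀, hC₀, hδ₀, hb₀⟩ := exists_bound_of_isBigO_zeroSection hlin
  have hlow : ∀ θ J : RSp d, ∑ p ∈ Finset.range 2, ∑ α ∈ degSet d p, h α (θ, 0) * powMon α J =
      ∑ l, ω l * J l := fun θ => sum_degSet_low_order hR (hhc θ) hcs
        (F := fun J => realHam H (θ, J)) (fun J hJ => hsum θ J (hcoord J hJ)) (C := C₀) hδ₀
        fun J hJ => by simpa using hb₀ θ J hJ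
  have main : ∀ m, 2 ≤ m → (∀ v, evalAt (homPart N 1) v = ∑ l, ω l * v l) ∧
      coeffNorm (homPart N m) ≤ (B * (m : ℝ) ^ (τ + 1)) ^ (m - 1) := by
    intro m hm
    have hm1 : (1 : ℝ) ≤ m := by exact_mod_cast (by omega : 1 ≤ m)
    have hm0 : (0 : ℝ) < m := by linarith
    have hmp : 1 ≤ (m : ℝ) ^ (τ + 1) := Real.one_le_rpow hm1 hτ.le
    have hB0 : 0 ≤ B := by positivity
    set T := (Finset.Ico 2 (m + 1)).biUnion (degSet d) with hT
    have hTdeg : ∀ α ∈ T, 2 ≤ α.degree := by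
      intro α hα
      simp only [hT, Finset.mem_biUnion, Finset.mem_Ico, mem_degSet] at hα
      obtain ⟨p, hp, hαp⟩ := hα
      omega
    set h' : (Fin d →₀ ℕ) → bddAlg d := fun α => ⟨h α, (hh α).mem_bddAlg hs.le⟩ with hh'
    have hconst : ∀ α θ I, (h' α : RSp d × RSp d → ℝ) (θ, I) =
        (h' α : RSp d × RSp d → ℝ) (θ, 0) := fun α θ I => by
      have := (hh α).smul_right 0 θ I
      simpa using this.symm
    have hcT : ∑ α ∈ T, c α * R ^ α.degree ≤ A * |M| :=
      (hcs.sum_le_tsum T fun α _ => mul_nonneg (hh α).nonneg (pow_pos hR _).le).trans hct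
    have hBle : B ≤ B * (m : ℝ) ^ (τ + 1) := le_mul_of_one_le_right hB0 hmp
    obtain ⟨W, S, n, hW0, hW, hstep⟩ := exists_formal_solution hγ hτ hω hs hR
      (κ := B * (m : ℝ) ^ (τ + 1)) m (by omega) T hTdeg h' c hh hcT (by
        have h1 : 32 / R ≤ B * (m : ℝ) ^ (τ + 1) :=
          le_trans (by rw [hB]; nlinarith [mul_nonneg hL0 hA'0]) hBle
        rw [div_le_iff₀ hR] at h1
        linarith) (by
        have h1 : A' ≤ B := by
          have : 0 < 32 / R := by positivity
          rw [hB]; nlinarith [mul_nonneg hL0 hA'0]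
        exact h1.trans hBle) (by
        have h1 : ((τ + 1) / (s / m)) ^ (τ + 1) / γ * A' = L * A' * (m : ℝ) ^ (τ + 1) := by
          rw [div_div_eq_mul_div, mul_div_right_comm,
            Real.mul_rpow (by positivity) hm0.le, hL]
          ring
        rw [h1]
        refine mul_le_mul_of_nonneg_right ?_ (by linarith)
        have : 0 < 32 / R := by positivity
        rw [hB]; linarith)
    obtain ⟨s', Ψ, hs', hΨ, hΨ1, hΨ2, hP⟩ := hN m hm
    have hray := exists_bound_sub_formal m (by omega) T hTdeg h' hconst W S n hW0 hW hstep
      (realHam H) ((∑' α, c α * R ^ α.degree) / R ^ (m + 1)) R hR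
      (div_nonneg (tsum_nonneg fun α => mul_nonneg (hh α).nonneg (pow_pos hR _).le)
        (pow_pos hR _).le)
      (fun θ J hJ => by
        have := abs_sub_sum_degSet_le hR (hhc θ) hcs hJ.le (hsum θ J (hcoord J hJ.le)) m
        rwa [← Finset.sum_range_add_sum_Ico _ (by omega : 2 ≤ m + 1), hlow θ J,
          ← Finset.sum_biUnion (pairwiseDisjoint_degSet _)] at this)
      s' hs' Ψ hΨ hΨ1 hΨ2 (truncBNF N m) hP
    -- The scheme is run anew for each m and only its last degree is used, so the loss s/m is
    -- matched to the degree being estimated.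
    obtain ⟨g1, g2⟩ := homPart_eq_formal m (by omega) N n hray
    refine ⟨g1, ?_⟩
    have h1 := g2 (m - 1) (by omega) (by omega)
    rw [Nat.sub_add_cancel (by omega : 1 ≤ m)] at h1
    rw [h1]
    exact (hstep (m - 1) (by omega) (by omega)).coeffNorm_le
  exact ⟨fun j hj => (main j hj).2, fun m hm => grad_truncBNF_zero (main 2 le_rfl).1 hm⟩

end Birkhoff

/-! ### The measure estimate -/

theorem mainTheorem4
    (d : ℕ) (γ τ ρ r₀ M : ℝ) (hγ : 0 < γ) (hτ : (d : ℝ) - 1 ≤ τ) (hρ : 0 < ρ) (hr₀ : 0 < r₀)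
    (m : ℕ) (P : MvPolynomial (Fin d) ℝ) :
    ∃ c₀ : ℝ, 0 < c₀ ∧ ∀ c : ℝ, 0 < c → c ≤ c₀ →
      ∃ C r' γ' : ℝ, 0 < C ∧ 0 < r' ∧ 0 < γ' ∧
        ∀ (H : Birkhoff.CSp d × Birkhoff.CSp d → ℂ) (ω : Birkhoff.RSp d)
          (N : MvPowerSeries (Fin d) ℝ),
          Birkhoff.MemA d ρ r₀ H →
          Birkhoff.supNorm d ρ r₀ H ≤ M →
          ω ∈ Birkhoff.DC d τ γ →
          Birkhoff.HasLinearPart H ω →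
          Birkhoff.IsBNF H N →
          Birkhoff.mStar N = m →
          Birkhoff.truncBNF N m = P →
          2 ≤ Module.finrank ℝ (Birkhoff.freqSpaceLim N) →
          Module.finrank ℝ (Birkhoff.freqSpaceLim N) ≤ d - 1 →
          ∀ r γb : ℝ, 0 < r → r < r' → 0 < γb → γb < γ' →
            MeasureTheory.volume
              {I : Birkhoff.RSp d | ‖I‖ < 2 * r ∧
                Birkhoff.grad (Birkhoff.truncBNF N (Birkhoff.truncOrder c τ r)) I ∉
                  Birkhoff.DC d (((m : ℝ) - 1) * ((d : ℝ) + 1) + τ + 1) γb}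
              ≤ ENNReal.ofReal (C * γb ^ (1 / ((m : ℝ) - 1)) * r ^ (d - 1)) := by
  by_cases hd : 3 ≤ d
  swap
  -- For d ≤ 2 the two bounds on the dimension contradict each other.
  · exact ⟨1, one_pos, fun c _ _ => ⟨1, 1, 1, one_pos, one_pos, one_pos,
      fun H ω N _ _ _ _ _ _ _ h2 h3 => by omega⟩⟩
  have hd3 : (3 : ℝ) ≤ d := by exact_mod_cast hd
  have hτ1 : 0 < τ + 1 := by linarith
  obtain ⟨B, hB, hgrowth⟩ := Birkhoff.exists_growth_bound d M hγ hτ1 hρ hr₀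
  -- Chosen so that 6B c^{τ+1} ≤ 1/2, the ratio of the geometric series on the ball of radius 6r.
  refine ⟨(1 / (12 * B)) ^ (1 / (τ + 1)), by positivity, fun c hc hcc => ?_⟩
  have hcB : 6 * B * c ^ (τ + 1) ≤ 1 / 2 := by
    have h1 : c ^ (τ + 1) ≤ 1 / (12 * B) := by
      have h2 := Real.rpow_le_rpow hc.le hcc hτ1.le
      rwa [← Real.rpow_mul (by positivity), one_div_mul_cancel hτ1.ne', Real.rpow_one] at h2
    calc 6 * B * c ^ (τ + 1) ≤ 6 * B * (1 / (12 * B)) := by gcongr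
      _ = 1 / 2 := by field_simp; norm_num
  obtain ⟨C, r', γ', hC, hr', hγ', hmeas⟩ :=
    Birkhoff.exists_measure_bound_of_growth d hd γ τ B c hγ hτ hB hc hcB m P
  refine ⟨C, r', γ', hC, hr', hγ', fun H ω N hH hM hω hlin hN hm hP h2 _ => ?_⟩
  obtain ⟨hg, hgrad⟩ := hgrowth H ω N hH hM hω hlin hN
  have hm2 : 2 ≤ m := hm ▸ Birkhoff.two_le_mStar N h2
  exact hmeas ω N hω (hgrad m (by omega)) hg hm hP h2
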